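/- Let $H$ be a commutative Hopf $*$-algebra over $\mathbb{C}$ and let $P$ be a $*$-algebra over $\mathbb{C}$ which is a right $H$-comodule algebra with coaction $\delta(p)=p_{(0)}\otimes p_{(1)}$. Assume that the coaction is unitary, i.e. $\delta(p^*)=p_{(0)}{}^*\otimes p_{(1)}{}^*$. Let $B=P^{co H}=\{b\in P:\delta(b)=b\otimes 1\}$ and assume that $B\subseteq P$ is a faithfully flat $H$-Galois extension, i.e. the canonical map $\chi:P\otimes_BP\to P\otimes H$, $\chi(q\otimes p)=qp_{(0)}\otimes p_{(1)}$, is bijective and $P$ is faithfully flat as a left $B$-module. Write $\tau(h)=\chi^{-1}(1\otimes h)=h^{\langle 1\rangle}\otimes_B h^{\langle 2\rangle}$, and let $$\mathcal{L}=\mathcal{L}(P,H)=\{p\otimes q\in P\otimes P:\ p_{(0)}\otimes q_{(0)}\otimes p_{(1)}q_{(1)}=p\otimes q\otimes 1\}$$ (sums understood), with product $(p\otimes q)(r\otimes u)=pr\otimes uq$, source map $s_L(b)=b\otimes 1$ and target map $t_L(b)=1\otimes b$. Then the canonical map $\mathcal{L}\otimes_B\mathcal{L}\to P\otimes(P\otimes_BP)\otimes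 P$ is injective, the formulas $$\Delta_L(p\otimes q)=p_{(0)}\otimes p_{(1)}{}^{\langle 1\rangle}\otimes_B p_{(1)}{}^{\langle 2\rangle}\otimes q,\qquad \varepsilon_L(p\otimes q)=pq$$ define a left $B$-bialgebroid structure on $\mathcal{L}$, and $\mathcal{L}$ is a full $*$-Hopf algebroid with antipode $S(p\otimes q)=q\otimes p$ and $*$-structure $$(p\otimes q)^\star=p^*\otimes q^*,$$ where $B$ carries the $*$-structure of $P$. Explicitly, the last statement means the following. 1. $S:\mathcal{L}\to\mathcal{L}$ is an invertible anti-algebra map with $S\circ t_L=s_L$ and, writing $\Delta_L(X)=X_{(1)}\otimes_B X_{(2)}$, $$(S^{-1}X_{(2)})_{(1)}\otimes_B(S^{-1}X_{(2)})_{(2)}X_{(1)}=S^{-1}(X)\otimes_B1,\qquad S(X_{(1)})_{(1)}X_{(2)}\otimes_BS(X_{(1)})_{(2)}=1\otimes_BS(X).$$ 2. The algebra $\mathcal{L}$ is a right bialgebroid over $A=B^{op}$ with $s_R(b)=t_L(b)$, $t_R(b)=S^{-1}(t_L(b))$, $\varepsilon_R=\varepsilon_L\circ S$ and $\Delta_R(X)=S^{-1}(S(X)_{(2)})\otimes_AS^{-1}(S(X)_{(1)})$.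 3. $B$ and $(\mathcal{L},\star)$ are $*$-algebras over $\mathbb{C}$, and $s_L(b)^\star=t_R(b^*)$, $t_L(b)^\star=s_R(b^*)$, $\varepsilon_L(X^\star)=\varepsilon_R(X)^*$ and $\Delta_R(X^\star)=X_{(1)}{}^\star\otimes_AX_{(2)}{}^\star$ for all $b\in B$, $X\in\mathcal{L}$. -/

import Mathlib

open scoped TensorProduct
open MulOpposite

universe u v

/-! ## Balanced tensor products over a noncommutative algebra

Everything is linear over `ℂ`.  If `B` acts on `M` from the right through `ρ` and on `N` from the
left through `σ`, then `BalTensor ρ σ` is `M ⊗_B N`, the quotient of `M ⊗ N` by the relations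
`ρ b m ⊗ n = m ⊗ σ b n`. -/

namespace BalTensor

section
variable {B M N : Type*} [AddCommGroup M] [Module ℂ M] [AddCommGroup N] [Module ℂ N]

/-- The span of the balancing relations. -/
def rel (ρ : B → M →ₗ[ℂ] M) (σ : B → N →ₗ[ℂ] N) : Submodule ℂ (M ⊗[ℂ] N) :=
  Submodule.span ℂ {x | ∃ (b : B) (m : M) (n : N), x = ρ b m ⊗ₜ[ℂ] n - m ⊗ₜ[ℂ] σ b n}

end

end BalTensor

/-- The balanced tensor product `M ⊗_B N`. -/
abbrev BalTensor {B M N : Type*} [AddCommGroup M] [Module ℂ M] [AddCommGroup N] [Module ℂ N]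
    (ρ : B → M →ₗ[ℂ] M) (σ : B → N →ₗ[ℂ] N) : Type _ :=
  (M ⊗[ℂ] N) ⧸ BalTensor.rel ρ σ

namespace BalTensor

section
variable {B M N : Type*} [AddCommGroup M] [Module ℂ M] [AddCommGroup N] [Module ℂ N]

/-- The class `m ⊗_B n`. -/
def mk (ρ : B → M →ₗ[ℂ] M) (σ : B → N →ₗ[ℂ] N) : M →ₗ[ℂ] N →ₗ[ℂ] BalTensor ρ σ :=
  (TensorProduct.mk ℂ M N).compr₂ (rel ρ σ).mkQ

theorem mk_bal (ρ : B → M →ₗ[ℂ] M) (σ : B → N →ₗ[ℂ] N) (b : B) (m : M) (n : N) :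
    mk ρ σ (ρ b m) n = mk ρ σ m (σ b n) :=
  (Submodule.Quotient.eq _).2 (Submodule.subset_span ⟨b, m, n, rfl⟩)

variable {ρ : B → M →ₗ[ℂ] M} {σ : B → N →ₗ[ℂ] N} {K : Type*} [AddCommGroup K] [Module ℂ K]
  {τ : ℂ →+* ℂ}

/-- A balanced (semi-)bilinear map factors through `M ⊗_B N`. -/
def lift (f : M →ₛₗ[τ] N →ₛₗ[τ] K) (h : ∀ b m n, f (ρ b m) n = f m (σ b n)) :
    BalTensor ρ σ →ₛₗ[τ] K :=
  (rel ρ σ).liftQ (TensorProduct.lift f) <| by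
    refine Submodule.span_le.2 ?_
    rintro _ ⟨b, m, n, rfl⟩
    simp [h]

@[simp]
theorem lift_mk (f : M →ₛₗ[τ] N →ₛₗ[τ] K) (h : ∀ b m n, f (ρ b m) n = f m (σ b n))
    (m : M) (n : N) : lift f h (mk ρ σ m n) = f m n := rfl

variable {B' M' N' : Type*} [AddCommGroup M'] [Module ℂ M'] [AddCommGroup N'] [Module ℂ N']
  {ρ' : B' → M' →ₗ[ℂ] M'} {σ' : B' → N' →ₗ[ℂ] N'}

/-- `f ⊗ g` on balanced tensor products, `m ⊗ n ↦ f m ⊗ g n`, whenever this is well defined. -/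
def map (f : M →ₗ[ℂ] M') (g : N →ₗ[ℂ] N')
    (h : ∀ b m n, mk ρ' σ' (f (ρ b m)) (g n) = mk ρ' σ' (f m) (g (σ b n))) :
    BalTensor ρ σ →ₗ[ℂ] BalTensor ρ' σ' :=
  lift ((mk ρ' σ').compl₁₂ f g) h

@[simp]
theorem map_mk (f : M →ₗ[ℂ] M') (g : N →ₗ[ℂ] N')
    (h : ∀ b m n, mk ρ' σ' (f (ρ b m)) (g n) = mk ρ' σ' (f m) (g (σ b n))) (m : M) (n : N) :
    map f g h (mk ρ σ m n) = mk ρ' σ' (f m) (g n) := rfl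

theorem hom_ext {f g : BalTensor ρ σ →ₛₗ[τ] K} (h : ∀ m n, f (mk ρ σ m n) = g (mk ρ σ m n)) :
    f = g := by
  refine LinearMap.ext fun z => ?_
  obtain ⟨w, rfl⟩ := Submodule.mkQ_surjective _ z
  induction w with
  | zero => simp
  | tmul m n => exact h m n
  | add x y hx hy => rw [map_add, map_add, map_add, hx, hy]

end

end BalTensor

/-- A source map `s` (an algebra map) and a target map `t` (an anti-algebra map, here an algebra
map into the opposite algebra) from `B` to `L` with commuting images. -/
structure EnvRing (B L : Type*) [Ring B] [Algebra ℂ B] [Ring L] [Algebra ℂ L] where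
  src : B →ₐ[ℂ] L
  tgt : B →ₐ[ℂ] Lᵐᵒᵖ
  comm : ∀ a b, src a * unop (tgt b) = unop (tgt b) * src a

namespace EnvRing

variable {B L : Type*} [Ring B] [Algebra ℂ B] [Ring L] [Algebra ℂ L] (E : EnvRing B L)

/-- The source map. -/
def s (b : B) : L := E.src b

/-- The target map, as an anti-multiplicative map to `L`. -/
def t (b : B) : L := unop (E.tgt b)

/-! ### The tensor product of a left bialgebroid: `L` is a `B`-bimodule by `a.X.b = s(a) t(b) X` -/

/-- `L ⊗_B L` for the bimodule structure `a.X.b = s(a) t(b) X`; so `t(b) X ⊗ Y = X ⊗ s(b) Y`. -/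
abbrev LTens : Type _ :=
  BalTensor (fun b : B => LinearMap.mulLeft ℂ (E.t b)) (fun b : B => LinearMap.mulLeft ℂ (E.s b))

/-- The class `X ⊗_B Y` in `LTens`. -/
def lmk : L →ₗ[ℂ] L →ₗ[ℂ] E.LTens := BalTensor.mk _ _

theorem lmk_bal (b : B) (X Y : L) : E.lmk (E.t b * X) Y = E.lmk X (E.s b * Y) :=
  BalTensor.mk_bal (fun b : B => LinearMap.mulLeft ℂ (E.t b))
    (fun b : B => LinearMap.mulLeft ℂ (E.s b)) b X Y

theorem lhom_ext {K : Type*} [AddCommGroup K] [Module ℂ K] {f g : E.LTens →ₗ[ℂ] K}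
    (h : ∀ X Y, f (E.lmk X Y) = g (E.lmk X Y)) : f = g :=
  BalTensor.hom_ext h

/-- The left action of `B` on `L ⊗_B L`: `a.(X ⊗ Y) = s(a) X ⊗ Y`. -/
def lactL (a : B) : E.LTens →ₗ[ℂ] E.LTens :=
  BalTensor.map (LinearMap.mulLeft ℂ (E.s a)) LinearMap.id fun b X Y => by
    have h : E.s a * (E.t b * X) = E.t b * (E.s a * X) := by
      rw [← mul_assoc, ← mul_assoc]; exact congrArg (· * X) (E.comm a b)
    simpa [h, lmk] using E.lmk_bal b (E.s a * X) Y

/-- The right action of `B` on `L ⊗_B L`: `(X ⊗ Y).a = X ⊗ t(a) Y`. -/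
def lactR (a : B) : E.LTens →ₗ[ℂ] E.LTens :=
  BalTensor.map LinearMap.id (LinearMap.mulLeft ℂ (E.t a)) fun b X Y => by
    have h : E.t a * (E.s b * Y) = E.s b * (E.t a * Y) := by
      rw [← mul_assoc, ← mul_assoc]; exact congrArg (· * Y) (E.comm b a).symm
    simpa [h, lmk] using E.lmk_bal b X (E.t a * Y)

@[simp]
theorem lactL_lmk (a : B) (X Y : L) : E.lactL a (E.lmk X Y) = E.lmk (E.s a * X) Y := rfl

/-- Multiplication from the right by `U ⊗ V` on `L ⊗_B L`: `X ⊗ Y ↦ X U ⊗ Y V`. -/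
def lmulR (U V : L) : E.LTens →ₗ[ℂ] E.LTens :=
  BalTensor.map (LinearMap.mulRight ℂ U) (LinearMap.mulRight ℂ V) fun b X Y => by
    simpa [mul_assoc, lmk] using E.lmk_bal b (X * U) (Y * V)

@[simp]
theorem lmulR_lmk (U V X Y : L) : E.lmulR U V (E.lmk X Y) = E.lmk (X * U) (Y * V) := rfl

/-- The Takeuchi product `L ×_B L`: the elements with `X t(a) ⊗ Y = X ⊗ Y s(a)` for all `a`. -/
def ltakeuchi : Submodule ℂ E.LTens where
  carrier := {Z | ∀ a, E.lmulR (E.t a) 1 Z = E.lmulR 1 (E.s a) Z}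
  add_mem' hZ hW a := by rw [map_add, map_add, hZ a, hW a]
  zero_mem' a := by rw [map_zero, map_zero]
  smul_mem' c Z hZ a := by rw [map_smul, map_smul, hZ a]

theorem lmulR_lmulR (U V U' V' : L) (Z : E.LTens) :
    E.lmulR U' V' (E.lmulR U V Z) = E.lmulR (U * U') (V * V') Z := by
  have : E.lmulR U' V' ∘ₗ E.lmulR U V = E.lmulR (U * U') (V * V') := by
    refine E.lhom_ext fun X Y => ?_
    simp [mul_assoc]
  exact LinearMap.congr_fun this Z

/-- `lmulR U V Z` as a bilinear map in `U` and `V`. -/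
def lmulBilin (Z : E.LTens) : L →ₗ[ℂ] L →ₗ[ℂ] E.LTens :=
  LinearMap.mk₂ ℂ (fun U V => E.lmulR U V Z)
    (fun U U' V => LinearMap.congr_fun (show E.lmulR (U + U') V = E.lmulR U V + E.lmulR U' V by
      exact E.lhom_ext fun X Y => by simp [mul_add]) Z)
    (fun c U V => LinearMap.congr_fun (show E.lmulR (c • U) V = c • E.lmulR U V by
      exact E.lhom_ext fun X Y => by simp) Z)
    (fun U V V' => LinearMap.congr_fun (show E.lmulR U (V + V') = E.lmulR U V + E.lmulR U V' by
      exact E.lhom_ext fun X Y => by simp [mul_add]) Z)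
    (fun c U V => LinearMap.congr_fun (show E.lmulR U (c • V) = c • E.lmulR U V by
      exact E.lhom_ext fun X Y => by simp) Z)

/-- The product `(X ⊗ Y)(U ⊗ V) = X U ⊗ Y V` of an element `Z = X ⊗ Y` of the Takeuchi product
with an element `U ⊗ V` of `L ⊗_B L`. -/
def ltMul (Z : E.ltakeuchi) : E.LTens →ₗ[ℂ] E.LTens :=
  BalTensor.lift (E.lmulBilin Z.1) fun b U V => by
    have h := congrArg (E.lmulR U V) (Z.2 b)
    rw [lmulR_lmulR, lmulR_lmulR, one_mul, one_mul] at h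
    exact h

@[simp]
theorem ltMul_lmk (Z : E.ltakeuchi) (U V : L) : E.ltMul Z (E.lmk U V) = E.lmulR U V Z.1 := rfl

/-- `L ⊗_B L ⊗_B L`, bracketed as `(L ⊗_B L) ⊗_B L`. -/
abbrev LTens₃ : Type _ :=
  BalTensor (fun b : B => E.lactR b) (fun b : B => LinearMap.mulLeft ℂ (E.s b))

/-- The map `U ⊗ V ↦ (X ⊗ U) ⊗ V`. -/
def linsert (X : L) : E.LTens →ₗ[ℂ] E.LTens₃ :=
  BalTensor.lift ((BalTensor.mk (fun b : B => E.lactR b)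
      (fun b : B => LinearMap.mulLeft ℂ (E.s b))).comp (E.lmk X)) fun b U V =>
    BalTensor.mk_bal (fun b : B => E.lactR b)
      (fun b : B => LinearMap.mulLeft ℂ (E.s b)) b (E.lmk X U) V

@[simp]
theorem linsert_lmk (X U V : L) : E.linsert X (E.lmk U V) =
    BalTensor.mk (fun b : B => E.lactR b) (fun b : B => LinearMap.mulLeft ℂ (E.s b))
      (E.lmk X U) V := rfl

/-- `linsert X W` as a bilinear map. -/
def linsertBilin : L →ₗ[ℂ] E.LTens →ₗ[ℂ] E.LTens₃ :=
  LinearMap.mk₂ ℂ (fun X W => E.linsert X W)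
    (fun X X' W => LinearMap.congr_fun
      (show E.linsert (X + X') = E.linsert X + E.linsert X' 
        from E.lhom_ext fun U V => by simp) W)
    (fun c X W => LinearMap.congr_fun
      (show E.linsert (c • X) = c • E.linsert X 
        from E.lhom_ext fun U V => by simp) W)
    (fun X W W' => map_add _ _ _) (fun c X W => map_smul _ _ _)

theorem linsert_bal (b : B) (X : L) (W : E.LTens) :
    E.linsert (E.t b * X) W = E.linsert X (E.lactL b W) := by
  have : E.linsert (E.t b * X) = E.linsert X ∘ₗ E.lactL b := by
    refine E.lhom_ext fun U V => ?_
    have h := E.lmk_bal b X U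
    rw [LinearMap.comp_apply, linsert_lmk, h, lactL_lmk, linsert_lmk]
  exact LinearMap.congr_fun this W

/-! ### The tensor product of a right bialgebroid: `R` is a bimodule by `a.X.b = X t(a) s(b)` -/

/-- `R ⊗_A R` for the bimodule structure `a.X.b = X t(a) s(b)`; so `X s(a) ⊗ Y = X ⊗ Y t(a)`. -/
abbrev RTens : Type _ :=
  BalTensor (fun b : B => LinearMap.mulRight ℂ (E.s b)) (fun b : B => LinearMap.mulRight ℂ (E.t b))

/-- The class `X ⊗_A Y` in `RTens`. -/
def rmk : L →ₗ[ℂ] L →ₗ[ℂ] E.RTens := BalTensor.mk _ _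

theorem rmk_bal (b : B) (X Y : L) : E.rmk (X * E.s b) Y = E.rmk X (Y * E.t b) :=
  BalTensor.mk_bal (fun b : B => LinearMap.mulRight ℂ (E.s b))
    (fun b : B => LinearMap.mulRight ℂ (E.t b)) b X Y

theorem rhom_ext {K : Type*} [AddCommGroup K] [Module ℂ K] {f g : E.RTens →ₗ[ℂ] K}
    (h : ∀ X Y, f (E.rmk X Y) = g (E.rmk X Y)) : f = g :=
  BalTensor.hom_ext h

/-- The left action of `A` on `R ⊗_A R`: `a.(X ⊗ Y) = X t(a) ⊗ Y`. -/
def ractL (a : B) : E.RTens →ₗ[ℂ] E.RTens :=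
  BalTensor.map (LinearMap.mulRight ℂ (E.t a)) LinearMap.id fun b X Y => by
    have h : X * E.s b * E.t a = X * E.t a * E.s b := by
      rw [mul_assoc, mul_assoc]; exact congrArg (X * ·) (E.comm b a)
    simpa [h, rmk] using E.rmk_bal b (X * E.t a) Y

/-- The right action of `A` on `R ⊗_A R`: `(X ⊗ Y).a = X ⊗ Y s(a)`. -/
def ractR (a : B) : E.RTens →ₗ[ℂ] E.RTens :=
  BalTensor.map LinearMap.id (LinearMap.mulRight ℂ (E.s a)) fun b X Y => by
    have h : Y * E.t b * E.s a = Y * E.s a * E.t b := by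
      rw [mul_assoc, mul_assoc]; exact congrArg (Y * ·) (E.comm a b).symm
    simpa [h, rmk] using E.rmk_bal b X (Y * E.s a)

@[simp]
theorem ractL_rmk (a : B) (X Y : L) : E.ractL a (E.rmk X Y) = E.rmk (X * E.t a) Y := rfl

/-- Multiplication from the left by `U ⊗ V` on `R ⊗_A R`: `X ⊗ Y ↦ U X ⊗ V Y`. -/
def rmulL (U V : L) : E.RTens →ₗ[ℂ] E.RTens :=
  BalTensor.map (LinearMap.mulLeft ℂ U) (LinearMap.mulLeft ℂ V) fun b X Y => by
    simpa [mul_assoc, rmk] using E.rmk_bal b (U * X) (V * Y)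

@[simp]
theorem rmulL_rmk (U V X Y : L) : E.rmulL U V (E.rmk X Y) = E.rmk (U * X) (V * Y) := rfl

/-- The Takeuchi product `R ×_A R`: the elements with `s(a) X ⊗ Y = X ⊗ t(a) Y` for all `a`. -/
def rtakeuchi : Submodule ℂ E.RTens where
  carrier := {Z | ∀ a, E.rmulL (E.s a) 1 Z = E.rmulL 1 (E.t a) Z}
  add_mem' hZ hW a := by rw [map_add, map_add, hZ a, hW a]
  zero_mem' a := by rw [map_zero, map_zero]
  smul_mem' c Z hZ a := by rw [map_smul, map_smul, hZ a]

theorem rmulL_rmulL (U V U' V' : L) (Z : E.RTens) :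
    E.rmulL U' V' (E.rmulL U V Z) = E.rmulL (U' * U) (V' * V) Z := by
  have : E.rmulL U' V' ∘ₗ E.rmulL U V = E.rmulL (U' * U) (V' * V) := by
    refine E.rhom_ext fun X Y => ?_
    simp [mul_assoc]
  exact LinearMap.congr_fun this Z

/-- `rmulL U V Z` as a bilinear map in `U` and `V`. -/
def rmulBilin (Z : E.RTens) : L →ₗ[ℂ] L →ₗ[ℂ] E.RTens :=
  LinearMap.mk₂ ℂ (fun U V => E.rmulL U V Z)
    (fun U U' V => LinearMap.congr_fun (show E.rmulL (U + U') V = E.rmulL U V + E.rmulL U' V by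
      exact E.rhom_ext fun X Y => by simp [add_mul]) Z)
    (fun c U V => LinearMap.congr_fun (show E.rmulL (c • U) V = c • E.rmulL U V by
      exact E.rhom_ext fun X Y => by simp) Z)
    (fun U V V' => LinearMap.congr_fun (show E.rmulL U (V + V') = E.rmulL U V + E.rmulL U V' by
      exact E.rhom_ext fun X Y => by simp [add_mul]) Z)
    (fun c U V => LinearMap.congr_fun (show E.rmulL U (c • V) = c • E.rmulL U V by
      exact E.rhom_ext fun X Y => by simp) Z)

/-- The product `(U ⊗ V)(X ⊗ Y) = U X ⊗ V Y` of an element `U ⊗ V` of `R ⊗_A R` with an element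
`Z = X ⊗ Y` of the Takeuchi product. -/
def rtMul (Z : E.rtakeuchi) : E.RTens →ₗ[ℂ] E.RTens :=
  BalTensor.lift (E.rmulBilin Z.1) fun b U V => by
    have h := congrArg (E.rmulL U V) (Z.2 b)
    rw [rmulL_rmulL, rmulL_rmulL, mul_one, mul_one] at h
    exact h

@[simp]
theorem rtMul_rmk (Z : E.rtakeuchi) (U V : L) : E.rtMul Z (E.rmk U V) = E.rmulL U V Z.1 := rfl

/-- `R ⊗_A R ⊗_A R`, bracketed as `(R ⊗_A R) ⊗_A R`. -/
abbrev RTens₃ : Type _ :=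
  BalTensor (fun b : B => E.ractR b) (fun b : B => LinearMap.mulRight ℂ (E.t b))

/-- The map `U ⊗ V ↦ (X ⊗ U) ⊗ V`. -/
def rinsert (X : L) : E.RTens →ₗ[ℂ] E.RTens₃ :=
  BalTensor.lift ((BalTensor.mk (fun b : B => E.ractR b)
      (fun b : B => LinearMap.mulRight ℂ (E.t b))).comp (E.rmk X)) fun b U V =>
    BalTensor.mk_bal (fun b : B => E.ractR b)
      (fun b : B => LinearMap.mulRight ℂ (E.t b)) b (E.rmk X U) V

@[simp]
theorem rinsert_rmk (X U V : L) : E.rinsert X (E.rmk U V) =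
    BalTensor.mk (fun b : B => E.ractR b) (fun b : B => LinearMap.mulRight ℂ (E.t b))
      (E.rmk X U) V := rfl

/-- `rinsert X W` as a bilinear map. -/
def rinsertBilin : L →ₗ[ℂ] E.RTens →ₗ[ℂ] E.RTens₃ :=
  LinearMap.mk₂ ℂ (fun X W => E.rinsert X W)
    (fun X X' W => LinearMap.congr_fun
      (show E.rinsert (X + X') = E.rinsert X + E.rinsert X' 
        from E.rhom_ext fun U V => by simp) W)
    (fun c X W => LinearMap.congr_fun
      (show E.rinsert (c • X) = c • E.rinsert X 
        from E.rhom_ext fun U V => by simp) W)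
    (fun X W W' => map_add _ _ _) (fun c X W => map_smul _ _ _)

theorem rinsert_bal (b : B) (X : L) (W : E.RTens) :
    E.rinsert (X * E.s b) W = E.rinsert X (E.ractL b W) := by
  have : E.rinsert (X * E.s b) = E.rinsert X ∘ₗ E.ractL b := by
    refine E.rhom_ext fun U V => ?_
    have h := E.rmk_bal b X U
    rw [LinearMap.comp_apply, rinsert_rmk, h, ractL_rmk, rinsert_rmk]
  exact LinearMap.congr_fun this W

end EnvRing

/-! ## Left bialgebroids -/

section LeftBialgebroid

variable {B L : Type*} [Ring B] [Algebra ℂ B] [Ring L] [Algebra ℂ L]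

/-- A coproduct `L → L ⊗_B L` and a counit `L → B` that are maps of `B`-bimodules, for the bimodule
structure `a.X.b = s(a) t(b) X`. -/
structure LeftCoringData (E : EnvRing B L) where
  comul : L →ₗ[ℂ] E.LTens
  counit : L →ₗ[ℂ] B
  comul_s : ∀ b X, comul (E.s b * X) = E.lactL b (comul X)
  comul_t : ∀ b X, comul (E.t b * X) = E.lactR b (comul X)
  counit_s : ∀ b X, counit (E.s b * X) = b * counit X
  counit_t : ∀ b X, counit (E.t b * X) = counit X * b

namespace LeftCoringData

variable {E : EnvRing B L} (D : LeftCoringData E)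

/-- `Δ ⊗ id : L ⊗_B L → L ⊗_B L ⊗_B L`. -/
def comulId : E.LTens →ₗ[ℂ] E.LTens₃ :=
  BalTensor.map D.comul LinearMap.id fun b X Y => by
    have h := D.comul_t b X
    simp only [LinearMap.mulLeft_apply, LinearMap.id_apply, h]
    exact BalTensor.mk_bal (fun b : B => E.lactR b)
      (fun b : B => LinearMap.mulLeft ℂ (E.s b)) b (D.comul X) Y

/-- `id ⊗ Δ : L ⊗_B L → L ⊗_B L ⊗_B L`. -/
def idComul : E.LTens →ₗ[ℂ] E.LTens₃ :=
  BalTensor.lift (E.linsertBilin.compl₂ D.comul) fun b X Y => by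
    have h := D.comul_s b Y
    have h' := E.linsert_bal b X (D.comul Y)
    simpa [EnvRing.linsertBilin, h] using h'

/-- `ε ⊗ id : L ⊗_B L → L`, `X ⊗ Y ↦ s(ε(X)) Y`. -/
def counitId : E.LTens →ₗ[ℂ] L :=
  BalTensor.lift ((LinearMap.mul ℂ L).comp (E.src.toLinearMap ∘ₗ D.counit)) fun b X Y => by
    have h := D.counit_t b X
    simp [h, EnvRing.s, mul_assoc]

/-- `id ⊗ ε : L ⊗_B L → L`, `X ⊗ Y ↦ t(ε(Y)) X`. -/
def idCounit : E.LTens →ₗ[ℂ] L :=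
  BalTensor.lift ((LinearMap.mul ℂ L).flip.compl₂
      ((opLinearEquiv ℂ).symm.toLinearMap ∘ₗ E.tgt.toLinearMap ∘ₗ D.counit)) fun b X Y => by
    have h := D.counit_s b Y
    simp [h, EnvRing.t, mul_assoc]

end LeftCoringData

/-- A left `B`-bialgebroid structure on the algebra `L` with given source and target maps. -/
structure LeftBialgebroid (E : EnvRing B L) extends LeftCoringData E where
  coassoc : ∀ X, toLeftCoringData.comulId (comul X) = toLeftCoringData.idComul (comul X)
  counit_comul : ∀ X, toLeftCoringData.counitId (comul X) = X
  comul_counit : ∀ X, toLeftCoringData.idCounit (comul X) = X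
  comul_mem : ∀ X, comul X ∈ E.ltakeuchi
  comul_one : comul 1 = E.lmk 1 1
  comul_mul : ∀ X Y, comul (X * Y) = E.ltMul ⟨comul X, comul_mem X⟩ (comul Y)
  counit_one : counit 1 = 1
  counit_mul_s : ∀ X Y, counit (X * Y) = counit (X * E.s (counit Y))
  counit_mul_t : ∀ X Y, counit (X * Y) = counit (X * E.t (counit Y))

namespace LeftBialgebroid

variable {E : EnvRing B L} (𝓛 : LeftBialgebroid E)

theorem comul_mul_s (X : L) (b : B) : 𝓛.comul (X * E.s b) = E.lmulR (E.s b) 1 (𝓛.comul X) := by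
  have h : 𝓛.comul (E.s b) = E.lmk (E.s b) 1 := by
    have h := 𝓛.comul_s b 1
    rw [mul_one, 𝓛.comul_one] at h
    simpa [EnvRing.lactL, EnvRing.lmk] using h
  rw [𝓛.comul_mul, h, EnvRing.ltMul_lmk]

theorem comul_mul_t (X : L) (b : B) : 𝓛.comul (X * E.t b) = E.lmulR 1 (E.t b) (𝓛.comul X) := by
  have h : 𝓛.comul (E.t b) = E.lmk 1 (E.t b) := by
    have h := 𝓛.comul_t b 1
    rw [mul_one, 𝓛.comul_one] at h
    simpa [EnvRing.lactR, EnvRing.lmk] using h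
  rw [𝓛.comul_mul, h, EnvRing.ltMul_lmk]

end LeftBialgebroid

end LeftBialgebroid

/-! ## Right bialgebroids -/

section RightBialgebroid

variable {A R : Type*} [Ring A] [Algebra ℂ A] [Ring R] [Algebra ℂ R]

/-- A coproduct `R → R ⊗_A R` and a counit `R → A` that are maps of `A`-bimodules, for the bimodule
structure `a.X.b = X t(a) s(b)`. -/
structure RightCoringData (E : EnvRing A R) where
  comul : R →ₗ[ℂ] E.RTens
  counit : R →ₗ[ℂ] A
  comul_t : ∀ a X, comul (X * E.t a) = E.ractL a (comul X)
  comul_s : ∀ a X, comul (X * E.s a) = E.ractR a (comul X)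
  counit_t : ∀ a X, counit (X * E.t a) = a * counit X
  counit_s : ∀ a X, counit (X * E.s a) = counit X * a

namespace RightCoringData

variable {E : EnvRing A R} (D : RightCoringData E)

/-- `Δ ⊗ id : R ⊗_A R → R ⊗_A R ⊗_A R`. -/
def comulId : E.RTens →ₗ[ℂ] E.RTens₃ :=
  BalTensor.map D.comul LinearMap.id fun b X Y => by
    have h := D.comul_s b X
    simp only [LinearMap.mulRight_apply, LinearMap.id_apply, h]
    exact BalTensor.mk_bal (fun b : A => E.ractR b)
      (fun b : A => LinearMap.mulRight ℂ (E.t b)) b (D.comul X) Y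

/-- `id ⊗ Δ : R ⊗_A R → R ⊗_A R ⊗_A R`. -/
def idComul : E.RTens →ₗ[ℂ] E.RTens₃ :=
  BalTensor.lift (E.rinsertBilin.compl₂ D.comul) fun b X Y => by
    have h := D.comul_t b Y
    have h' := E.rinsert_bal b X (D.comul Y)
    simpa [EnvRing.rinsertBilin, h] using h'

/-- `ε ⊗ id : R ⊗_A R → R`, `X ⊗ Y ↦ Y t(ε(X))`. -/
def counitId : E.RTens →ₗ[ℂ] R :=
  BalTensor.lift ((LinearMap.mul ℂ R).flip.comp
      ((opLinearEquiv ℂ).symm.toLinearMap ∘ₗ E.tgt.toLinearMap ∘ₗ D.counit)) fun b X Y => by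
    have h := D.counit_s b X
    simp [h, EnvRing.t, mul_assoc]

/-- `id ⊗ ε : R ⊗_A R → R`, `X ⊗ Y ↦ X s(ε(Y))`. -/
def idCounit : E.RTens →ₗ[ℂ] R :=
  BalTensor.lift ((LinearMap.mul ℂ R).compl₂ (E.src.toLinearMap ∘ₗ D.counit)) fun b X Y => by
    have h := D.counit_t b Y
    simp [h, EnvRing.s, mul_assoc]

end RightCoringData

/-- A right `A`-bialgebroid structure on the algebra `R` with given source and target maps. -/
structure RightBialgebroid (E : EnvRing A R) extends RightCoringData E where
  coassoc : ∀ X, toRightCoringData.comulId (comul X) = toRightCoringData.idComul (comul X)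
  counit_comul : ∀ X, toRightCoringData.counitId (comul X) = X
  comul_counit : ∀ X, toRightCoringData.idCounit (comul X) = X
  comul_mem : ∀ X, comul X ∈ E.rtakeuchi
  comul_one : comul 1 = E.rmk 1 1
  comul_mul : ∀ X Y, comul (X * Y) = E.rtMul ⟨comul Y, comul_mem Y⟩ (comul X)
  counit_one : counit 1 = 1
  counit_s_mul : ∀ X Y, counit (X * Y) = counit (E.s (counit X) * Y)
  counit_t_mul : ∀ X Y, counit (X * Y) = counit (E.t (counit X) * Y)

end RightBialgebroid

/-! ## Full Hopf algebroids and full `*`-Hopf algebroids -/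

section FullHopfAlgebroid

variable {B L : Type*} [Ring B] [Algebra ℂ B] [Ring L] [Algebra ℂ L]

namespace EnvRing

variable {E : EnvRing B L} {F : EnvRing Bᵐᵒᵖ L}

/-- The map `L ⊗_B L → L ⊗_A L`, `X ⊗ Y ↦ φ(Y) ⊗ φ(X)`, where `A = Bᵒᵖ`. -/
def flipMap (φ : L →ₗ[ℂ] L) (ht : ∀ b X, φ (E.t b * X) = φ X * F.t (op b))
    (hs : ∀ b X, φ (E.s b * X) = φ X * F.s (op b)) : E.LTens →ₗ[ℂ] F.RTens :=
  BalTensor.lift (F.rmk.compl₁₂ φ φ).flip fun b X Y => by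
    have h := F.rmk_bal (op b) (φ Y) (φ X)
    rw [← hs, ← ht] at h
    exact h.symm

/-- The antilinear map `L ⊗_B L → L ⊗_A L`, `X ⊗ Y ↦ X^* ⊗ Y^*`, where `A = Bᵒᵖ`. -/
def starMap [StarRing B] [StarRing L] [StarModule ℂ L]
    (hs : ∀ b, star (E.s b) = F.t (op (star b))) (ht : ∀ b, star (E.t b) = F.s (op (star b))) :
    E.LTens →ₛₗ[starRingEnd ℂ] F.RTens :=
  BalTensor.lift
    (LinearMap.mk₂'ₛₗ (starRingEnd ℂ) (starRingEnd ℂ) (fun X Y => F.rmk (star X) (star Y))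
      (fun X X' Y => by simp) (fun c X Y => by simp)
      (fun X Y Y' => by simp) (fun c X Y => by simp))
    fun b X Y => by
      have h := F.rmk_bal (op (star b)) (star X) (star Y)
      rw [← hs, ← ht, ← star_mul, ← star_mul] at h
      exact h

end EnvRing

/-- A left bialgebroid with an invertible anti-algebra map `S : L → L` such that `S ∘ t = s`. -/
structure AntipodeData (E : EnvRing B L) where
  left : LeftBialgebroid E
  antipode : L ≃ₐ[ℂ] Lᵐᵒᵖ
  antipode_t : ∀ b, unop (antipode (E.t b)) = E.s b

namespace AntipodeData

variable {E : EnvRing B L} (D : AntipodeData E)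

/-- The antipode as a linear map `L → L`. -/
def S : L →ₗ[ℂ] L := (opLinearEquiv ℂ).symm.toLinearMap ∘ₗ D.antipode.toLinearMap

/-- The inverse of the antipode as a linear map `L → L`. -/
def Sinv : L →ₗ[ℂ] L := D.antipode.symm.toLinearMap ∘ₗ (opLinearEquiv ℂ).toLinearMap

theorem S_mul (X Y : L) : D.S (X * Y) = D.S Y * D.S X := by simp [S]

theorem Sinv_mul (X Y : L) : D.Sinv (X * Y) = D.Sinv Y * D.Sinv X := by simp [Sinv]

theorem S_t (b : B) : D.S (E.t b) = E.s b := D.antipode_t b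

theorem Sinv_S (X : L) : D.Sinv (D.S X) = X := by simp [S, Sinv]

theorem S_Sinv (X : L) : D.S (D.Sinv X) = X := by simp [S, Sinv]

theorem Sinv_s (b : B) : D.Sinv (E.s b) = E.t b := by rw [← D.S_t, Sinv_S]

/-- The map `L ⊗_B L → L ⊗_B L`, `X ⊗ Y ↦ S⁻¹(Y)₁ ⊗ S⁻¹(Y)₂ X`. -/
def mapSinv : E.LTens →ₗ[ℂ] E.LTens :=
  BalTensor.lift
    (LinearMap.mk₂ ℂ (fun X Y => E.lmulR 1 X (D.left.comul (D.Sinv Y)))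
      (fun X X' Y => (E.lmulBilin _ 1).map_add X X')
      (fun c X Y => (E.lmulBilin _ 1).map_smul c X)
      (fun X Y Y' => by simp only [map_add]) (fun c X Y => by simp only [map_smul]))
    fun b X Y => by
      change E.lmulR 1 (E.t b * X) _ = E.lmulR 1 X (D.left.comul (D.Sinv (E.s b * Y)))
      simp only [Sinv_mul, Sinv_s,
        LeftBialgebroid.comul_mul_t, EnvRing.lmulR_lmulR, mul_one]

/-- The map `L ⊗_B L → L ⊗_B L`, `X ⊗ Y ↦ S(X)₁ Y ⊗ S(X)₂`. -/
def mapS : E.LTens →ₗ[ℂ] E.LTens :=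
  BalTensor.lift
    (LinearMap.mk₂ ℂ (fun X Y => E.lmulR Y 1 (D.left.comul (D.S X)))
      (fun X X' Y => by simp only [map_add]) (fun c X Y => by simp only [map_smul])
      (fun X Y Y' => LinearMap.congr_fun ((E.lmulBilin _).map_add Y Y') 1)
      (fun c X Y => LinearMap.congr_fun ((E.lmulBilin _).map_smul c Y) 1))
    fun b X Y => by
      change E.lmulR Y 1 (D.left.comul (D.S (E.t b * X))) = E.lmulR (E.s b * Y) 1 _
      simp only [S_mul, S_t,
        LeftBialgebroid.comul_mul_s, EnvRing.lmulR_lmulR, mul_one]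

end AntipodeData

/-- A full Hopf algebroid `(L, R, S)` with given left source and target maps: a left
`B`-bialgebroid `L` with an invertible antipode `S`, together with the right bialgebroid structure
on the algebra `R = L` over `A = Bᵒᵖ` that `S` induces. -/
structure FullHopfAlgebroid (E : EnvRing B L) extends AntipodeData E where
  /-- `S⁻¹(X₂)₁ ⊗ S⁻¹(X₂)₂ X₁ = S⁻¹(X) ⊗ 1`. -/
  antipode_inv_comul : ∀ X,
    toAntipodeData.mapSinv (left.comul X) = E.lmk (toAntipodeData.Sinv X) 1
  /-- `S(X₁)₁ X₂ ⊗ S(X₁)₂ = 1 ⊗ S(X)`. -/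
  antipode_comul : ∀ X, toAntipodeData.mapS (left.comul X) = E.lmk 1 (toAntipodeData.S X)
  /-- The source and target maps `s_R` and `t_R` of `R`. -/
  rbase : EnvRing Bᵐᵒᵖ L
  rbase_s : ∀ b, rbase.s (op b) = E.t b
  rbase_t : ∀ b, rbase.t (op b) = toAntipodeData.Sinv (E.t b)
  right : RightBialgebroid rbase
  /-- `ε_R = ε_L ∘ S`. -/
  right_counit : ∀ X, right.counit X = op (left.counit (toAntipodeData.S X))
  /-- `Δ_R(X) = S⁻¹(S(X)₂) ⊗ S⁻¹(S(X)₁)`. -/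
  right_comul : ∀ X, right.comul X =
    EnvRing.flipMap toAntipodeData.Sinv
      (fun b X => by rw [AntipodeData.Sinv_mul, rbase_t])
      (fun b X => by rw [AntipodeData.Sinv_mul, AntipodeData.Sinv_s, rbase_s])
      (left.comul (toAntipodeData.S X))

/-- A full `*`-Hopf algebroid: a full Hopf algebroid `(L, R, S)` in which `B` and `L` are
`*`-algebras over `ℂ`, with `s_L(b)^* = t_R(b^*)`, `t_L(b)^* = s_R(b^*)`,
`ε_L(X^*) = ε_R(X)^*` and `Δ_R(X^*) = X₁^* ⊗ X₂^*`. -/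
structure FullHopfAlgebroid.IsStar [StarRing B] [StarModule ℂ B] [StarRing L] [StarModule ℂ L]
    {E : EnvRing B L} (𝓗 : FullHopfAlgebroid E) : Prop where
  star_s : ∀ b, star (E.s b) = 𝓗.rbase.t (op (star b))
  star_t : ∀ b, star (E.t b) = 𝓗.rbase.s (op (star b))
  counit_star : ∀ X, op (𝓗.left.counit (star X)) = star (𝓗.right.counit X)
  comul_star : ∀ X, 𝓗.right.comul (star X) =
    EnvRing.starMap (E := E) (F := 𝓗.rbase) star_s star_t (𝓗.left.comul X)

end FullHopfAlgebroid

/-! ## Faithfully flat Hopf-Galois extensions -/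

section FaithfullyFlat

universe w

variable (B Q : Type*) [Ring B] [Algebra ℂ B] [AddCommGroup Q] [Module ℂ Q] [Module B Q]
  [IsScalarTower ℂ B Q]

/-- `M ⊗_B Q` for a right `B`-module `M` and a left `B`-module `Q`. -/
abbrev ModTensor (M : Type*) [AddCommGroup M] [Module ℂ M] [Module Bᵐᵒᵖ M]
    [IsScalarTower ℂ Bᵐᵒᵖ M] : Type _ :=
  BalTensor (fun b : B => Algebra.lsmul ℂ ℂ M (op b)) (fun b : B => Algebra.lsmul ℂ ℂ Q b)

/-- `f ⊗_B id : M ⊗_B Q → N ⊗_B Q` for a map `f : M → N` of right `B`-modules. -/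
def modTensorMap {M N : Type*} [AddCommGroup M] [Module ℂ M] [Module Bᵐᵒᵖ M]
    [IsScalarTower ℂ Bᵐᵒᵖ M] [AddCommGroup N] [Module ℂ N] [Module Bᵐᵒᵖ N]
    [IsScalarTower ℂ Bᵐᵒᵖ N] (f : M →ₗ[Bᵐᵒᵖ] N) : ModTensor B Q M →ₗ[ℂ] ModTensor B Q N :=
  BalTensor.map (f.restrictScalars ℂ) LinearMap.id fun b m q => by
    have h := BalTensor.mk_bal (fun b : B => (Algebra.lsmul ℂ ℂ N (op b) : N →ₗ[ℂ] N))
      (fun b : B => (Algebra.lsmul ℂ ℂ Q b : Q →ₗ[ℂ] Q)) b (f m) q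
    simpa using h

/-- The left `B`-module `Q` is faithfully flat: `- ⊗_B Q` preserves and reflects exactness of
sequences of right `B`-modules (in the universe `w`). -/
def IsFaithfullyFlatLeft : Prop :=
  ∀ (M N K : Type w) [AddCommGroup M] [Module ℂ M] [Module Bᵐᵒᵖ M] [IsScalarTower ℂ Bᵐᵒᵖ M]
    [AddCommGroup N] [Module ℂ N] [Module Bᵐᵒᵖ N] [IsScalarTower ℂ Bᵐᵒᵖ N]
    [AddCommGroup K] [Module ℂ K] [Module Bᵐᵒᵖ K] [IsScalarTower ℂ Bᵐᵒᵖ K]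
    (f : M →ₗ[Bᵐᵒᵖ] N) (g : N →ₗ[Bᵐᵒᵖ] K),
    Function.Exact f g ↔ Function.Exact (modTensorMap B Q f) (modTensorMap B Q g)

end FaithfullyFlat

/-- `H` is a Hopf `*`-algebra: `H` is a Hopf algebra and a `*`-algebra over `ℂ`, the coproduct and
the counit are `*`-maps (where `(g ⊗ h)^* = g^* ⊗ h^*`), and `S ∘ * ∘ S ∘ * = id`. -/
structure IsHopfStarAlgebra (H : Type*) [Ring H] [HopfAlgebra ℂ H] [StarRing H]
    [StarModule ℂ H] : Prop where
  comul_star : ∀ h : H, Coalgebra.comul (R := ℂ) (star h) = star (Coalgebra.comul (R := ℂ) h)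
  counit_star : ∀ h : H, Coalgebra.counit (R := ℂ) (star h) = star (Coalgebra.counit (R := ℂ) h)
  antipode_star : ∀ h : H,
    HopfAlgebra.antipode ℂ (star (HopfAlgebra.antipode ℂ (star h))) = h

/-- A right `H`-comodule algebra structure on the algebra `P`. -/
structure ComoduleAlgebra (P H : Type*) [Ring P] [Algebra ℂ P] [Ring H] [HopfAlgebra ℂ H] where
  coact : P →ₐ[ℂ] P ⊗[ℂ] H
  coassoc : ∀ p, TensorProduct.assoc ℂ P H H (coact.toLinearMap.rTensor H (coact p)) =
    (Coalgebra.comul (R := ℂ) (A := H)).lTensor P (coact p)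
  counit : ∀ p, TensorProduct.rid ℂ P ((Coalgebra.counit (R := ℂ) (A := H)).lTensor P (coact p)) = p

namespace ComoduleAlgebra

section

set_option maxSynthPendingDepth 3

variable {P H : Type*} [Ring P] [Algebra ℂ P] [Ring H] [HopfAlgebra ℂ H] (δ : ComoduleAlgebra P H)

/-- The coaction is unitary: `δ(p^*) = δ(p)^*`, where `(p ⊗ h)^* = p^* ⊗ h^*`. -/
def IsUnitary [StarRing P] [StarModule ℂ P] [StarRing H] [StarModule ℂ H] : Prop :=
  ∀ p, δ.coact (star p) = star (δ.coact p)

/-- The subalgebra `B = {b | δ(b) = b ⊗ 1}` of coinvariants. -/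
def coinv : Subalgebra ℂ P :=
  AlgHom.equalizer δ.coact Algebra.TensorProduct.includeLeft

theorem coact_coinv (b : δ.coinv) : δ.coact b = (b : P) ⊗ₜ 1 := b.2

/-- `P ⊗_B P`. -/
abbrev PBP : Type _ :=
  BalTensor (fun b : δ.coinv => LinearMap.mulRight ℂ (b : P))
    (fun b : δ.coinv => LinearMap.mulLeft ℂ (b : P))

/-- The canonical map `χ : P ⊗_B P → P ⊗ H`, `q ⊗ p ↦ q p₍₀₎ ⊗ p₍₁₎`. -/
def can : δ.PBP →ₗ[ℂ] P ⊗[ℂ] H :=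
  BalTensor.lift ((LinearMap.mul ℂ (P ⊗[ℂ] H)).compl₁₂
      (Algebra.TensorProduct.includeLeft : P →ₐ[ℂ] P ⊗[ℂ] H).toLinearMap δ.coact.toLinearMap)
    fun b q p => by
      have h := δ.coact_coinv b
      simp [h, ← mul_assoc]

/-- `B ⊆ P` is an `H`-Galois extension: the canonical map is an isomorphism. -/
def IsGalois : Prop := Function.Bijective δ.can

/-- The translation map `τ : H → P ⊗_B P`, `τ(h) = χ⁻¹(1 ⊗ h)`. -/
noncomputable def translation (hδ : δ.IsGalois) : H →ₗ[ℂ] δ.PBP :=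
  (LinearEquiv.ofBijective δ.can hδ).symm.toLinearMap ∘ₗ TensorProduct.mk ℂ P H 1

/-! ### The Ehresmann-Schauenburg algebra -/

/-- The bilinear map `(p ⊗ g, q ⊗ h) ↦ (p ⊗ q) ⊗ g h`. -/
def pair : (P ⊗[ℂ] H) →ₗ[ℂ] (P ⊗[ℂ] H) →ₗ[ℂ] (P ⊗[ℂ] Pᵐᵒᵖ) ⊗[ℂ] H :=
  TensorProduct.curry
    ((LinearMap.mul' ℂ H).lTensor (P ⊗[ℂ] Pᵐᵒᵖ) ∘ₗ
      (TensorProduct.tensorTensorTensorComm ℂ P H Pᵐᵒᵖ H).toLinearMap ∘ₗ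
      ((opLinearEquiv ℂ).toLinearMap.rTensor H).lTensor (P ⊗[ℂ] H))

@[simp]
theorem pair_tmul (p q : P) (g h : H) :
    pair (p ⊗ₜ[ℂ] g) (q ⊗ₜ[ℂ] h) = (p ⊗ₜ[ℂ] op q) ⊗ₜ[ℂ] (g * h) := by
  simp [pair]

/-- The diagonal coaction `P ⊗ P → P ⊗ P ⊗ H`, `p ⊗ q ↦ p₍₀₎ ⊗ q₍₀₎ ⊗ p₍₁₎ q₍₁₎`.  The second factor is
written as `Pᵐᵒᵖ`, since it carries the opposite product in the algebra below. -/
def diag : (P ⊗[ℂ] Pᵐᵒᵖ) →ₗ[ℂ] (P ⊗[ℂ] Pᵐᵒᵖ) ⊗[ℂ] H :=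
  TensorProduct.lift (pair.compl₁₂ δ.coact.toLinearMap
    (δ.coact.toLinearMap ∘ₗ (opLinearEquiv ℂ).symm.toLinearMap))

@[simp]
theorem diag_tmul (p q : P) : δ.diag (p ⊗ₜ[ℂ] op q) = pair (δ.coact p) (δ.coact q) := by
  simp [diag]

/-- For `x = p ⊗ g` and `y = q ⊗ h`, the map `w ⊗ k ↦ (p ⊗ q) w ⊗ g k h`. -/
def sandwich (x y : P ⊗[ℂ] H) : (P ⊗[ℂ] Pᵐᵒᵖ) ⊗[ℂ] H →ₗ[ℂ] (P ⊗[ℂ] Pᵐᵒᵖ) ⊗[ℂ] H :=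
  LinearMap.mulLeft ℂ (Algebra.TensorProduct.map
      (Algebra.TensorProduct.includeLeft : P →ₐ[ℂ] P ⊗[ℂ] Pᵐᵒᵖ) (AlgHom.id ℂ H) x) ∘ₗ
    TensorProduct.homTensorHomMap (RingHom.id ℂ) (P ⊗[ℂ] Pᵐᵒᵖ) H (P ⊗[ℂ] Pᵐᵒᵖ) H
      (TensorProduct.map (LinearMap.mul ℂ (P ⊗[ℂ] Pᵐᵒᵖ) ∘ₗ
        (Algebra.TensorProduct.includeRight : Pᵐᵒᵖ →ₐ[ℂ] P ⊗[ℂ] Pᵐᵒᵖ).toLinearMap ∘ₗ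
          (opLinearEquiv ℂ).toLinearMap) (LinearMap.mul ℂ H).flip y)

theorem sandwich_tmul (p q : P) (g h k : H) (w : P ⊗[ℂ] Pᵐᵒᵖ) :
    sandwich (p ⊗ₜ[ℂ] g) (q ⊗ₜ[ℂ] h) (w ⊗ₜ[ℂ] k) =
      ((p ⊗ₜ[ℂ] op q) * w) ⊗ₜ[ℂ] (g * k * h) := by
  simp [sandwich, ← mul_assoc]

theorem sandwich_add_left (x x' y : P ⊗[ℂ] H) :
    sandwich (x + x') y = sandwich x y + sandwich x' y := by
  ext; simp [sandwich, add_mul]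

theorem sandwich_add_right (x y y' : P ⊗[ℂ] H) :
    sandwich x (y + y') = sandwich x y + sandwich x y' := by
  ext; simp [sandwich, mul_add]

theorem sandwich_zero_left (y : P ⊗[ℂ] H) : sandwich 0 y = 0 := by
  ext; simp [sandwich]

theorem sandwich_zero_right (x : P ⊗[ℂ] H) : sandwich x 0 = 0 := by
  ext; simp [sandwich]

theorem pair_mul (x x' y y' : P ⊗[ℂ] H) :
    pair (x * x') (y' * y) = sandwich x y (pair x' y') := by
  induction x with
  | zero => simp [sandwich_zero_left]
  | add a b ha hb => simp [add_mul, sandwich_add_left, ha, hb]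
  | tmul p g =>
  induction y with
  | zero => simp [sandwich_zero_right]
  | add a b ha hb => simp [mul_add, sandwich_add_right, ha, hb]
  | tmul q h =>
  induction x' with
  | zero => simp
  | add a b ha hb => simp [mul_add, ha, hb]
  | tmul p' g' =>
  induction y' with
  | zero => simp
  | add a b ha hb => rw [add_mul, map_add, map_add, map_add, ha, hb]
  | tmul q' h' => simp [sandwich_tmul, mul_assoc]

theorem sandwich_one (x y : P ⊗[ℂ] H) (w : P ⊗[ℂ] Pᵐᵒᵖ) :
    sandwich x y (w ⊗ₜ 1) = pair x y * (w ⊗ₜ 1) := by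
  induction x with
  | zero => simp [sandwich_zero_left]
  | add a b ha hb => simp [add_mul, sandwich_add_left, ha, hb]
  | tmul p g =>
  induction y with
  | zero => simp [sandwich_zero_right]
  | add a b ha hb => simp [add_mul, sandwich_add_right, ha, hb]
  | tmul q h => simp [sandwich_tmul]

/-- The product of `P ⊗ Pᵐᵒᵖ` with a diagonally coinvariant second factor. -/
theorem diag_mul (x y : P ⊗[ℂ] Pᵐᵒᵖ) (hy : δ.diag y = y ⊗ₜ 1) :
    δ.diag (x * y) = δ.diag x * (y ⊗ₜ 1) := by
  induction x with
  | zero => simp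
  | add a b ha hb => simp [add_mul, ha, hb]
  | tmul p q =>
    have h : ∀ y, δ.diag (p ⊗ₜ q * y) = sandwich (δ.coact p) (δ.coact (unop q)) (δ.diag y) := by
      intro y
      induction y with
      | zero => simp
      | add a b ha hb => simp [mul_add, ha, hb]
      | tmul r u =>
        have h1 := δ.diag_tmul (p * r) (unop u * unop q)
        have h2 := δ.diag_tmul r (unop u)
        simp only [op_mul, op_unop] at h1 h2
        rw [Algebra.TensorProduct.tmul_mul_tmul, h1, h2, map_mul δ.coact, map_mul δ.coact, pair_mul]
    have h3 := δ.diag_tmul p (unop q)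
    rw [op_unop] at h3
    rw [h, hy, sandwich_one, h3]

/-- The Ehresmann-Schauenburg algebra `L(P, H) = (P ⊗ P)^{co H}`, with
`(p ⊗ q)(r ⊗ u) = p r ⊗ u q`, as a subalgebra of `P ⊗ Pᵐᵒᵖ`. -/
def ES : Subalgebra ℂ (P ⊗[ℂ] Pᵐᵒᵖ) where
  carrier := {x | δ.diag x = x ⊗ₜ 1}
  mul_mem' {x y} hx hy := by
    simp only [Set.mem_ofPred_eq] at hx hy ⊢
    rw [δ.diag_mul x y hy, hx, Algebra.TensorProduct.tmul_mul_tmul, one_mul]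
  add_mem' {x y} hx hy := by
    simp only [Set.mem_ofPred_eq] at hx hy ⊢
    rw [map_add, hx, hy, TensorProduct.add_tmul]
  algebraMap_mem' c := by
    have h : δ.diag (1 : P ⊗[ℂ] Pᵐᵒᵖ) = 1 := by
      have h := δ.diag_tmul 1 1
      rw [map_one, op_one, Algebra.TensorProduct.one_def, pair_tmul, mul_one] at h
      exact h
    simp only [Set.mem_ofPred_eq, Algebra.algebraMap_eq_smul_one, map_smul, h]
    rfl

/-- The source and target maps `s(b) = b ⊗ 1` and `t(b) = 1 ⊗ b` of `L(P, H)`. -/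
def ESbase : EnvRing δ.coinv δ.ES where
  src := ((Algebra.TensorProduct.includeLeft : P →ₐ[ℂ] P ⊗[ℂ] Pᵐᵒᵖ).comp δ.coinv.val).codRestrict
    δ.ES fun b => by
      change δ.diag ((b : P) ⊗ₜ op 1) = ((b : P) ⊗ₜ op 1) ⊗ₜ 1
      rw [diag_tmul, coact_coinv, map_one, Algebra.TensorProduct.one_def, pair_tmul, mul_one]
  tgt := AlgHom.ofLinearMap
    ((opLinearEquiv ℂ).toLinearMap ∘ₗ
      (((Algebra.TensorProduct.includeRight : Pᵐᵒᵖ →ₐ[ℂ] P ⊗[ℂ] Pᵐᵒᵖ).toLinearMap ∘ₗ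
        (opLinearEquiv ℂ).toLinearMap ∘ₗ δ.coinv.val.toLinearMap).codRestrict
          (Subalgebra.toSubmodule δ.ES) fun b => by
        change δ.diag (1 ⊗ₜ op (b : P)) = (1 ⊗ₜ op (b : P)) ⊗ₜ 1
        rw [diag_tmul, coact_coinv, map_one, Algebra.TensorProduct.one_def, pair_tmul, mul_one]))
    rfl
    (fun a b => by
      refine unop_injective (Subtype.ext ?_)
      change (1 : P) ⊗ₜ[ℂ] op ((a : P) * b) = (1 ⊗ₜ[ℂ] op (b : P)) * (1 ⊗ₜ[ℂ] op (a : P))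
      simp)
  comm a b := Subtype.ext <| by
    change ((a : P) ⊗ₜ[ℂ] 1) * (1 ⊗ₜ[ℂ] op (b : P)) = (1 ⊗ₜ[ℂ] op (b : P)) * ((a : P) ⊗ₜ[ℂ] 1)
    simp

theorem ESbase_s (b : δ.coinv) : (δ.ESbase.s b : P ⊗[ℂ] Pᵐᵒᵖ) = (b : P) ⊗ₜ 1 := rfl

theorem ESbase_t (b : δ.coinv) : (δ.ESbase.t b : P ⊗[ℂ] Pᵐᵒᵖ) = 1 ⊗ₜ op (b : P) := rfl

/-- The multiplication `p ⊗ q ↦ p q`, as a map on `P ⊗ Pᵐᵒᵖ`. -/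
def mulMap : P ⊗[ℂ] Pᵐᵒᵖ →ₗ[ℂ] P :=
  LinearMap.mul' ℂ P ∘ₗ (opLinearEquiv ℂ).symm.toLinearMap.lTensor P

/-- The flip `p ⊗ q ↦ q ⊗ p`, as a map on `P ⊗ Pᵐᵒᵖ`. -/
def flipMap : P ⊗[ℂ] Pᵐᵒᵖ →ₗ[ℂ] P ⊗[ℂ] Pᵐᵒᵖ :=
  TensorProduct.map (opLinearEquiv ℂ).symm.toLinearMap (opLinearEquiv ℂ).toLinearMap ∘ₗ
    (TensorProduct.comm ℂ P Pᵐᵒᵖ).toLinearMap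

/-- The map `(P ⊗ P) ⊗ (P ⊗ P) → P ⊗ (P ⊗_B P) ⊗ P`, `(p ⊗ q) ⊗ (r ⊗ u) ↦ p ⊗ (q ⊗_B r) ⊗ u`. -/
def middle : (P ⊗[ℂ] Pᵐᵒᵖ) ⊗[ℂ] (P ⊗[ℂ] Pᵐᵒᵖ) →ₗ[ℂ] P ⊗[ℂ] (δ.PBP ⊗[ℂ] Pᵐᵒᵖ) :=
  ((TensorProduct.lift ((BalTensor.mk (fun b : δ.coinv => LinearMap.mulRight ℂ (b : P))
          (fun b : δ.coinv => LinearMap.mulLeft ℂ (b : P))) ∘ₗ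
        (opLinearEquiv ℂ).symm.toLinearMap)).rTensor Pᵐᵒᵖ ∘ₗ
      (TensorProduct.assoc ℂ Pᵐᵒᵖ P Pᵐᵒᵖ).symm.toLinearMap).lTensor P ∘ₗ
    (TensorProduct.assoc ℂ P Pᵐᵒᵖ (P ⊗[ℂ] Pᵐᵒᵖ)).toLinearMap

@[simp]
theorem middle_tmul (p q r u : P) :
    δ.middle ((p ⊗ₜ op q) ⊗ₜ (r ⊗ₜ op u)) = p ⊗ₜ (BalTensor.mk _ _ q r ⊗ₜ op u) := by
  simp [middle]

/-- The canonical map `L ⊗_B L → P ⊗ (P ⊗_B P) ⊗ P`, induced by the inclusion of `L = L(P, H)` in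
`P ⊗ P`: `(p ⊗ q) ⊗_B (r ⊗ u) ↦ p ⊗ (q ⊗_B r) ⊗ u`. -/
def expand : δ.ESbase.LTens →ₗ[ℂ] P ⊗[ℂ] (δ.PBP ⊗[ℂ] Pᵐᵒᵖ) :=
  BalTensor.lift ((TensorProduct.curry δ.middle).compl₁₂ δ.ES.val.toLinearMap
      δ.ES.val.toLinearMap) fun b X Y => by
    change δ.middle (((1 ⊗ₜ op (b : P)) * (X : P ⊗[ℂ] Pᵐᵒᵖ)) ⊗ₜ (Y : P ⊗[ℂ] Pᵐᵒᵖ)) =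
      δ.middle ((X : P ⊗[ℂ] Pᵐᵒᵖ) ⊗ₜ ((((b : P) ⊗ₜ 1) : P ⊗[ℂ] Pᵐᵒᵖ) * (Y : P ⊗[ℂ] Pᵐᵒᵖ)))
    generalize (X : P ⊗[ℂ] Pᵐᵒᵖ) = x
    generalize (Y : P ⊗[ℂ] Pᵐᵒᵖ) = y
    induction x with
    | zero => simp
    | add x x' hx hx' => simp [mul_add, TensorProduct.add_tmul, hx, hx']
    | tmul p q =>
    induction y with
    | zero => simp
    | add y y' hy hy' =>
      rw [mul_add, TensorProduct.tmul_add, TensorProduct.tmul_add, map_add, map_add, hy, hy']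
    | tmul r u =>
      have h := BalTensor.mk_bal (fun b : δ.coinv => LinearMap.mulRight ℂ (b : P))
        (fun b : δ.coinv => LinearMap.mulLeft ℂ (b : P)) b (unop q) r
      have h1 := δ.middle_tmul p (unop q * b) r (unop u)
      have h2 := δ.middle_tmul p (unop q) (b * r) (unop u)
      simp only [op_mul, op_unop] at h1 h2
      rw [Algebra.TensorProduct.tmul_mul_tmul, Algebra.TensorProduct.tmul_mul_tmul, one_mul,
        one_mul, h1, h2]
      exact congrArg (fun z => p ⊗ₜ[ℂ] (z ⊗ₜ[ℂ] u)) h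

/-- The map `p ⊗ q ↦ p₍₀₎ ⊗ τ(p₍₁₎) ⊗ q` from `P ⊗ P` to `P ⊗ (P ⊗_B P) ⊗ P`. -/
noncomputable def comulFormula (hδ : δ.IsGalois) :
    P ⊗[ℂ] Pᵐᵒᵖ →ₗ[ℂ] P ⊗[ℂ] (δ.PBP ⊗[ℂ] Pᵐᵒᵖ) :=
  (TensorProduct.assoc ℂ P δ.PBP Pᵐᵒᵖ).toLinearMap ∘ₗ
    ((δ.translation hδ).lTensor P ∘ₗ δ.coact.toLinearMap).rTensor Pᵐᵒᵖ

/-- `𝓛` is the Ehresmann-Schauenburg bialgebroid `L(P, H)` of a Hopf-Galois extension: on top of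
the algebra `L(P, H)` with `s(b) = b ⊗ 1` and `t(b) = 1 ⊗ b`, the coproduct is
`Δ(p ⊗ q) = (p₍₀₎ ⊗ τ(p₍₁₎)⟨1⟩) ⊗_B (τ(p₍₁₎)⟨2⟩ ⊗ q)` and the counit is `ε(p ⊗ q) = p q`. -/
structure IsESBialgebroid (hδ : δ.IsGalois) (𝓛 : LeftBialgebroid δ.ESbase) : Prop where
  comul_eq : ∀ X : δ.ES, δ.expand (𝓛.comul X) = δ.comulFormula hδ (X : P ⊗[ℂ] Pᵐᵒᵖ)
  counit_eq : ∀ X : δ.ES, (𝓛.counit X : P) = mulMap (X : P ⊗[ℂ] Pᵐᵒᵖ)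

end

end ComoduleAlgebra

/-- The antilinear map `p ⊗ q ↦ p^* ⊗ q^*` on `P ⊗ Pᵐᵒᵖ`. -/
def tensorStar (P : Type*) [Ring P] [Algebra ℂ P] [StarRing P] [StarModule ℂ P] :
    P ⊗[ℂ] Pᵐᵒᵖ →ₛₗ[starRingEnd ℂ] P ⊗[ℂ] Pᵐᵒᵖ :=
  TensorProduct.map (starLinearEquiv ℂ (A := P)).toLinearMap
    (starLinearEquiv ℂ (A := Pᵐᵒᵖ)).toLinearMap

theorem tensorStar_tmul {P : Type*} [Ring P] [Algebra ℂ P] [StarRing P] [StarModule ℂ P]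
    (p q : P) : tensorStar P (p ⊗ₜ op q) = star p ⊗ₜ op (star q) := rfl

/-! ## Right actions and faithfully flat descent -/

/-! The proof replaces the formula for the coproduct, which involves the translation map, by an
embedding into tensor powers of `P`. The map `fuse : L ⊗_B L → P ⊗ P ⊗ P`, `(p ⊗ q) ⊗ (r ⊗ u) ↦ p ⊗
q r ⊗ u`, is injective, and its image is the space of coinvariants for the diagonal coaction. Since
`p ⊗ 1 ⊗ q` is coinvariant when `p ⊗ q` is, there is exactly one `Δ(p ⊗ q)` with `fuse (Δ(p ⊗ q)) =
p ⊗ 1 ⊗ q`. With the analogous injection of `L ⊗_B L ⊗_B L` into `P ⊗ P ⊗ P ⊗ P`, every bialgebroid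
axiom becomes an elementary identity about multiplying legs and inserting units: coassociativity,
for instance, says that both sides are `p ⊗ 1 ⊗ 1 ⊗ q`.

The embedding rests on faithfully flat descent. The structure theorem for relative Hopf modules,
`extend_bijective_of_coinvariants`, gives `V^{co H} ⊗_B P ≅ V`. For `V = P ⊗ P` this is `L ⊗_B P ≅ P
⊗ P`, and iterating it (`extend_fuseMap_bijective`) gives `L ⊗_B L ⊗_B P ≅ P ⊗ P ⊗ P`. Hence `fuse`
becomes bijective onto the coinvariants after `- ⊗_B P`, and faithful flatness lets injectivity
(`fuse_injective`) and surjectivity (`mem_range_fuse`) descend.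

The formula for `Δ` is recovered by applying `χ` to the middle factor of `P ⊗ (P ⊗_B P) ⊗ P`: there
`expand` turns into `fuse` followed by the injective map `codiag₂ ⊗ id` (`canMid_expand`), and
`χ(τ(h)) = 1 ⊗ h` turns the formula into the image of `p ⊗ 1 ⊗ q`. This also proves that `expand` is
injective.

The antipode is the flip of the two legs, which preserves coinvariants because `H` is commutative.
Under `fuse` the two antipode identities become cyclic rotations of `p ⊗ 1 ⊗ q`. The right
bialgebroid is the left one transported along `X ⊗ Y ↦ S⁻¹(Y) ⊗ S⁻¹(X)`, and compatibility of the
`*`-structure with the coproducts amounts to `p ⊗ 1 ⊗ q` being sent by star and reversal to `q^* ⊗ 1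
⊗ p^*`. -/

/-- `ρ` is a right action of the algebra `B` on `M`. -/
structure IsRightAction {B M : Type*} [Ring B] [Algebra ℂ B] [AddCommGroup M] [Module ℂ M]
    (ρ : B → M →ₗ[ℂ] M) : Prop where
  one : ∀ m, ρ 1 m = m
  mul : ∀ a b m, ρ (a * b) m = ρ b (ρ a m)
  add : ∀ a b m, ρ (a + b) m = ρ a m + ρ b m
  smul : ∀ (c : ℂ) a m, ρ (c • a) m = c • ρ a m

namespace IsRightAction

variable {B M : Type*} [Ring B] [Algebra ℂ B] [AddCommGroup M] [Module ℂ M]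
  {ρ : B → M →ₗ[ℂ] M} (h : IsRightAction ρ)
include h

theorem zero (m : M) : ρ 0 m = 0 := by
  have := h.smul 0 0 m
  rwa [zero_smul, zero_smul] at this

/-- The module over the opposite algebra given by a right action. -/
@[reducible]
def toModule : Module Bᵐᵒᵖ M where
  smul b m := ρ (unop b) m
  one_smul m := h.one m
  mul_smul _ _ m := h.mul _ _ m
  smul_zero _ := map_zero _
  smul_add _ := map_add _
  add_smul _ _ m := h.add _ _ m
  zero_smul m := h.zero m

/-- The orbit map `b ↦ m b`. -/
def orbit (m : M) : B →ₗ[ℂ] M where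
  toFun b := ρ b m
  map_add' a b := h.add a b m
  map_smul' c a := h.smul c a m

@[simp]
theorem orbit_apply (m : M) (b : B) : h.orbit m b = ρ b m := rfl

end IsRightAction

namespace BalTensor

section
variable {B M N Q : Type*} [AddCommGroup M] [Module ℂ M] [AddCommGroup N] [Module ℂ N]
  [AddCommGroup Q] [Module ℂ Q]
  {ρ : B → M →ₗ[ℂ] M} {ρ' : B → N →ₗ[ℂ] N} {σ : B → Q →ₗ[ℂ] Q}

/-- `f ⊗_B id` for a map `f` of right `B`-modules. -/
def mapLeft (σ : B → Q →ₗ[ℂ] Q) (f : M →ₗ[ℂ] N) (hf : ∀ b m, f (ρ b m) = ρ' b (f m)) :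
    BalTensor ρ σ →ₗ[ℂ] BalTensor ρ' σ :=
  BalTensor.map f LinearMap.id fun b m q => by
    rw [hf, LinearMap.id_apply, LinearMap.id_apply, mk_bal]

@[simp]
theorem mapLeft_mk (f : M →ₗ[ℂ] N) (hf : ∀ b m, f (ρ b m) = ρ' b (f m)) (m : M) (q : Q) :
    mapLeft σ f hf (mk ρ σ m q) = mk ρ' σ (f m) q := rfl

/-- `id ⊗_B g` for a map `g` of left `B`-modules. -/
def mapRight (ρ : B → M →ₗ[ℂ] M) {σ : B → Q →ₗ[ℂ] Q} {σ' : B → N →ₗ[ℂ] N} (g : Q →ₗ[ℂ] N)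
    (hg : ∀ b q, σ' b (g q) = g (σ b q)) : BalTensor ρ σ →ₗ[ℂ] BalTensor ρ σ' :=
  BalTensor.map LinearMap.id g fun b m q => by
    rw [LinearMap.id_apply, LinearMap.id_apply, mk_bal, hg]

@[simp]
theorem mapRight_mk {σ' : B → N →ₗ[ℂ] N} (g : Q →ₗ[ℂ] N) (hg : ∀ b q, σ' b (g q) = g (σ b q))
    (m : M) (q : Q) : mapRight ρ g hg (mk ρ σ m q) = mk ρ σ' m (g q) := rfl

theorem mapLeft_zero (hf : ∀ b m, (0 : M →ₗ[ℂ] N) (ρ b m) = ρ' b ((0 : M →ₗ[ℂ] N) m)) :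
    mapLeft σ 0 hf = 0 :=
  hom_ext fun m q => by simp

/-- No case for zero is needed, because `0` is the class of `0 ⊗ 0`. -/
theorem mk_surj_induction {p : BalTensor ρ σ → Prop} (z : BalTensor ρ σ)
    (hmk : ∀ m q, p (mk ρ σ m q)) (hadd : ∀ x y, p x → p y → p (x + y)) : p z := by
  obtain ⟨w, rfl⟩ := Submodule.mkQ_surjective _ z
  induction w with
  | zero => simpa using hmk 0 0
  | tmul m n => exact hmk m n
  | add x y hx hy => rw [map_add]; exact hadd _ _ hx hy

end

end BalTensor

namespace BalTensor

section
variable {B M N Q : Type*} [AddCommGroup M] [Module ℂ M] [AddCommGroup N] [Module ℂ N]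
  [AddCommGroup Q] [Module ℂ Q] {ρ : B → M →ₗ[ℂ] M} {ρ' : B → N →ₗ[ℂ] N} {σ : B → Q →ₗ[ℂ] Q}
  {f f₁ f₂ : M →ₗ[ℂ] N} {hf : ∀ b m, f (ρ b m) = ρ' b (f m)}
  {hf₁ : ∀ b m, f₁ (ρ b m) = ρ' b (f₁ m)} {hf₂ : ∀ b m, f₂ (ρ b m) = ρ' b (f₂ m)}

/-- The `B`-linearity proof is an argument of `mapLeft`, so additivity in `f` is expressed through
values, with independent linearity proofs for the three maps. -/
theorem mapLeft_eq_add (h : ∀ m, f m = f₁ m + f₂ m) (z : BalTensor ρ σ) :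
    mapLeft σ f hf z = mapLeft σ f₁ hf₁ z + mapLeft σ f₂ hf₂ z := by
  induction z using mk_surj_induction with
  | hadd x y hx hy => rw [map_add, map_add, map_add, hx, hy]; abel
  | hmk m n => rw [mapLeft_mk, mapLeft_mk, mapLeft_mk, h, map_add, LinearMap.add_apply]

theorem mapLeft_eq_smul (c : ℂ) (h : ∀ m, f m = c • f₁ m) (z : BalTensor ρ σ) :
    mapLeft σ f hf z = c • mapLeft σ f₁ hf₁ z := by
  induction z using mk_surj_induction with
  | hadd x y hx hy => rw [map_add, map_add, hx, hy, smul_add]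
  | hmk m n => rw [mapLeft_mk, mapLeft_mk, h, map_smul, LinearMap.smul_apply]

end

end BalTensor

section FaithfullyFlat

open BalTensor

universe w₁ w₂ w₃

variable {B Q : Type*} [Ring B] [Algebra ℂ B] [AddCommGroup Q] [Module ℂ Q] [Module B Q]
  [IsScalarTower ℂ B Q] {σ : B → Q →ₗ[ℂ] Q}

/-- Replacing `M` by a copy in a larger universe, with a module structure in place of an action. -/
def BalTensor.uliftEquiv {M : Type w₁} [AddCommGroup M] [Module ℂ M] [Module Bᵐᵒᵖ M]
    [IsScalarTower ℂ Bᵐᵒᵖ M] {ρ : B → M →ₗ[ℂ] M} (hρ : ∀ b m, ρ b m = op b • m)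
    (hσ : ∀ b q, σ b q = b • q) :
    BalTensor ρ σ ≃ₗ[ℂ] ModTensor B Q (ULift.{w₂} M) :=
  LinearEquiv.ofLinearMap
    (BalTensor.map (ULift.moduleEquiv (R := ℂ) (M := M)).symm.toLinearMap LinearMap.id
      fun b m q => by
        rw [hρ, LinearMap.id_apply, LinearMap.id_apply, hσ]
        exact mk_bal (fun b : B => Algebra.lsmul ℂ ℂ (ULift.{w₂} M) (op b))
          (fun b : B => Algebra.lsmul ℂ ℂ Q b) b (ULift.up m) q)
    (BalTensor.map (ULift.moduleEquiv (R := ℂ) (M := M)).toLinearMap LinearMap.id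
      fun b m q => by
        have := mk_bal ρ σ b m.down q
        rw [hρ, hσ] at this
        exact this)
    (BalTensor.hom_ext fun m q => rfl)
    (BalTensor.hom_ext fun m q => rfl)

variable {M : Type w₁} {N : Type w₂} {K : Type w₃} [AddCommGroup M] [Module ℂ M]
  [AddCommGroup N] [Module ℂ N] [AddCommGroup K] [Module ℂ K]
  {ρ : B → M →ₗ[ℂ] M} {ρ' : B → N →ₗ[ℂ] N} {ρ'' : B → K →ₗ[ℂ] K}

/-- Faithful flatness is assumed for module instances in one universe, whereas the applications have
actions `ρ` on spaces in different universes. The actions become modules over `Bᵐᵒᵖ` on lifted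
copies, and `uliftEquiv` identifies the tensor products. -/
theorem IsFaithfullyFlatLeft.exact_iff (hQ : IsFaithfullyFlatLeft.{max w₁ w₂ w₃} B Q)
    (hσ : ∀ b q, σ b q = b • q) (hρ : IsRightAction ρ) (hρ' : IsRightAction ρ')
    (hρ'' : IsRightAction ρ'') {f : M →ₗ[ℂ] N} (hf : ∀ b m, f (ρ b m) = ρ' b (f m))
    {g : N →ₗ[ℂ] K} (hg : ∀ b m, g (ρ' b m) = ρ'' b (g m)) :
    Function.Exact f g ↔ Function.Exact (mapLeft σ f hf) (mapLeft σ g hg) := by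
  let _ := hρ.toModule
  let _ := hρ'.toModule
  let _ := hρ''.toModule
  have : IsScalarTower ℂ Bᵐᵒᵖ M := ⟨fun c b m => hρ.smul c (unop b) m⟩
  have : IsScalarTower ℂ Bᵐᵒᵖ N := ⟨fun c b m => hρ'.smul c (unop b) m⟩
  have : IsScalarTower ℂ Bᵐᵒᵖ K := ⟨fun c b m => hρ''.smul c (unop b) m⟩
  let F : ULift.{max w₂ w₃} M →ₗ[Bᵐᵒᵖ] ULift.{max w₁ w₃} N :=
    { toFun := fun m => ULift.up (f m.down)
      map_add' := fun x y => congrArg ULift.up (map_add f _ _)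
      map_smul' := fun b m => congrArg ULift.up (hf (unop b) m.down) }
  let G : ULift.{max w₁ w₃} N →ₗ[Bᵐᵒᵖ] ULift.{max w₁ w₂} K :=
    { toFun := fun m => ULift.up (g m.down)
      map_add' := fun x y => congrArg ULift.up (map_add g _ _)
      map_smul' := fun b m => congrArg ULift.up (hg (unop b) m.down) }
  have h := hQ (ULift.{max w₂ w₃} M) (ULift.{max w₁ w₃} N) (ULift.{max w₁ w₂} K) F G
  have h1 : Function.Exact f g ↔ Function.Exact F G := by
    constructor
    · intro H y
      have := H y.down
      rw [show G y = 0 ↔ g y.down = 0 from ⟨congrArg ULift.down, congrArg ULift.up⟩, this]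
      exact ⟨fun ⟨x, hx⟩ => ⟨ULift.up x, congrArg ULift.up hx⟩,
        fun ⟨x, hx⟩ => ⟨x.down, congrArg ULift.down hx⟩⟩
    · intro H y
      have := H (ULift.up y)
      rw [show g y = 0 ↔ G (ULift.up y) = 0 from ⟨congrArg ULift.up, congrArg ULift.down⟩, this]
      exact ⟨fun ⟨x, hx⟩ => ⟨x.down, congrArg ULift.down hx⟩,
        fun ⟨x, hx⟩ => ⟨ULift.up x, congrArg ULift.up hx⟩⟩
  rw [h1, h]
  exact Function.Exact.iff_of_ladder_linearEquiv
    (e₁ := uliftEquiv (fun _ _ => rfl) hσ) (e₂ := uliftEquiv (fun _ _ => rfl) hσ)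
    (e₃ := uliftEquiv (fun _ _ => rfl) hσ)
    (BalTensor.hom_ext fun _ _ => rfl) (BalTensor.hom_ext fun _ _ => rfl)

/-- The universe of the zero module is left free so that the maximum of the universes in an exact
sequence can be matched with the one in the flatness hypothesis. -/
theorem isRightAction_zero :
    IsRightAction (fun _ : B => (0 : PUnit.{w₃ + 1} →ₗ[ℂ] PUnit.{w₃ + 1})) :=
  ⟨fun _ => rfl, fun _ _ _ => rfl, fun _ _ _ => rfl, fun _ _ _ => rfl⟩

/-- Injectivity of `f` is exactness of `0 → M → N`; both preservation and reflection of exactness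
are used. -/
theorem IsFaithfullyFlatLeft.injective_iff (hQ : IsFaithfullyFlatLeft.{max w₁ w₂ w₃} B Q)
    (hσ : ∀ b q, σ b q = b • q) (hρ : IsRightAction ρ) (hρ' : IsRightAction ρ')
    {f : M →ₗ[ℂ] N} (hf : ∀ b m, f (ρ b m) = ρ' b (f m)) :
    Function.Injective f ↔ Function.Injective (mapLeft σ f hf) := by
  have h := IsFaithfullyFlatLeft.exact_iff hQ hσ (isRightAction_zero.{w₃} (B := B)) hρ hρ'
    (f := 0) (fun b m => by simp) hf
  rw [injective_iff_map_eq_zero, injective_iff_map_eq_zero]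
  rw [mapLeft_zero] at h
  constructor
  · intro H
    refine fun z hz => ?_
    have := (h.1 fun y => ⟨fun hy => ⟨PUnit.unit, (H y hy).symm⟩,
      fun ⟨x, hx⟩ => by rw [← hx]; simp⟩) z
    obtain ⟨x, hx⟩ := this.1 hz
    exact hx.symm
  · intro H
    refine fun z hz => ?_
    have := (h.2 fun y => ⟨fun hy => ⟨0, (H y hy).symm⟩,
      fun ⟨x, hx⟩ => by rw [← hx]; simp⟩) z
    obtain ⟨x, hx⟩ := this.1 hz
    exact hx.symm

/-- Surjectivity is exactness of `M → N → 0`, which faithful flatness reflects. -/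
theorem IsFaithfullyFlatLeft.surjective_of_mapLeft (hQ : IsFaithfullyFlatLeft.{max w₁ w₂ w₃} B Q)
    (hσ : ∀ b q, σ b q = b • q) (hρ : IsRightAction ρ) (hρ' : IsRightAction ρ')
    {f : M →ₗ[ℂ] N} (hf : ∀ b m, f (ρ b m) = ρ' b (f m))
    (h : Function.Surjective (mapLeft σ f hf)) : Function.Surjective f := by
  have h' := IsFaithfullyFlatLeft.exact_iff hQ hσ hρ hρ' (isRightAction_zero.{w₃} (B := B))
    hf (g := 0) (fun b m => by simp)
  refine fun y => ((h'.2 fun z => ?_) y).1 rfl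
  refine ⟨fun _ => h z, fun _ => ?_⟩
  rw [mapLeft_zero, LinearMap.zero_apply]

end FaithfullyFlat

/-! ## Hopf modules over a Hopf-Galois extension -/

namespace IsRightAction

section

variable {A M : Type*} [Ring A] [Algebra ℂ A] [AddCommGroup M] [Module ℂ M]
  {ρ : A → M →ₗ[ℂ] M} (h : IsRightAction ρ)

/-- The orbit map as a bilinear map `m ↦ a ↦ m a`. -/
def orbitₗ : M →ₗ[ℂ] A →ₗ[ℂ] M where
  toFun m := h.orbit m
  map_add' m m' := LinearMap.ext fun a => map_add (ρ a) m m'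
  map_smul' c m := LinearMap.ext fun a => map_smul (ρ a) c m

@[simp]
theorem orbitₗ_apply (m : M) : h.orbitₗ m = h.orbit m := rfl

include h in
theorem comp {C : Type*} [Ring C] [Algebra ℂ C] (φ : C →ₐ[ℂ] A) :
    IsRightAction fun c => ρ (φ c) :=
  ⟨fun m => by simpa using h.one m, fun a b m => by simpa using h.mul _ _ m,
    fun a b m => by simpa using h.add _ _ m, fun c a m => by simpa using h.smul c _ m⟩

variable {C N : Type*} [Ring C] [Algebra ℂ C] [AddCommGroup N] [Module ℂ N]
  {ρ' : C → N →ₗ[ℂ] N} (h' : IsRightAction ρ')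

/-- The action of `A ⊗ C` on `M ⊗ N`. -/
noncomputable def tensorAct : A ⊗[ℂ] C →ₗ[ℂ] M ⊗[ℂ] N →ₗ[ℂ] M ⊗[ℂ] N :=
  TensorProduct.homTensorHomMap (RingHom.id ℂ) M N M N ∘ₗ
    TensorProduct.map h.orbitₗ.flip h'.orbitₗ.flip

@[simp]
theorem tensorAct_tmul (a : A) (c : C) (m : M) (n : N) :
    h.tensorAct h' (a ⊗ₜ c) (m ⊗ₜ n) = ρ a m ⊗ₜ ρ' c n := rfl

theorem tensor : IsRightAction fun x => h.tensorAct h' x where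
  one x := by
    induction x with
    | zero => simp
    | add x y hx hy => simp_all
    | tmul m n => simp [Algebra.TensorProduct.one_def, h.one, h'.one]
  mul a b x := by
    induction x with
    | zero => simp
    | add x y hx hy => simp_all
    | tmul m n =>
    induction a with
    | zero => simp
    | add a a' ha ha' => simp [add_mul, ha, ha']
    | tmul a c =>
    induction b with
    | zero => simp
    | add a a' ha ha' => simp [mul_add, ha, ha']
    | tmul b d => simp [h.mul, h'.mul]
  add a b x := by simp
  smul c a x := by simp

end

theorem mulRight (A : Type*) [Ring A] [Algebra ℂ A] :
    IsRightAction fun a : A => LinearMap.mulRight ℂ a :=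
  ⟨fun m => by simp, fun a b m => by simp [mul_assoc], fun a b m => by simp [mul_add],
    fun c a m => by simp⟩

theorem lTensor {A M : Type*} [Ring A] [Algebra ℂ A] [AddCommGroup M] [Module ℂ M]
    {ρ : A → M →ₗ[ℂ] M} (h : IsRightAction ρ) (W : Type*) [AddCommGroup W] [Module ℂ W] :
    IsRightAction fun a : A => (ρ a).lTensor W where
  one x := by
    induction x with
    | zero => simp
    | add x y hx hy => simp_all
    | tmul m n => simp [h.one]
  mul a b x := by
    induction x with
    | zero => simp
    | add x y hx hy => simp_all
    | tmul m n => simp [h.mul]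
  add a b x := by
    induction x with
    | zero => simp
    | add x y hx hy => simp only [map_add, hx, hy]; abel
    | tmul m n => simp [h.add, TensorProduct.tmul_add]
  smul c a x := by
    induction x with
    | zero => simp
    | add x y hx hy => simp_all
    | tmul m n => simp [h.smul]

theorem balTensor {B M N C : Type*} [Ring C] [Algebra ℂ C] [AddCommGroup M] [Module ℂ M]
    [AddCommGroup N] [Module ℂ N] {ρ : B → M →ₗ[ℂ] M} {σ : B → N →ₗ[ℂ] N} {ρ' : C → N →ₗ[ℂ] N}
    (h : IsRightAction ρ') (hc : ∀ b c n, σ b (ρ' c n) = ρ' c (σ b n)) :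
    IsRightAction fun c => BalTensor.mapRight ρ (ρ' c) (hc · c) where
  one x := by
    induction x using BalTensor.mk_surj_induction with
    | hadd x y hx hy => simp_all
    | hmk m n => simp [h.one]
  mul a b x := by
    induction x using BalTensor.mk_surj_induction with
    | hadd x y hx hy => simp_all
    | hmk m n => simp [h.mul]
  add a b x := by
    induction x using BalTensor.mk_surj_induction with
    | hadd x y hx hy => simp only [map_add, hx, hy]; abel
    | hmk m n => simp [h.add]
  smul c a x := by
    induction x using BalTensor.mk_surj_induction with
    | hadd x y hx hy => simp_all
    | hmk m n => simp [h.smul]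

end IsRightAction

namespace ComoduleAlgebra

section

set_option maxSynthPendingDepth 3

variable {P H : Type*} [Ring P] [Algebra ℂ P] [Ring H] [HopfAlgebra ℂ H] (δ : ComoduleAlgebra P H)

/-- `M ⊗_B P`. -/
abbrev TensP {M : Type*} [AddCommGroup M] [Module ℂ M] (ρ : δ.coinv → M →ₗ[ℂ] M) : Type _ :=
  BalTensor ρ fun b : δ.coinv => LinearMap.mulLeft ℂ (b : P)

variable {V : Type*} [AddCommGroup V] [Module ℂ V] {ρ : P → V →ₗ[ℂ] V} (h : IsRightAction ρ)

include h in
theorem isRightAction_coinv : IsRightAction fun b : δ.coinv => ρ b := h.comp δ.coinv.val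

/-- This is `(v q) x = v (q x)`; with `δ(b) = b ⊗ 1` it makes `canMod` balanced over `B`. -/
theorem orbit_rTensor (q : P) (v : V) (x : P ⊗[ℂ] H) :
    (h.orbit (ρ q v)).rTensor H x = (h.orbit v).rTensor H ((q ⊗ₜ 1) * x) := by
  induction x with
  | zero => simp
  | add x y hx hy => simp only [mul_add, map_add, hx, hy]
  | tmul p k => simp [h.mul]

/-- The canonical map `V ⊗_B P → V ⊗ H`, `v ⊗ p ↦ v p₍₀₎ ⊗ p₍₁₎`, of a right `P`-module `V`. -/
noncomputable def canMod : δ.TensP (fun b : δ.coinv => ρ b) →ₗ[ℂ] V ⊗[ℂ] H :=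
  BalTensor.lift ((LinearMap.rTensorHom H ∘ₗ h.orbitₗ).compl₂ δ.coact.toLinearMap)
    fun b v p => by
      have hb := δ.coact_coinv b
      simpa [hb] using orbit_rTensor h (b : P) v (δ.coact p)

@[simp]
theorem canMod_mk (v : V) (p : P) :
    δ.canMod h (BalTensor.mk _ _ v p) = (h.orbit v).rTensor H (δ.coact p) := rfl

/-- The map `P ⊗_B P → V ⊗_B P`, `q ⊗ p ↦ v q ⊗ p`. -/
noncomputable def orbitBal : V →ₗ[ℂ] δ.PBP →ₗ[ℂ] δ.TensP (fun b : δ.coinv => ρ b) :=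
  LinearMap.mk₂ ℂ (fun v z => BalTensor.mapLeft (ρ' := fun b : δ.coinv => ρ b) _ (h.orbit v)
      (fun b p => h.mul p b v) z)
    (fun v v' z => BalTensor.mapLeft_eq_add (fun p => map_add (ρ p) v v') z)
    (fun c v z => BalTensor.mapLeft_eq_smul c (fun p => map_smul (ρ p) c v) z)
    (fun _ _ _ => map_add _ _ _) (fun _ _ _ => map_smul _ _ _)

@[simp]
theorem orbitBal_mk (v : V) (q p : P) :
    δ.orbitBal h v (BalTensor.mk _ _ q p) = BalTensor.mk _ _ (ρ q v) p := rfl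

theorem canMod_orbitBal (v : V) (z : δ.PBP) :
    δ.canMod h (δ.orbitBal h v z) = (h.orbit v).rTensor H (δ.can z) := by
  induction z using BalTensor.mk_surj_induction with
  | hadd x y hx hy => simp only [map_add, hx, hy]
  | hmk q p => rw [orbitBal_mk, canMod_mk, orbit_rTensor]; rfl

/-- Left `P`-linearity of `χ`, from which `χ⁻¹(q ⊗ k) = q τ(k)`. -/
theorem can_mul (q : P) (z : δ.PBP) :
    δ.can (δ.orbitBal (IsRightAction.mulRight P) q z) = (q ⊗ₜ 1) * δ.can z := by
  induction z using BalTensor.mk_surj_induction with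
  | hadd x y hx hy => simp only [map_add, hx, hy, mul_add]
  | hmk r p =>
    change ((q * r) ⊗ₜ[ℂ] (1 : H)) * δ.coact p = (q ⊗ₜ 1) * ((r ⊗ₜ 1) * δ.coact p)
    rw [← mul_assoc, Algebra.TensorProduct.tmul_mul_tmul, one_mul]

theorem can_translation (hgal : δ.IsGalois) (k : H) : δ.can (δ.translation hgal k) = 1 ⊗ₜ k :=
  (LinearEquiv.ofBijective δ.can hgal).apply_symm_apply _

theorem orbitBal_act (v : V) (q : P) (z : δ.PBP) :
    δ.orbitBal h (ρ q v) z = δ.orbitBal h v (δ.orbitBal (IsRightAction.mulRight P) q z) := by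
  induction z using BalTensor.mk_surj_induction with
  | hadd x y hx hy => simp only [map_add, hx, hy]
  | hmk r p => simp [h.mul]

/-- This is `χ` tensored with `V` over `P`, since `V ⊗_B P` is `V ⊗_P (P ⊗_B P)`. The inverse is `v
⊗ k ↦ v τ(k)`. -/
theorem IsGalois.canMod_bijective (hgal : δ.IsGalois) : Function.Bijective (δ.canMod h) := by
  have key : ∀ (v : V) (z : δ.PBP),
      TensorProduct.lift ((δ.orbitBal h).compl₂ (δ.translation hgal))
        ((h.orbit v).rTensor H (δ.can z)) = δ.orbitBal h v z := by
    intro v z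
    have : ∀ x : P ⊗[ℂ] H, TensorProduct.lift ((δ.orbitBal h).compl₂ (δ.translation hgal))
        ((h.orbit v).rTensor H x) =
          δ.orbitBal h v ((LinearEquiv.ofBijective δ.can hgal).symm x) := by
      intro x
      induction x with
      | zero => simp
      | add x y hx hy => simp only [map_add, hx, hy]
      | tmul q k =>
        have hz : (LinearEquiv.ofBijective δ.can hgal).symm (q ⊗ₜ k) =
            δ.orbitBal (IsRightAction.mulRight P) q (δ.translation hgal k) := by
          rw [LinearEquiv.symm_apply_eq]
          change _ = δ.can _
          rw [can_mul, can_translation, Algebra.TensorProduct.tmul_mul_tmul, mul_one, one_mul]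
        rw [hz, ← orbitBal_act]
        rfl
    rw [this, show δ.can z = LinearEquiv.ofBijective δ.can hgal z from rfl,
      LinearEquiv.symm_apply_apply]
  refine ⟨Function.LeftInverse.injective
    (g := TensorProduct.lift ((δ.orbitBal h).compl₂ (δ.translation hgal))) fun z => ?_, fun x => ?_⟩
  · induction z using BalTensor.mk_surj_induction with
    | hadd x y hx hy => simp only [map_add, hx, hy]
    | hmk v p =>
      -- The generator `v ⊗ p` is `v · (1 ⊗ p)`, which is of the form covered by `key`.
      have := key v (BalTensor.mk _ _ 1 p)
      rw [orbitBal_mk, h.one] at this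
      refine Eq.trans (congrArg _ ?_) this
      rw [canMod_mk]
      congr 1
      change δ.coact p = ((1 : P) ⊗ₜ[ℂ] (1 : H)) * δ.coact p
      rw [← Algebra.TensorProduct.one_def, one_mul]
  · induction x with
    | zero => exact ⟨0, map_zero _⟩
    | add x y hx hy =>
      obtain ⟨z, rfl⟩ := hx
      obtain ⟨w, rfl⟩ := hy
      exact ⟨z + w, map_add _ _ _⟩
    | tmul v k =>
      refine ⟨δ.orbitBal h v (δ.translation hgal k), ?_⟩
      rw [canMod_orbitBal, can_translation, LinearMap.rTensor_tmul, h.orbit_apply, h.one]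

/-- The diagonal action of `P` on `V ⊗ H`, `(v ⊗ h) p = v p₍₀₎ ⊗ h p₍₁₎`. -/
noncomputable def diagAct (p : P) : V ⊗[ℂ] H →ₗ[ℂ] V ⊗[ℂ] H :=
  h.tensorAct (IsRightAction.mulRight H) (δ.coact p)

theorem diagAct_isRightAction : IsRightAction (δ.diagAct h) :=
  (h.tensor (IsRightAction.mulRight H)).comp δ.coact

/-- For a coinvariant `v` this turns the Hopf module condition into `ν(v p) = v p₍₀₎ ⊗ p₍₁₎`, the
value of the canonical map at `v ⊗ p`. -/
theorem tensorAct_one (x : P ⊗[ℂ] H) (v : V) :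
    h.tensorAct (IsRightAction.mulRight H) x (v ⊗ₜ 1) = (h.orbit v).rTensor H x := by
  induction x with
  | zero => simp
  | add x y hx hy => simp only [map_add, hx, hy, LinearMap.add_apply]
  | tmul p k => simp

/-- The map `M ⊗_B P → V`, `m ⊗ p ↦ f(m) p`, for a map of right `B`-modules from `M` to a right
`P`-module `V`. -/
noncomputable def extend {M : Type*} [AddCommGroup M] [Module ℂ M] {ρM : δ.coinv → M →ₗ[ℂ] M}
    (f : M →ₗ[ℂ] V) (hf : ∀ b m, f (ρM b m) = ρ b (f m)) : δ.TensP ρM →ₗ[ℂ] V :=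
  BalTensor.lift (h.orbitₗ ∘ₗ f) fun b m p => by simp [hf, h.mul]

@[simp]
theorem extend_mk {M : Type*} [AddCommGroup M] [Module ℂ M] {ρM : δ.coinv → M →ₗ[ℂ] M}
    (f : M →ₗ[ℂ] V) (hf : ∀ b m, f (ρM b m) = ρ b (f m)) (m : M) (p : P) :
    δ.extend h f hf (BalTensor.mk _ _ m p) = ρ p (f m) := rfl

end

end ComoduleAlgebra

theorem rTensor_lTensor_comm {M M' N N' : Type*} [AddCommGroup M] [Module ℂ M] [AddCommGroup M']
    [Module ℂ M'] [AddCommGroup N] [Module ℂ N] [AddCommGroup N'] [Module ℂ N'] (f : M →ₗ[ℂ] M')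
    (g : N →ₗ[ℂ] N') (x : M ⊗[ℂ] N) :
    f.rTensor N' (g.lTensor M x) = g.lTensor M' (f.rTensor N x) := by
  rw [← LinearMap.comp_apply, ← LinearMap.comp_apply, LinearMap.rTensor_comp_lTensor,
    LinearMap.lTensor_comp_rTensor]

/-! ### Iterating isomorphisms of the form `M ⊗_B P ≅ V` -/

namespace ComoduleAlgebra

section Iterate

set_option maxSynthPendingDepth 3

variable {P H : Type*} [Ring P] [Algebra ℂ P] [Ring H] [HopfAlgebra ℂ H] {δ : ComoduleAlgebra P H}
  {V : Type*} [AddCommGroup V] [Module ℂ V] {ρ : P → V →ₗ[ℂ] V} (h : IsRightAction ρ)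
  {M : Type*} [AddCommGroup M] [Module ℂ M] {ρM : δ.coinv → M →ₗ[ℂ] M}
  {f : M →ₗ[ℂ] V} (hf : ∀ b m, f (ρM b m) = ρ b (f m))
  {Λ : Type*} [AddCommGroup Λ] [Module ℂ Λ] {σΛ ρΛ : δ.coinv → Λ →ₗ[ℂ] Λ}
  {g : Λ →ₗ[ℂ] P ⊗[ℂ] P} (hgσ : ∀ b X, g (σΛ b X) = (LinearMap.mulLeft ℂ (b : P)).rTensor P (g X))

include h hf hgσ in
/-- The map `M ⊗_B Λ → V ⊗ P`, `m ⊗ (p ⊗ q) ↦ f(m) p ⊗ q`, for a `B`-bimodule `Λ` over `P ⊗ P`. -/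
noncomputable def fuseMap : BalTensor ρM σΛ →ₗ[ℂ] V ⊗[ℂ] P :=
  BalTensor.lift ((LinearMap.rTensorHom P ∘ₗ h.orbitₗ ∘ₗ f).compl₂ g) fun b m X => by
    simp only [LinearMap.compl₂_apply, LinearMap.comp_apply, hf, hgσ, LinearMap.coe_rTensorHom,
      IsRightAction.orbitₗ_apply]
    induction g X with
    | zero => simp
    | add x y hx hy => rw [map_add, map_add, map_add, hx, hy]
    | tmul p q => simp [h.mul]

@[simp]
theorem fuseMap_mk (m : M) (X : Λ) :
    fuseMap h hf hgσ (BalTensor.mk ρM σΛ m X) = (h.orbit (f m)).rTensor P (g X) := rfl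

variable (hgρ : ∀ b X, g (ρΛ b X) = (LinearMap.mulRight ℂ (b : P)).lTensor P (g X))
  (hc : ∀ b c X, σΛ b (ρΛ c X) = ρΛ c (σΛ b X))

include hgρ in
theorem fuseMap_act (b : δ.coinv) (z : BalTensor ρM σΛ) :
    fuseMap h hf hgσ (BalTensor.mapRight ρM (ρΛ b) (hc · b) z) =
      (LinearMap.mulRight ℂ (b : P)).lTensor V (fuseMap h hf hgσ z) := by
  induction z using BalTensor.mk_surj_induction with
  | hadd x y hx hy => simp only [map_add, hx, hy]
  | hmk m X =>
    rw [BalTensor.mapRight_mk, fuseMap_mk, fuseMap_mk, hgρ, rTensor_lTensor_comm]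

/-- If `M ⊗_B P ≅ V` and `Λ ⊗_B P ≅ P ⊗ P`, then `M ⊗_B Λ ⊗_B P ≅ V ⊗ P`. -/
theorem extend_fuseMap_bijective (hfb : Function.Bijective (δ.extend h f hf))
    (hgb : Function.Bijective (δ.extend ((IsRightAction.mulRight P).lTensor P) g hgρ)) :
    Function.Bijective (δ.extend ((IsRightAction.mulRight P).lTensor V) (fuseMap h hf hgσ)
      (fuseMap_act h hf hgσ hgρ hc)) := by
  let κ := δ.extend ((IsRightAction.mulRight P).lTensor V) (fuseMap h hf hgσ)
    (fuseMap_act h hf hgσ hgρ hc)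
  let eV := LinearEquiv.ofBijective _ hfb
  let eΛ := LinearEquiv.ofBijective _ hgb
  have heΛ : ∀ z, δ.extend ((IsRightAction.mulRight P).lTensor P) g hgρ (eΛ.symm z) = z :=
    eΛ.apply_symm_apply
  -- `J m` is `z ↦ m ⊗ z`, with the triple tensor product rebracketed as `(M ⊗_B Λ) ⊗_B P`.
  let J : M →ₗ[ℂ] δ.TensP ρΛ →ₗ[ℂ] δ.TensP (fun c => BalTensor.mapRight ρM (ρΛ c) (hc · c)) :=
    LinearMap.mk₂ ℂ (fun m z => BalTensor.mapLeft _ (BalTensor.mk ρM σΛ m) (fun _ _ => rfl) z)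
      (fun m m' z => BalTensor.mapLeft_eq_add (fun X => by simp) z)
      (fun c m z => BalTensor.mapLeft_eq_smul c (fun X => by simp) z)
      (fun _ _ _ => map_add _ _ _) (fun _ _ _ => map_smul _ _ _)
  have hJmk : ∀ m X p, J m (BalTensor.mk _ _ X p) =
      BalTensor.mk _ _ (BalTensor.mk ρM σΛ m X) p := fun _ _ _ => rfl
  have hbal : ∀ (b : δ.coinv) m (z : δ.TensP ρΛ), J (ρM b m) z =
      J m (BalTensor.mapLeft _ (σΛ b) (hc b) z) := fun b m z => by
    induction z using BalTensor.mk_surj_induction with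
    | hadd x y hx hy => simp only [map_add, hx, hy]
    | hmk X p => rw [hJmk, BalTensor.mk_bal, BalTensor.mapLeft_mk, hJmk]
  -- The inverse of `Λ ⊗_B P ≅ P ⊗ P` is left `B`-linear, because the isomorphism is.
  have hsymm : ∀ (b : δ.coinv) w, BalTensor.mapLeft _ (σΛ b) (hc b) (eΛ.symm w) =
      eΛ.symm ((LinearMap.mulLeft ℂ (b : P)).rTensor P w) := fun b w => by
    obtain ⟨z, rfl⟩ := eΛ.surjective w
    rw [LinearEquiv.symm_apply_apply, LinearEquiv.eq_symm_apply]
    change δ.extend _ g hgρ _ = LinearMap.rTensor P _ (δ.extend _ g hgρ z)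
    induction z using BalTensor.mk_surj_induction with
    | hadd x y hx hy => simp only [map_add, hx, hy]
    | hmk X p =>
      rw [BalTensor.mapLeft_mk, extend_mk, extend_mk, hgσ, rTensor_lTensor_comm]
  -- The candidate inverse of `κ`, precomposed with `M ⊗_B P ≅ V`: `(m ⊗ p) ⊗ q` goes to `m`
  -- tensored with the preimage of `p ⊗ q` in `Λ ⊗_B P`. Balancing over `B` follows from `hbal` and
  -- `hsymm`.
  let Φ : δ.TensP ρM →ₗ[ℂ] P →ₗ[ℂ] δ.TensP (fun c => BalTensor.mapRight ρM (ρΛ c) (hc · c)) :=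
    BalTensor.lift (LinearMap.mk₂ ℂ
        (fun m p => TensorProduct.curry (J m ∘ₗ eΛ.symm.toLinearMap) p)
        (fun m m' p => by ext; simp) (fun c m p => by ext; simp)
        (fun m p p' => by ext; simp) (fun c m p => by ext; simp)) fun b m p => by
      ext q
      change J (ρM b m) (eΛ.symm (p ⊗ₜ q)) = J m (eΛ.symm ((b * p) ⊗ₜ q))
      rw [hbal, hsymm]
      rfl
  have hΦmk : ∀ m p q, Φ (BalTensor.mk _ _ m p) q = J m (eΛ.symm (p ⊗ₜ q)) := fun _ _ _ => rfl
  have hκJ : ∀ m z, κ (J m z) = (h.orbit (f m)).rTensor P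
      (δ.extend ((IsRightAction.mulRight P).lTensor P) g hgρ z) := fun m z => by
    induction z using BalTensor.mk_surj_induction with
    | hadd x y hx hy => simp only [map_add, hx, hy]
    | hmk X p =>
      rw [hJmk]
      simp only [κ]
      rw [extend_mk, extend_mk, fuseMap_mk, rTensor_lTensor_comm]
  -- Elements `f(m) p` are enough to compute the inverse of `κ`, since they span `V`.
  have hinv : ∀ m w, TensorProduct.lift (Φ ∘ₗ eV.symm.toLinearMap)
      ((h.orbit (f m)).rTensor P w) = J m (eΛ.symm w) := fun m w => by
    induction w with
    | zero => simp
    | add x y hx hy => simp only [map_add, hx, hy]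
    | tmul p q =>
      have : eV.symm (ρ p (f m)) = BalTensor.mk _ _ m p := by
        rw [LinearEquiv.symm_apply_eq]; rfl
      change Φ (eV.symm (ρ p (f m))) q = _
      rw [this, hΦmk]
  refine ⟨Function.LeftInverse.injective
    (g := TensorProduct.lift (Φ ∘ₗ eV.symm.toLinearMap)) fun z => ?_, fun w => ?_⟩
  · change TensorProduct.lift (Φ ∘ₗ eV.symm.toLinearMap) (κ z) = z
    induction z using BalTensor.mk_surj_induction with
    | hadd x y hx hy => simp only [map_add, hx, hy]
    | hmk y r =>
      induction y using BalTensor.mk_surj_induction with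
      | hadd x y hx hy => simp only [map_add, hx, hy, LinearMap.add_apply]
      | hmk m X =>
        rw [← hJmk, hκJ, hinv]
        congr 1
        exact eΛ.symm_apply_apply _
  · change ∃ z, κ z = w
    induction w with
    | zero => exact ⟨0, map_zero _⟩
    | add x y hx hy =>
      obtain ⟨z, rfl⟩ := hx
      obtain ⟨w, rfl⟩ := hy
      exact ⟨z + w, map_add _ _ _⟩
    | tmul v q =>
      refine ⟨Φ (eV.symm v) q, ?_⟩
      obtain ⟨z, rfl⟩ := eV.surjective v
      rw [LinearEquiv.symm_apply_apply]
      induction z using BalTensor.mk_surj_induction with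
      | hadd x y hx hy => simp only [map_add, hx, hy, LinearMap.add_apply, TensorProduct.add_tmul]
      | hmk m p =>
        rw [hΦmk, hκJ, heΛ]
        rfl

end Iterate

/-! ### The structure theorem for relative Hopf modules and faithfully flat descent -/

section Descent

set_option maxSynthPendingDepth 3

open BalTensor

variable {P : Type u} {H : Type v} [Ring P] [Algebra ℂ P] [Ring H] [HopfAlgebra ℂ H]
  {δ : ComoduleAlgebra P H}
  {V : Type u} [AddCommGroup V] [Module ℂ V] {ρ : P → V →ₗ[ℂ] V} {h : IsRightAction ρ}
  {M : Type u} [AddCommGroup M] [Module ℂ M] {ρM : δ.coinv → M →ₗ[ℂ] M}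
  {N : Type u} [AddCommGroup N] [Module ℂ N] {ρN : δ.coinv → N →ₗ[ℂ] N}

/-- The structure theorem for relative Hopf modules: if `N` is the `B`-module of coinvariants of
the Hopf module `V`, then `N ⊗_B P → V` is bijective. -/
theorem extend_bijective_of_coinvariants (hgal : δ.IsGalois)
    (hflat : IsFaithfullyFlatLeft.{max u v} δ.coinv P) {ν : V →ₗ[ℂ] V ⊗[ℂ] H}
    (hν : ∀ p v, ν (ρ p v) = δ.diagAct h p (ν v))
    (hcounit : ∀ v, TensorProduct.rid ℂ V
      ((Coalgebra.counit (R := ℂ) (A := H)).lTensor V (ν v)) = v)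
    (hcoassoc : ∀ v, TensorProduct.assoc ℂ V H H (ν.rTensor H (ν v)) =
      (Coalgebra.comul (R := ℂ) (A := H)).lTensor V (ν v))
    (hN : IsRightAction ρN) {f : N →ₗ[ℂ] V} (hf : ∀ b m, f (ρN b m) = ρ b (f m))
    (hinj : Function.Injective f) (hrange : ∀ v, ν v = v ⊗ₜ 1 ↔ v ∈ Set.range f) :
    Function.Bijective (δ.extend h f hf) := by
  have hσ : ∀ (b : δ.coinv) (q : P), LinearMap.mulLeft ℂ (b : P) q = b • q := fun _ _ => rfl
  have hV := δ.isRightAction_coinv h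
  have hV' := δ.diagAct_isRightAction h
  have hνinj : Function.Injective ν := fun v w hvw => by rw [← hcounit v, hvw, hcounit w]
  -- The coinvariants are the equalizer of `ν` and `ι`. The rest of the proof compares this
  -- equalizer after `- ⊗_B P` with the one that describes the image of `ν` inside `V ⊗ H`.
  let ι : V →ₗ[ℂ] V ⊗[ℂ] H := (TensorProduct.mk ℂ V H).flip 1
  have hι : ∀ (b : δ.coinv) v, ι (ρ b v) = δ.diagAct h b (ι v) := fun b v => by
    change ρ b v ⊗ₜ 1 = h.tensorAct (IsRightAction.mulRight H) (δ.coact b) (v ⊗ₜ 1)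
    rw [δ.coact_coinv]
    simp
  -- The third universe argument puts the auxiliary zero module in universe `v`, so that the
  -- flatness hypothesis is needed in `max u v`.
  have hfinj := (IsFaithfullyFlatLeft.injective_iff.{u, u, v, u, u} hflat hσ hN hV hf).1 hinj
  have hcomp : ∀ z, δ.canMod h (mapLeft (ρ' := fun b : δ.coinv => ρ b) _ f hf z) =
      ν (δ.extend h f hf z) := by
    intro z
    induction z using BalTensor.mk_surj_induction with
    | hadd x y hx hy => simp only [map_add, hx, hy]
    | hmk n p =>
      rw [mapLeft_mk, canMod_mk, extend_mk, hν, (hrange (f n)).2 ⟨n, rfl⟩, diagAct, tensorAct_one]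
  -- After the canonical isomorphisms for `V` and for `V ⊗ H`, the map `ν ⊗_B id` is `ν ⊗ id_H`.
  have hν' : ∀ z, δ.canMod hV' (mapLeft (ρ := fun b : δ.coinv => ρ b)
      (ρ' := fun b : δ.coinv => δ.diagAct h b) _ ν (fun b v => hν b v) z) =
      ν.rTensor H (δ.canMod h z) := by
    intro z
    induction z using BalTensor.mk_surj_induction with
    | hadd x y hx hy => simp only [map_add, hx, hy]
    | hmk v p =>
      rw [mapLeft_mk, canMod_mk, canMod_mk]
      induction δ.coact p with
      | zero => simp
      | add x y hx hy => simp only [map_add, hx, hy]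
      | tmul q k => simp [hν]
  -- Under the same isomorphisms `ι ⊗_B id` is `id ⊗ Δ`, since `(v ⊗ 1) · p₍₀₎ ⊗ p₍₁₎ = v p₍₀₎ ⊗
  -- p₍₁₎ ⊗ p₍₂₎`.
  have hι' : ∀ z, δ.canMod hV' (mapLeft (ρ := fun b : δ.coinv => ρ b)
      (ρ' := fun b : δ.coinv => δ.diagAct h b) _ ι hι z) =
      (TensorProduct.assoc ℂ V H H).symm
        ((Coalgebra.comul (R := ℂ) (A := H)).lTensor V (δ.canMod h z)) := by
    intro z
    induction z using BalTensor.mk_surj_induction with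
    | hadd x y hx hy => simp only [map_add, hx, hy]
    | hmk v p =>
      rw [mapLeft_mk, canMod_mk, canMod_mk]
      have h1 : (Coalgebra.comul (R := ℂ) (A := H)).lTensor V
          ((h.orbit v).rTensor H (δ.coact p)) =
          (h.orbit v).rTensor (H ⊗[ℂ] H)
            ((Coalgebra.comul (R := ℂ) (A := H)).lTensor P (δ.coact p)) := by
        rw [← LinearMap.comp_apply, ← LinearMap.comp_apply, LinearMap.lTensor_comp_rTensor,
          LinearMap.rTensor_comp_lTensor]
      rw [h1, ← δ.coassoc]
      induction δ.coact p with
      | zero => simp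
      | add x y hx hy => simp only [map_add, hx, hy]
      | tmul q k =>
        rw [LinearMap.rTensor_tmul, LinearMap.rTensor_tmul]
        change h.tensorAct (IsRightAction.mulRight H) (δ.coact q) (v ⊗ₜ 1) ⊗ₜ k = _
        rw [tensorAct_one]
        change _ = (TensorProduct.assoc ℂ V H H).symm ((h.orbit v).rTensor (H ⊗[ℂ] H)
          (TensorProduct.assoc ℂ P H H (δ.coact q ⊗ₜ k)))
        induction δ.coact q with
        | zero => simp
        | add x y hx hy => simp only [map_add, hx, hy, TensorProduct.add_tmul]
        | tmul r l => simp
  have hex : Function.Exact f (ν - ι) := fun v => by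
    rw [LinearMap.sub_apply, sub_eq_zero]
    exact hrange v
  have hsub : ∀ (b : δ.coinv) v, (ν - ι) (ρ b v) = δ.diagAct h b ((ν - ι) v) := fun b v => by
    rw [LinearMap.sub_apply, LinearMap.sub_apply, map_sub, hν, hι]
  have hexP := (IsFaithfullyFlatLeft.exact_iff hflat hσ hN hV (δ.isRightAction_coinv hV') hf
    (g := ν - ι) hsub).1 hex
  constructor
  · intro x y hxy
    refine hfinj ((hgal.canMod_bijective (h := h)).1 ?_)
    rw [hcomp, hcomp, hxy]
  · intro v
    obtain ⟨z, hz⟩ := (hgal.canMod_bijective (h := h)).2 (ν v)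
    -- The element `z` corresponds to `ν(v)`, on which `ν ⊗ id` and `id ⊗ Δ` agree by
    -- coassociativity. So `z` lies in the kernel of `(ν - ι) ⊗_B id`, which by flatness is the
    -- image of `N ⊗_B P`.
    have : mapLeft (ρ' := fun b : δ.coinv => δ.diagAct h b)
        (fun b : δ.coinv => LinearMap.mulLeft ℂ (b : P)) (ν - ι) hsub z = 0 := by
      have hs := mapLeft_eq_add (ρ := fun b : δ.coinv => ρ b)
        (ρ' := fun b : δ.coinv => δ.diagAct h b)
        (σ := fun b : δ.coinv => LinearMap.mulLeft ℂ (b : P))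
        (hf := fun b v => hν b v) (hf₁ := hsub) (hf₂ := hι)
        (fun v => (sub_add_cancel (ν v) (ι v)).symm) z
      refine add_eq_right.1 (hs.symm.trans ?_)
      refine (hgal.canMod_bijective (h := hV')).1 ?_
      rw [hν', hι', hz, ← hcoassoc, LinearEquiv.symm_apply_apply]
    obtain ⟨w, rfl⟩ := (hexP z).1 this
    -- The counit makes `ν` injective, so equality may be tested after `ν`, where `hcomp` applies.
    exact ⟨w, hνinj (by rw [← hcomp, hz])⟩

/-- The extension of `f` factors as `f ⊗_B id` followed by the action map `V ⊗_B P → V`. Hence `f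
⊗_B id` is injective, and faithful flatness reflects this. -/
theorem injective_of_extend_injective (hflat : IsFaithfullyFlatLeft.{max u v} δ.coinv P)
    (hM : IsRightAction ρM) {f : M →ₗ[ℂ] V} (hf : ∀ b m, f (ρM b m) = ρ b (f m))
    (hinj : Function.Injective (δ.extend h f hf)) : Function.Injective f := by
  have hV := δ.isRightAction_coinv h
  refine (IsFaithfullyFlatLeft.injective_iff.{u, u, v, u, u}
    (σ := fun b : δ.coinv => LinearMap.mulLeft ℂ (b : P)) hflat (fun _ _ => rfl) hM hV hf).2
    (Function.Injective.of_comp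
    (f := δ.extend (ρM := fun b : δ.coinv => ρ b) h LinearMap.id fun _ _ => rfl) ?_)
  convert hinj
  ext z
  induction z using BalTensor.mk_surj_induction with
  | hadd x y hx hy =>
    rw [Function.comp_apply] at hx hy ⊢
    simp only [map_add, hx, hy]
  | hmk m p => rfl

/-- The extension of `f` is the extension of `g` composed with `e ⊗_B id`. As the former is
surjective and the extension of `g` is injective, `e ⊗_B id` is surjective, and this descends to
`e`. -/
theorem surjective_of_extend_bijective (hflat : IsFaithfullyFlatLeft.{max u v} δ.coinv P)
    (hM : IsRightAction ρM) (hN : IsRightAction ρN)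
    {f : M →ₗ[ℂ] V} (hf : ∀ b m, f (ρM b m) = ρ b (f m))
    {g : N →ₗ[ℂ] V} (hg : ∀ b m, g (ρN b m) = ρ b (g m))
    (hfs : Function.Surjective (δ.extend h f hf)) (hgi : Function.Injective (δ.extend h g hg))
    {e : M →ₗ[ℂ] N} (he : ∀ b m, e (ρM b m) = ρN b (e m)) (hge : ∀ m, g (e m) = f m) :
    Function.Surjective e := by
  refine IsFaithfullyFlatLeft.surjective_of_mapLeft.{u, u, v, u, u}
    (σ := fun b : δ.coinv => LinearMap.mulLeft ℂ (b : P)) hflat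
    (fun _ _ => rfl) hM hN he fun w => ?_
  obtain ⟨z, hz⟩ := hfs (δ.extend h g hg w)
  refine ⟨z, hgi ?_⟩
  rw [← hz]
  clear hz
  induction z using BalTensor.mk_surj_induction with
  | hadd x y hx hy => simp only [map_add, hx, hy]
  | hmk m p => rw [mapLeft_mk, extend_mk, extend_mk, hge]

end Descent

end ComoduleAlgebra

/-! ### Diagonal coactions on tensor powers of `P` -/

namespace ComoduleAlgebra

section Diagonal

set_option maxSynthPendingDepth 3

/-- The map `(w ⊗ a) ⊗ (p ⊗ c) ↦ (w ⊗ p) ⊗ a c`. -/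
noncomputable def mulPair (W P A : Type*) [AddCommGroup W] [Module ℂ W] [AddCommGroup P]
    [Module ℂ P] [Ring A] [Algebra ℂ A] : (W ⊗[ℂ] A) ⊗[ℂ] (P ⊗[ℂ] A) →ₗ[ℂ] (W ⊗[ℂ] P) ⊗[ℂ] A :=
  (LinearMap.mul' ℂ A).lTensor (W ⊗[ℂ] P) ∘ₗ
    (TensorProduct.tensorTensorTensorComm ℂ W A P A).toLinearMap

@[simp]
theorem mulPair_tmul {W P A : Type*} [AddCommGroup W] [Module ℂ W] [AddCommGroup P] [Module ℂ P]
    [Ring A] [Algebra ℂ A] (w : W) (p : P) (a c : A) :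
    mulPair W P A ((w ⊗ₜ a) ⊗ₜ (p ⊗ₜ c)) = (w ⊗ₜ p) ⊗ₜ (a * c) := by
  simp [mulPair]

theorem lTensor_mulPair {W P A C : Type*} [AddCommGroup W] [Module ℂ W] [AddCommGroup P]
    [Module ℂ P] [Ring A] [Algebra ℂ A] [Ring C] [Algebra ℂ C] (φ : A →ₐ[ℂ] C)
    (x : W ⊗[ℂ] A) (y : P ⊗[ℂ] A) :
    φ.toLinearMap.lTensor (W ⊗[ℂ] P) (mulPair W P A (x ⊗ₜ y)) =
      mulPair W P C (φ.toLinearMap.lTensor W x ⊗ₜ φ.toLinearMap.lTensor P y) := by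
  induction x with
  | zero => simp
  | add x x' hx hx' => simp only [TensorProduct.add_tmul, map_add, hx, hx']
  | tmul w a =>
  induction y with
  | zero => simp
  | add y y' hy hy' => simp only [TensorProduct.tmul_add, map_add, hy, hy']
  | tmul p c => simp

variable {P H : Type*} [Ring P] [Algebra ℂ P] [Ring H] [HopfAlgebra ℂ H] (δ : ComoduleAlgebra P H)
  {W W' : Type*} [AddCommGroup W] [Module ℂ W] [AddCommGroup W'] [Module ℂ W']

/-- The diagonal coaction `w ⊗ p ↦ w₍₀₎ ⊗ p₍₀₎ ⊗ w₍₁₎ p₍₁₎` on `W ⊗ P`. -/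
noncomputable def codiag (ν : W →ₗ[ℂ] W ⊗[ℂ] H) : W ⊗[ℂ] P →ₗ[ℂ] (W ⊗[ℂ] P) ⊗[ℂ] H :=
  mulPair W P H ∘ₗ TensorProduct.map ν δ.coact.toLinearMap

@[simp]
theorem codiag_tmul (ν : W →ₗ[ℂ] W ⊗[ℂ] H) (w : W) (p : P) :
    δ.codiag ν (w ⊗ₜ p) = mulPair W P H (ν w ⊗ₜ δ.coact p) := rfl

/-- The Hopf module condition for `W ⊗ P`, from multiplicativity of `δ`. Acting on the last factor
keeps the `H`-legs in order, so commutativity of `H` plays no role. -/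
theorem codiag_act (ν : W →ₗ[ℂ] W ⊗[ℂ] H) (p : P) (z : W ⊗[ℂ] P) :
    δ.codiag ν ((LinearMap.mulRight ℂ p).lTensor W z) =
      δ.diagAct ((IsRightAction.mulRight P).lTensor W) p (δ.codiag ν z) := by
  induction z with
  | zero => simp
  | add x y hx hy => simp only [map_add, hx, hy]
  | tmul w q =>
    rw [LinearMap.lTensor_tmul, codiag_tmul, codiag_tmul, LinearMap.mulRight_apply, map_mul,
      diagAct]
    induction ν w with
    | zero => simp
    | add x x' hx hx' => simp only [TensorProduct.add_tmul, map_add, hx, hx']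
    | tmul w a =>
    induction δ.coact q with
    | zero => simp
    | add y y' hy hy' => simp only [TensorProduct.tmul_add, add_mul, map_add, hy, hy']
    | tmul q c =>
    induction δ.coact p with
    | zero => simp
    | add y y' hy hy' =>
      simp only [TensorProduct.tmul_add, mul_add, map_add, hy, hy', LinearMap.add_apply]
    | tmul p d => simp [mul_assoc]

/-- Multiplicativity of the counit of `H` lets it act on the two factors separately. -/
theorem codiag_counit {ν : W →ₗ[ℂ] W ⊗[ℂ] H}
    (hν : ∀ v, TensorProduct.rid ℂ W
      ((Coalgebra.counit (R := ℂ) (A := H)).lTensor W (ν v)) = v) (z : W ⊗[ℂ] P) :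
    TensorProduct.rid ℂ (W ⊗[ℂ] P)
      ((Coalgebra.counit (R := ℂ) (A := H)).lTensor (W ⊗[ℂ] P) (δ.codiag ν z)) = z := by
  induction z with
  | zero => simp
  | add x y hx hy => simp only [map_add, hx, hy]
  | tmul w p =>
    have h := lTensor_mulPair (Bialgebra.counitAlgHom ℂ H) (ν w) (δ.coact p)
    have h' : ∀ (x : W ⊗[ℂ] ℂ) (y : P ⊗[ℂ] ℂ), TensorProduct.rid ℂ (W ⊗[ℂ] P)
        (mulPair W P ℂ (x ⊗ₜ y)) = TensorProduct.rid ℂ W x ⊗ₜ TensorProduct.rid ℂ P y := by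
      intro x y
      induction x with
      | zero => simp
      | add x x' hx hx' => simp only [TensorProduct.add_tmul, map_add, hx, hx']
      | tmul w a =>
      induction y with
      | zero => simp
      | add y y' hy hy' => simp only [TensorProduct.tmul_add, map_add, hy, hy']
      | tmul p c => simp [mul_comm, TensorProduct.smul_tmul', TensorProduct.tmul_smul, smul_smul]
    rw [codiag_tmul]
    refine (congrArg _ h).trans ((h' _ _).trans ?_)
    exact congrArg₂ _ (hν w) (δ.counit p)

/-- Multiplicativity of the coproduct of `H` reduces this to coassociativity on `W` and on `P`. -/
theorem codiag_coassoc {ν : W →ₗ[ℂ] W ⊗[ℂ] H}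
    (hν : ∀ v, TensorProduct.assoc ℂ W H H (ν.rTensor H (ν v)) =
      (Coalgebra.comul (R := ℂ) (A := H)).lTensor W (ν v)) (z : W ⊗[ℂ] P) :
    TensorProduct.assoc ℂ (W ⊗[ℂ] P) H H ((δ.codiag ν).rTensor H (δ.codiag ν z)) =
      (Coalgebra.comul (R := ℂ) (A := H)).lTensor (W ⊗[ℂ] P) (δ.codiag ν z) := by
  induction z with
  | zero => simp
  | add x y hx hy => simp only [map_add, hx, hy]
  | tmul w p =>
    have h := lTensor_mulPair (Bialgebra.comulAlgHom ℂ H) (ν w) (δ.coact p)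
    have h' : ∀ (x : W ⊗[ℂ] H) (y : P ⊗[ℂ] H),
        TensorProduct.assoc ℂ (W ⊗[ℂ] P) H H ((δ.codiag ν).rTensor H (mulPair W P H (x ⊗ₜ y))) =
          mulPair W P (H ⊗[ℂ] H) (TensorProduct.assoc ℂ W H H (ν.rTensor H x) ⊗ₜ
            TensorProduct.assoc ℂ P H H (δ.coact.toLinearMap.rTensor H y)) := by
      intro x y
      induction x with
      | zero => simp
      | add x x' hx hx' => simp only [TensorProduct.add_tmul, map_add, hx, hx']
      | tmul w a =>
      induction y with
      | zero => simp
      | add y y' hy hy' => simp only [TensorProduct.tmul_add, map_add, hy, hy']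
      | tmul p c =>
      rw [mulPair_tmul, LinearMap.rTensor_tmul, LinearMap.rTensor_tmul, LinearMap.rTensor_tmul,
        codiag_tmul, AlgHom.toLinearMap_apply]
      induction ν w with
      | zero => simp
      | add x x' hx hx' => simp only [TensorProduct.add_tmul, map_add, hx, hx']
      | tmul w d =>
      induction δ.coact p with
      | zero => simp
      | add y y' hy hy' =>
        simp only [TensorProduct.tmul_add, TensorProduct.add_tmul, map_add, hy, hy']
      | tmul p e => simp
    rw [codiag_tmul, h', hν]
    refine Eq.trans ?_ h.symm
    congr 2
    exact δ.coassoc p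

/-- The diagonal coaction is natural for maps of comodules. -/
theorem codiag_rTensor {ν : W →ₗ[ℂ] W ⊗[ℂ] H} {ν' : W' →ₗ[ℂ] W' ⊗[ℂ] H} {k : W →ₗ[ℂ] W'}
    (hk : ∀ w, ν' (k w) = k.rTensor H (ν w)) (z : W ⊗[ℂ] P) :
    δ.codiag ν' (k.rTensor P z) = (k.rTensor P).rTensor H (δ.codiag ν z) := by
  induction z with
  | zero => simp
  | add x y hx hy => simp only [map_add, hx, hy]
  | tmul w p =>
    rw [LinearMap.rTensor_tmul, codiag_tmul, codiag_tmul, hk]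
    induction ν w with
    | zero => simp
    | add x x' hx hx' => simp only [TensorProduct.add_tmul, map_add, hx, hx']
    | tmul w d =>
    induction δ.coact p with
    | zero => simp
    | add y y' hy hy' => simp only [TensorProduct.tmul_add, map_add, hy, hy']
    | tmul p e => simp

/-- The diagonal coaction on `P ⊗ P`. -/
noncomputable abbrev codiag₂ : P ⊗[ℂ] P →ₗ[ℂ] (P ⊗[ℂ] P) ⊗[ℂ] H := δ.codiag δ.coact.toLinearMap

/-- The diagonal coaction on `P ⊗ P ⊗ P`. -/
noncomputable abbrev codiag₃ : (P ⊗[ℂ] P) ⊗[ℂ] P →ₗ[ℂ] ((P ⊗[ℂ] P) ⊗[ℂ] P) ⊗[ℂ] H :=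
  δ.codiag δ.codiag₂

/-- The action of `P` on the last factor of `W ⊗ P`. -/
theorem lastAct (P W : Type*) [Ring P] [Algebra ℂ P] [AddCommGroup W] [Module ℂ W] :
    IsRightAction fun p : P => (LinearMap.mulRight ℂ p).lTensor W :=
  (IsRightAction.mulRight P).lTensor W

/-- Multiplication is a comodule map `P ⊗ P → P`, so `p ⊗ q ↦ p q` sends coinvariants to `B`. This
makes the counit well defined. -/
theorem rTensor_codiag₂_mul (z : P ⊗[ℂ] P) :
    δ.coact (LinearMap.mul' ℂ P z) = (LinearMap.mul' ℂ P).rTensor H (δ.codiag₂ z) := by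
  induction z with
  | zero => simp
  | add x y hx hy => simp only [map_add, hx, hy]
  | tmul p q =>
    rw [LinearMap.mul'_apply, map_mul, codiag_tmul, AlgHom.toLinearMap_apply]
    induction δ.coact p with
    | zero => simp
    | add x x' hx hx' => simp only [TensorProduct.add_tmul, add_mul, map_add, hx, hx']
    | tmul w d =>
    induction δ.coact q with
    | zero => simp
    | add y y' hy hy' => simp only [TensorProduct.tmul_add, mul_add, map_add, hy, hy']
    | tmul p e => simp

/-- The product `(p ⊗ q)(r ⊗ u) = p r ⊗ u q` on `P ⊗ P`. -/
noncomputable def legMul (P : Type*) [Ring P] [Algebra ℂ P] :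
    P ⊗[ℂ] P →ₗ[ℂ] P ⊗[ℂ] P →ₗ[ℂ] P ⊗[ℂ] P :=
  TensorProduct.homTensorHomMap (RingHom.id ℂ) P P P P ∘ₗ
    TensorProduct.map (LinearMap.mul ℂ P) (LinearMap.mul ℂ P).flip

@[simp]
theorem legMul_tmul (p q r u : P) : legMul P (p ⊗ₜ q) (r ⊗ₜ u) = (p * r) ⊗ₜ (u * q) := rfl

/-- The map `w ⊗ q ↦ w ⊗ 1 ⊗ q`. -/
noncomputable def insertOne (W P : Type*) [AddCommGroup W] [Module ℂ W] [Ring P] [Algebra ℂ P] :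
    W ⊗[ℂ] P →ₗ[ℂ] (W ⊗[ℂ] P) ⊗[ℂ] P :=
  ((TensorProduct.mk ℂ W P).flip 1).rTensor P

@[simp]
theorem insertOne_tmul (w : W) (q : P) : insertOne W P (w ⊗ₜ q) = (w ⊗ₜ 1) ⊗ₜ q := rfl

theorem codiag₂_tmul_one (p : P) : δ.codiag₂ (p ⊗ₜ 1) =
    ((TensorProduct.mk ℂ P P).flip 1).rTensor H (δ.coact p) := by
  rw [codiag_tmul, map_one, AlgHom.toLinearMap_apply, Algebra.TensorProduct.one_def]
  induction δ.coact p with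
  | zero => simp
  | add x x' hx hx' => simp only [TensorProduct.add_tmul, map_add, hx, hx']
  | tmul w d => simp

end Diagonal

/-! ### The coinvariant ring and its maps into tensor powers of `P` -/

section CoinvariantRing

set_option maxSynthPendingDepth 3

variable {P H : Type*} [Ring P] [Algebra ℂ P] [Ring H] [HopfAlgebra ℂ H] {δ : ComoduleAlgebra P H}

variable (δ) in
/-- A presentation of the ring `L` with source and target maps as `(P ⊗ P)^{co H}`. -/
structure CoinvariantRing {L : Type*} [Ring L] [Algebra ℂ L] (E : EnvRing δ.coinv L) where
  leg : L →ₗ[ℂ] P ⊗[ℂ] P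
  leg_injective : Function.Injective leg
  range_leg : ∀ x, δ.codiag₂ x = x ⊗ₜ 1 ↔ x ∈ Set.range leg
  leg_mul : ∀ X Y, leg (X * Y) = legMul P (leg X) (leg Y)
  leg_one : leg 1 = 1 ⊗ₜ 1
  leg_s : ∀ b, leg (E.s b) = (b : P) ⊗ₜ 1
  leg_t : ∀ b, leg (E.t b) = 1 ⊗ₜ (b : P)

namespace CoinvariantRing

variable {L : Type*} [Ring L] [Algebra ℂ L] {E : EnvRing δ.coinv L} (D : δ.CoinvariantRing E)

theorem codiag₂_leg (X : L) : δ.codiag₂ (D.leg X) = D.leg X ⊗ₜ 1 :=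
  (D.range_leg _).2 ⟨X, rfl⟩

theorem leg_s_mul (b : δ.coinv) (X : L) :
    D.leg (E.s b * X) = (LinearMap.mulLeft ℂ (b : P)).rTensor P (D.leg X) := by
  rw [D.leg_mul, D.leg_s]
  induction D.leg X with
  | zero => simp
  | add x y hx hy => simp only [map_add, hx, hy]
  | tmul r u => simp

theorem leg_t_mul (b : δ.coinv) (X : L) :
    D.leg (E.t b * X) = (LinearMap.mulRight ℂ (b : P)).lTensor P (D.leg X) := by
  rw [D.leg_mul, D.leg_t]
  induction D.leg X with
  | zero => simp
  | add x y hx hy => simp only [map_add, hx, hy]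
  | tmul r u => simp

/-- When `X` is coinvariant, `p ↦ X p` is a comodule map `P → P ⊗ P`, by the Hopf module condition.
-/
theorem orbit_leg (X : L) (p : P) : δ.codiag₂ ((lastAct P P).orbit (D.leg X) p) =
    ((lastAct P P).orbit (D.leg X)).rTensor H (δ.coact p) := by
  rw [IsRightAction.orbit_apply, codiag_act, D.codiag₂_leg, diagAct, tensorAct_one]

theorem actT (E : EnvRing δ.coinv L) :
    IsRightAction fun b : δ.coinv => LinearMap.mulLeft ℂ (E.t b) :=
  ⟨fun X => by simp [EnvRing.t], fun a b X => by simp [EnvRing.t],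
    fun a b X => by simp [EnvRing.t, add_mul], fun c b X => by simp [EnvRing.t]⟩

theorem comm_s_t (E : EnvRing δ.coinv L) (b c : δ.coinv) (X : L) :
    LinearMap.mulLeft ℂ (E.s b) (LinearMap.mulLeft ℂ (E.t c) X) =
      LinearMap.mulLeft ℂ (E.t c) (LinearMap.mulLeft ℂ (E.s b) X) := by
  have h : E.s b * E.t c = E.t c * E.s b := E.comm b c
  simp only [LinearMap.mulLeft_apply, ← mul_assoc, h]

/-- The map `L ⊗_B L → P ⊗ P ⊗ P`, `(p ⊗ q) ⊗ (r ⊗ u) ↦ p ⊗ q r ⊗ u`. -/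
noncomputable def fuse : E.LTens →ₗ[ℂ] (P ⊗[ℂ] P) ⊗[ℂ] P :=
  fuseMap (δ := δ) (lastAct P P) (f := D.leg) D.leg_t_mul (g := D.leg) D.leg_s_mul

theorem fuse_lactR (b : δ.coinv) (Z : E.LTens) :
    D.fuse (E.lactR b Z) = (LinearMap.mulRight ℂ (b : P)).lTensor (P ⊗[ℂ] P) (D.fuse Z) :=
  fuseMap_act (δ := δ) (lastAct P P) D.leg_t_mul D.leg_s_mul D.leg_t_mul (comm_s_t E) b Z

/-- The map `L ⊗_B L ⊗_B L → P ⊗ P ⊗ P ⊗ P`,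
`(p ⊗ q) ⊗ (r ⊗ u) ⊗ (x ⊗ y) ↦ p ⊗ q r ⊗ u x ⊗ y`. -/
noncomputable def fuse₃ : E.LTens₃ →ₗ[ℂ] ((P ⊗[ℂ] P) ⊗[ℂ] P) ⊗[ℂ] P :=
  fuseMap (δ := δ) (lastAct P (P ⊗[ℂ] P)) (f := D.fuse) D.fuse_lactR (g := D.leg) D.leg_s_mul

/-- On `X ⊗ Y`, fusing is the comodule map `p ↦ X p` tensored with the identity and applied to the
coinvariant element `Y`. -/
theorem codiag₃_fuse (Z : E.LTens) : δ.codiag₃ (D.fuse Z) = D.fuse Z ⊗ₜ 1 := by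
  induction Z using BalTensor.mk_surj_induction with
  | hadd x y hx hy => simp only [map_add, hx, hy, TensorProduct.add_tmul]
  | hmk X Y =>
    change δ.codiag₃ (((lastAct P P).orbit (D.leg X)).rTensor P (D.leg Y)) =
      (((lastAct P P).orbit (D.leg X)).rTensor P (D.leg Y)) ⊗ₜ 1
    rw [δ.codiag_rTensor (ν := δ.coact.toLinearMap) (D.orbit_leg X), D.codiag₂_leg]
    rfl

theorem codiag₃_insertOne (X : L) : δ.codiag₃ (insertOne P P (D.leg X)) =
    insertOne P P (D.leg X) ⊗ₜ 1 := by
  rw [insertOne, δ.codiag_rTensor (ν := δ.coact.toLinearMap) δ.codiag₂_tmul_one, D.codiag₂_leg]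
  rfl

theorem lactR_isRightAction (E : EnvRing δ.coinv L) : IsRightAction fun b => E.lactR b :=
  (actT E).balTensor (comm_s_t E)

end CoinvariantRing

end CoinvariantRing

/-! ### Descent for `L ⊗_B L` and `L ⊗_B L ⊗_B L` -/

namespace CoinvariantRing

section Fuse

set_option maxSynthPendingDepth 3

variable {P : Type u} {H : Type v} [Ring P] [Algebra ℂ P] [Ring H] [HopfAlgebra ℂ H]
  {δ : ComoduleAlgebra P H} {L : Type u} [Ring L] [Algebra ℂ L] {E : EnvRing δ.coinv L}
  (D : δ.CoinvariantRing E) (hgal : δ.IsGalois) (hflat : IsFaithfullyFlatLeft.{max u v} δ.coinv P)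

include hgal hflat

/-- The structure theorem for the Hopf module `P ⊗ P`, with coinvariants `L`: `L ⊗_B P ≅ P ⊗ P`. -/
theorem extend_leg_bijective :
    Function.Bijective (δ.extend (ρM := fun b => LinearMap.mulLeft ℂ (E.t b)) (lastAct P P) D.leg
      D.leg_t_mul) :=
  extend_bijective_of_coinvariants hgal hflat (δ.codiag_act _)
    (δ.codiag_counit δ.counit) (δ.codiag_coassoc δ.coassoc) (actT E) _ D.leg_injective
    D.range_leg

theorem extend_fuse_bijective :
    Function.Bijective (δ.extend (lastAct P (P ⊗[ℂ] P)) D.fuse D.fuse_lactR) :=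
  extend_fuseMap_bijective (lastAct P P) D.leg_t_mul D.leg_s_mul D.leg_t_mul (comm_s_t E)
    (D.extend_leg_bijective hgal hflat) (D.extend_leg_bijective hgal hflat)

theorem fuse_injective : Function.Injective D.fuse :=
  injective_of_extend_injective hflat (lactR_isRightAction E) D.fuse_lactR
    (D.extend_fuse_bijective hgal hflat).1

/-- One more iteration of the isomorphism `L ⊗_B P ≅ P ⊗ P`. It allows coassociativity to be checked
in `P ⊗ P ⊗ P ⊗ P`. -/
theorem fuse₃_injective : Function.Injective D.fuse₃ :=
  injective_of_extend_injective hflat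
    (ρM := fun b => BalTensor.mapRight _ (LinearMap.mulLeft ℂ (E.t b)) ((comm_s_t E) · b))
    ((actT E).balTensor (comm_s_t E))
    (h := lastAct P ((P ⊗[ℂ] P) ⊗[ℂ] P)) _
    (extend_fuseMap_bijective (lastAct P (P ⊗[ℂ] P)) D.fuse_lactR D.leg_s_mul D.leg_t_mul
      (comm_s_t E) (D.extend_fuse_bijective hgal hflat) (D.extend_leg_bijective hgal hflat)).1

/-- Both `L ⊗_B L` and the space `N` of coinvariants of `P ⊗ P ⊗ P` become `P ⊗ P ⊗ P` after `- ⊗_B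
P`, compatibly with `fuse`. So `L ⊗_B L → N` becomes surjective, hence is surjective. -/
theorem mem_range_fuse {z : (P ⊗[ℂ] P) ⊗[ℂ] P} (hz : δ.codiag₃ z = z ⊗ₜ 1) :
    z ∈ Set.range D.fuse := by
  let N : Submodule ℂ ((P ⊗[ℂ] P) ⊗[ℂ] P) :=
    LinearMap.eqLocus δ.codiag₃ ((TensorProduct.mk ℂ _ H).flip 1)
  have hN : ∀ (b : δ.coinv), ∀ x ∈ N, (LinearMap.mulRight ℂ (b : P)).lTensor (P ⊗[ℂ] P) x ∈ N := by
    intro b x hx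
    rw [LinearMap.mem_eqLocus] at hx ⊢
    rw [codiag_act, hx]
    change δ.diagAct _ _ (x ⊗ₜ 1) = _
    rw [diagAct, tensorAct_one, coact_coinv]
    rfl
  have hact := δ.isRightAction_coinv (lastAct P (P ⊗[ℂ] P))
  have hNact : IsRightAction fun b : δ.coinv =>
      ((LinearMap.mulRight ℂ (b : P)).lTensor (P ⊗[ℂ] P)).restrict (hN b) :=
    ⟨fun x => Subtype.ext (hact.one x), fun a b x => Subtype.ext (hact.mul a b x),
      fun a b x => Subtype.ext (hact.add a b x), fun c b x => Subtype.ext (hact.smul c b x)⟩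
  have hNbij := extend_bijective_of_coinvariants hgal hflat (h := lastAct P (P ⊗[ℂ] P))
    (ν := δ.codiag₃) (δ.codiag_act _)
    (δ.codiag_counit (δ.codiag_counit δ.counit)) (δ.codiag_coassoc (δ.codiag_coassoc δ.coassoc))
    hNact (f := N.subtype) (fun b m => rfl) N.injective_subtype
    (fun v => by rw [Submodule.coe_subtype, Subtype.range_val]; rfl)
  obtain ⟨w, hw⟩ := surjective_of_extend_bijective hflat (lactR_isRightAction E) hNact
    D.fuse_lactR (g := N.subtype) (fun b m => rfl) (D.extend_fuse_bijective hgal hflat).2 hNbij.1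
    (e := D.fuse.codRestrict N D.codiag₃_fuse) (fun b m => Subtype.ext (D.fuse_lactR b m))
    (fun m => rfl) ⟨z, hz⟩
  exact ⟨w, congrArg Subtype.val hw⟩

end Fuse

end CoinvariantRing

end ComoduleAlgebra

/-! ### Leg identities in tensor powers of `P` -/

namespace ComoduleAlgebra

section Multiplication

set_option maxSynthPendingDepth 3

/-- The map `(w ⊗ q) ⊗ (r ⊗ u) ↦ w ⊗ q r ⊗ u`. -/
noncomputable def fuseTensor (W P : Type*) [AddCommGroup W] [Module ℂ W] [Ring P] [Algebra ℂ P] :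
    W ⊗[ℂ] P →ₗ[ℂ] P ⊗[ℂ] P →ₗ[ℂ] (W ⊗[ℂ] P) ⊗[ℂ] P :=
  LinearMap.rTensorHom P ∘ₗ (lastAct P W).orbitₗ

@[simp]
theorem fuseTensor_tmul {W P : Type*} [AddCommGroup W] [Module ℂ W] [Ring P] [Algebra ℂ P]
    (w : W) (q r u : P) :
    fuseTensor W P (w ⊗ₜ q) (r ⊗ₜ u) = (w ⊗ₜ (q * r)) ⊗ₜ u := rfl

variable (P : Type*) [Ring P] [Algebra ℂ P]

/-- The map sending `(r ⊗ u) ⊗ (r' ⊗ u')` to `x ⊗ y ⊗ z ↦ x r ⊗ u y r' ⊗ u' z`. -/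
noncomputable def twoSided : (P ⊗[ℂ] P) ⊗[ℂ] (P ⊗[ℂ] P) →ₗ[ℂ]
    Module.End ℂ ((P ⊗[ℂ] P) ⊗[ℂ] P) :=
  LinearMap.mul' ℂ (Module.End ℂ ((P ⊗[ℂ] P) ⊗[ℂ] P)) ∘ₗ
    TensorProduct.map
      ((LinearMap.mul ℂ ((P ⊗[ℂ] P) ⊗[ℂ] P)).flip ∘ₗ (TensorProduct.mk ℂ (P ⊗[ℂ] P) P).flip 1)
      (LinearMap.mul ℂ ((P ⊗[ℂ] P) ⊗[ℂ] P) ∘ₗ (TensorProduct.mk ℂ P P 1).rTensor P) ∘ₗ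
    (TensorProduct.tensorTensorTensorComm ℂ P P P P).toLinearMap

@[simp]
theorem twoSided_tmul (r u r' u' x y z : P) :
    twoSided P ((r ⊗ₜ u) ⊗ₜ (r' ⊗ₜ u')) ((x ⊗ₜ y) ⊗ₜ z) =
      ((x * r) ⊗ₜ (u * y * r')) ⊗ₜ (u' * z) := by
  simp [twoSided]

/-- The map sending `p ⊗ q` to `x ⊗ y ⊗ z ↦ p x ⊗ y ⊗ z q`. -/
noncomputable def outer : P ⊗[ℂ] P →ₗ[ℂ] Module.End ℂ ((P ⊗[ℂ] P) ⊗[ℂ] P) :=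
  TensorProduct.homTensorHomMap (RingHom.id ℂ) (P ⊗[ℂ] P) P (P ⊗[ℂ] P) P ∘ₗ
    TensorProduct.map (LinearMap.rTensorHom P ∘ₗ LinearMap.mul ℂ P) (LinearMap.mul ℂ P).flip

@[simp]
theorem outer_tmul (p q x y z : P) :
    outer P (p ⊗ₜ q) ((x ⊗ₜ y) ⊗ₜ z) = ((p * x) ⊗ₜ y) ⊗ₜ (z * q) := by
  simp [outer]

variable {P}

/-- Under fusing, right multiplication by `U ⊗ V` on `L ⊗_B L` is `twoSided`. -/
theorem fuseTensor_legMul (x y v w : P ⊗[ℂ] P) :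
    fuseTensor P P (legMul P x v) (legMul P y w) = twoSided P (v ⊗ₜ w) (fuseTensor P P x y) := by
  induction x with
  | zero => simp
  | add a b ha hb => simp only [map_add, LinearMap.add_apply, ha, hb]
  | tmul p q =>
  induction y with
  | zero => simp
  | add a b ha hb => simp only [map_add, LinearMap.add_apply, ha, hb]
  | tmul r u =>
  induction v with
  | zero => simp
  | add a b ha hb => simp only [map_add, LinearMap.add_apply, TensorProduct.add_tmul, ha, hb]
  | tmul p' q' =>
  induction w with
  | zero => simp
  | add a b ha hb => simp only [map_add, LinearMap.add_apply, TensorProduct.tmul_add, ha, hb]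
  | tmul r' u' => simp [mul_assoc]

/-- The middle unit is what makes left multiplication by `Δ(X)` depend only on the fused value of
the other factor: it multiplies the outer legs alone. -/
theorem twoSided_insertOne (x v w : P ⊗[ℂ] P) :
    twoSided P (v ⊗ₜ w) (insertOne P P x) = outer P x (fuseTensor P P v w) := by
  induction x with
  | zero => simp
  | add a b ha hb => simp only [map_add, LinearMap.add_apply, ha, hb]
  | tmul p q =>
  induction v with
  | zero => simp
  | add a b ha hb => simp only [map_add, LinearMap.add_apply, TensorProduct.add_tmul, ha, hb]
  | tmul p' q' =>
  induction w with
  | zero => simp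
  | add a b ha hb => simp only [map_add, LinearMap.add_apply, TensorProduct.tmul_add, ha, hb]
  | tmul r' u' => simp

theorem outer_insertOne (x y : P ⊗[ℂ] P) :
    outer P x (insertOne P P y) = insertOne P P (legMul P x y) := by
  induction x with
  | zero => simp
  | add a b ha hb => simp only [map_add, LinearMap.add_apply, ha, hb]
  | tmul p q =>
  induction y with
  | zero => simp
  | add a b ha hb => simp only [map_add, ha, hb]
  | tmul r u => simp

/-- The Takeuchi condition for `p ⊗ 1 ⊗ q`: the middle leg is `b` whether the unit is multiplied by
`b` from the left or from the right. -/
theorem twoSided_insertOne_comm (b : P) (x : P ⊗[ℂ] P) :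
    twoSided P ((1 ⊗ₜ b) ⊗ₜ (1 ⊗ₜ 1)) (insertOne P P x) =
      twoSided P ((1 ⊗ₜ 1) ⊗ₜ (b ⊗ₜ 1)) (insertOne P P x) := by
  induction x with
  | zero => simp
  | add a b ha hb => simp only [map_add, ha, hb]
  | tmul p q => simp

theorem fuseTensor_mulLeft (b : P) (x y : P ⊗[ℂ] P) :
    fuseTensor P P ((LinearMap.mulLeft ℂ b).rTensor P x) y =
      ((LinearMap.mulLeft ℂ b).rTensor P).rTensor P (fuseTensor P P x y) := by
  induction x with
  | zero => simp
  | add a b ha hb => simp only [map_add, LinearMap.add_apply, ha, hb]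
  | tmul p q =>
  induction y with
  | zero => simp
  | add a b ha hb => simp only [map_add, ha, hb]
  | tmul r u => simp

theorem rTensor_mulLeft_insertOne (b : P) (x : P ⊗[ℂ] P) :
    ((LinearMap.mulLeft ℂ b).rTensor P).rTensor P (insertOne P P x) =
      insertOne P P ((LinearMap.mulLeft ℂ b).rTensor P x) := by
  induction x with
  | zero => simp
  | add a b ha hb => simp only [map_add, ha, hb]
  | tmul p q => simp

theorem lTensor_mulRight_insertOne {W : Type*} [AddCommGroup W] [Module ℂ W] (b : P)
    (x : W ⊗[ℂ] P) :
    (LinearMap.mulRight ℂ b).lTensor (W ⊗[ℂ] P) (insertOne W P x) =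
      insertOne W P ((LinearMap.mulRight ℂ b).lTensor W x) := by
  induction x with
  | zero => simp
  | add a b ha hb => simp only [map_add, ha, hb]
  | tmul p q => simp

theorem mul'_rTensor_mulLeft (b : P) (x : P ⊗[ℂ] P) :
    LinearMap.mul' ℂ P ((LinearMap.mulLeft ℂ b).rTensor P x) = b * LinearMap.mul' ℂ P x := by
  induction x with
  | zero => simp
  | add a b ha hb => simp only [map_add, mul_add, ha, hb]
  | tmul p q => simp [mul_assoc]

theorem mul'_lTensor_mulRight (b : P) (x : P ⊗[ℂ] P) :
    LinearMap.mul' ℂ P ((LinearMap.mulRight ℂ b).lTensor P x) = LinearMap.mul' ℂ P x * b := by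
  induction x with
  | zero => simp
  | add a b ha hb => simp only [map_add, add_mul, ha, hb]
  | tmul p q => simp [mul_assoc]

theorem mul'_rTensor_fuseTensor (x y : P ⊗[ℂ] P) :
    (LinearMap.mul' ℂ P).rTensor P (fuseTensor P P x y) =
      (LinearMap.mulLeft ℂ (LinearMap.mul' ℂ P x)).rTensor P y := by
  induction y with
  | zero => simp
  | add a b ha hb => simp only [map_add, ha, hb]
  | tmul r u =>
  induction x with
  | zero => simp
  | add a b ha hb =>
    simp only [map_add, LinearMap.add_apply, ha, hb, LinearMap.rTensor_tmul,
      LinearMap.mulLeft_apply, add_mul, TensorProduct.add_tmul]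
  | tmul p q => simp

theorem mul'_rTensor_insertOne (x : P ⊗[ℂ] P) :
    (LinearMap.mul' ℂ P).rTensor P (insertOne P P x) = x := by
  induction x with
  | zero => simp
  | add a b ha hb => simp only [map_add, ha, hb]
  | tmul p q => simp

theorem mul'_lTensor_fuseTensor (x y : P ⊗[ℂ] P) :
    (LinearMap.mul' ℂ P).lTensor P (TensorProduct.assoc ℂ P P P (fuseTensor P P x y)) =
      (LinearMap.mulRight ℂ (LinearMap.mul' ℂ P y)).lTensor P x := by
  induction x with
  | zero => simp
  | add a b ha hb => simp only [map_add, LinearMap.add_apply, ha, hb]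
  | tmul p q =>
  induction y with
  | zero => simp
  | add a b ha hb =>
    simp only [map_add, ha, hb, LinearMap.lTensor_tmul, LinearMap.mulRight_apply, mul_add,
      TensorProduct.tmul_add]
  | tmul r u => simp [mul_assoc]

theorem mul'_lTensor_insertOne (x : P ⊗[ℂ] P) :
    (LinearMap.mul' ℂ P).lTensor P (TensorProduct.assoc ℂ P P P (insertOne P P x)) = x := by
  induction x with
  | zero => simp
  | add a b ha hb => simp only [map_add, ha, hb]
  | tmul p q => simp

theorem fuseTensor_insertOne {W : Type*} [AddCommGroup W] [Module ℂ W] (x : W ⊗[ℂ] P)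
    (y : P ⊗[ℂ] P) :
    fuseTensor (W ⊗[ℂ] P) P (insertOne W P x) y =
      (insertOne W P).rTensor P (fuseTensor W P x y) := by
  induction x with
  | zero => simp
  | add a b ha hb => simp only [map_add, LinearMap.add_apply, ha, hb]
  | tmul w q =>
  induction y with
  | zero => simp
  | add a b ha hb => simp only [map_add, ha, hb]
  | tmul r u => simp

theorem fuseTensor_fuseTensor (x y z : P ⊗[ℂ] P) :
    fuseTensor (P ⊗[ℂ] P) P (fuseTensor P P x y) z =
      ((fuseTensor P P x).rTensor P) (fuseTensor P P y z) := by
  induction z with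
  | zero => simp
  | add a b ha hb => simp only [map_add, ha, hb]
  | tmul r' u' =>
  induction y with
  | zero => simp
  | add a b ha hb => simp only [map_add, LinearMap.add_apply, ha, hb]
  | tmul r u =>
  induction x with
  | zero => simp
  | add a b ha hb => simp_all
  | tmul p q => simp

theorem fuseTensor_rTensor_insertOne (x y : P ⊗[ℂ] P) :
    (fuseTensor P P x).rTensor P (insertOne P P y) =
      insertOne (P ⊗[ℂ] P) P (fuseTensor P P x y) := by
  induction y with
  | zero => simp
  | add a b ha hb => simp only [map_add, ha, hb]
  | tmul r u =>
  induction x with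
  | zero => simp
  | add a b ha hb => simp_all
  | tmul p q => simp

theorem rTensor_insertOne_insertOne (x : P ⊗[ℂ] P) :
    (insertOne P P).rTensor P (insertOne P P x) = insertOne (P ⊗[ℂ] P) P (insertOne P P x) := by
  induction x with
  | zero => simp
  | add a b ha hb => simp only [map_add, ha, hb]
  | tmul p q => simp

/-- Since `(p r)(u q) = p (r u) q`, the second argument enters only through its product; this gives
both counit axioms for products. -/
theorem mul'_legMul (x y : P ⊗[ℂ] P) : LinearMap.mul' ℂ P (legMul P x y) =
    LinearMap.mul' ℂ P ((LinearMap.mulRight ℂ (LinearMap.mul' ℂ P y)).rTensor P x) := by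
  induction x with
  | zero => simp
  | add a b ha hb => simp only [map_add, LinearMap.add_apply, ha, hb]
  | tmul p q =>
  induction y with
  | zero => simp
  | add a b ha hb =>
    simp only [map_add, ha, hb, LinearMap.rTensor_tmul, LinearMap.mulRight_apply, mul_add,
      TensorProduct.add_tmul]
  | tmul r u => simp [mul_assoc]

theorem mul'_legMul_tmul_one (x : P ⊗[ℂ] P) (b : P) :
    LinearMap.mul' ℂ P (legMul P x (b ⊗ₜ 1)) =
    LinearMap.mul' ℂ P ((LinearMap.mulRight ℂ b).rTensor P x) := by
  simpa using mul'_legMul x (b ⊗ₜ 1)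

theorem mul'_legMul_one_tmul (x : P ⊗[ℂ] P) (b : P) :
    LinearMap.mul' ℂ P (legMul P x (1 ⊗ₜ b)) =
    LinearMap.mul' ℂ P ((LinearMap.mulRight ℂ b).rTensor P x) := by
  simpa using mul'_legMul x (1 ⊗ₜ b)

/-- Under fusing, the map `X ⊗ Y ↦ S(X)₁ Y ⊗ S(X)₂` is the rotation `x ⊗ y ⊗ z ↦ y ⊗ z ⊗ x`. -/
theorem twoSided_comm_left (x y : P ⊗[ℂ] P) :
    twoSided P (y ⊗ₜ (1 ⊗ₜ 1)) (insertOne P P (TensorProduct.comm ℂ P P x)) =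
      TensorProduct.comm ℂ P (P ⊗[ℂ] P) (TensorProduct.assoc ℂ P P P (fuseTensor P P x y)) := by
  induction x with
  | zero => simp
  | add a b ha hb => simp only [map_add, LinearMap.add_apply, ha, hb]
  | tmul p q =>
  induction y with
  | zero => simp
  | add a b ha hb => simp only [map_add, TensorProduct.add_tmul, LinearMap.add_apply, ha, hb]
  | tmul r u => simp

/-- Under fusing, the map `X ⊗ Y ↦ S⁻¹(Y)₁ ⊗ S⁻¹(Y)₂ X` is the opposite rotation `x ⊗ y ⊗ z ↦ z ⊗ x
⊗ y`. -/
theorem twoSided_comm_right (x y : P ⊗[ℂ] P) :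
    twoSided P ((1 ⊗ₜ 1) ⊗ₜ x) (insertOne P P (TensorProduct.comm ℂ P P y)) =
      (TensorProduct.assoc ℂ P P P).symm
        (TensorProduct.comm ℂ (P ⊗[ℂ] P) P (fuseTensor P P x y)) := by
  induction x with
  | zero => simp
  | add a b ha hb => simp only [map_add, TensorProduct.tmul_add, LinearMap.add_apply, ha, hb]
  | tmul p q =>
  induction y with
  | zero => simp
  | add a b ha hb => simp only [map_add, ha, hb]
  | tmul r u => simp

theorem comm_assoc_insertOne (x : P ⊗[ℂ] P) :
    TensorProduct.comm ℂ P (P ⊗[ℂ] P) (TensorProduct.assoc ℂ P P P (insertOne P P x)) =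
      fuseTensor P P (1 ⊗ₜ 1) (TensorProduct.comm ℂ P P x) := by
  induction x with
  | zero => simp
  | add a b ha hb => simp only [map_add, ha, hb]
  | tmul p q => simp

theorem assoc_comm_insertOne (x : P ⊗[ℂ] P) :
    (TensorProduct.assoc ℂ P P P).symm (TensorProduct.comm ℂ (P ⊗[ℂ] P) P (insertOne P P x)) =
      fuseTensor P P (TensorProduct.comm ℂ P P x) (1 ⊗ₜ 1) := by
  induction x with
  | zero => simp
  | add a b ha hb => simp only [map_add, LinearMap.add_apply, ha, hb]
  | tmul p q => simp

end Multiplication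

/-! ### The left bialgebroid and the antipode identities -/

namespace CoinvariantRing

set_option maxSynthPendingDepth 3

variable {P : Type u} {H : Type v} [Ring P] [Algebra ℂ P] [Ring H] [HopfAlgebra ℂ H]
  {δ : ComoduleAlgebra P H} {L : Type u} [Ring L] [Algebra ℂ L] {E : EnvRing δ.coinv L}
  (D : δ.CoinvariantRing E)

theorem fuse_lmk (X Y : L) : D.fuse (E.lmk X Y) = fuseTensor P P (D.leg X) (D.leg Y) := rfl

theorem fuse_lactL (b : δ.coinv) (Z : E.LTens) : D.fuse (E.lactL b Z) =
    ((LinearMap.mulLeft ℂ (b : P)).rTensor P).rTensor P (D.fuse Z) := by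
  induction Z using BalTensor.mk_surj_induction with
  | hadd x y hx hy => simp only [map_add, hx, hy]
  | hmk X Y =>
    change fuseTensor P P (D.leg (E.s b * X)) (D.leg Y) =
      LinearMap.rTensor P _ (fuseTensor P P (D.leg X) (D.leg Y))
    rw [leg_s_mul, fuseTensor_mulLeft]

theorem fuse_lmulR (U V : L) (Z : E.LTens) :
    D.fuse (E.lmulR U V Z) = twoSided P (D.leg U ⊗ₜ D.leg V) (D.fuse Z) := by
  induction Z using BalTensor.mk_surj_induction with
  | hadd x y hx hy => simp only [map_add, hx, hy]
  | hmk X Y =>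
    change fuseTensor P P (D.leg (X * U)) (D.leg (Y * V)) =
      twoSided P _ (fuseTensor P P (D.leg X) (D.leg Y))
    rw [D.leg_mul, D.leg_mul, fuseTensor_legMul]

/-- The counit `p ⊗ q ↦ p q`. -/
noncomputable def counit : L →ₗ[ℂ] δ.coinv where
  toFun X := ⟨LinearMap.mul' ℂ P (D.leg X), by
    change δ.coact _ = _ ⊗ₜ 1
    rw [rTensor_codiag₂_mul, codiag₂_leg]
    rfl⟩
  map_add' X Y := Subtype.ext (by simp)
  map_smul' c X := Subtype.ext (by simp)

theorem coe_counit (X : L) : (D.counit X : P) = LinearMap.mul' ℂ P (D.leg X) := rfl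

variable (hgal : δ.IsGalois) (hflat : IsFaithfullyFlatLeft.{max u v} δ.coinv P)

/-- The coproduct, characterized by `fuse_comul`. -/
noncomputable def comul : L →ₗ[ℂ] E.LTens :=
  (LinearEquiv.ofInjective D.fuse (D.fuse_injective hgal hflat)).symm.toLinearMap ∘ₗ
    (insertOne P P ∘ₗ D.leg).codRestrict (LinearMap.range D.fuse) fun X =>
      D.mem_range_fuse hgal hflat (D.codiag₃_insertOne X)

@[simp]
theorem fuse_comul (X : L) : D.fuse (D.comul hgal hflat X) = insertOne P P (D.leg X) := by
  have h : LinearEquiv.ofInjective D.fuse (D.fuse_injective hgal hflat) (D.comul hgal hflat X) =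
      (insertOne P P ∘ₗ D.leg).codRestrict (LinearMap.range D.fuse) (fun X =>
        D.mem_range_fuse hgal hflat (D.codiag₃_insertOne X)) X :=
    LinearEquiv.apply_symm_apply _ _
  exact congrArg Subtype.val h

/-- The coproduct and the counit of `L`. -/
noncomputable def coring : LeftCoringData E where
  comul := D.comul hgal hflat
  counit := D.counit
  comul_s b X := D.fuse_injective hgal hflat <| by
    rw [fuse_comul, fuse_lactL, fuse_comul, leg_s_mul, rTensor_mulLeft_insertOne]
  comul_t b X := D.fuse_injective hgal hflat <| by
    rw [fuse_comul, fuse_lactR, fuse_comul, leg_t_mul, lTensor_mulRight_insertOne]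
  counit_s b X := Subtype.ext <| by
    rw [coe_counit, leg_s_mul, mul'_rTensor_mulLeft]
    rfl
  counit_t b X := Subtype.ext <| by
    rw [coe_counit, leg_t_mul, mul'_lTensor_mulRight]
    rfl

theorem fuse_coring_comul (X : L) :
    D.fuse ((D.coring hgal hflat).comul X) = insertOne P P (D.leg X) := D.fuse_comul hgal hflat X

theorem fuse₃_linsert (X : L) (Z : E.LTens) :
    D.fuse₃ (E.linsert X Z) = (fuseTensor P P (D.leg X)).rTensor P (D.fuse Z) := by
  induction Z using BalTensor.mk_surj_induction with
  | hadd x y hx hy => simp only [map_add, hx, hy]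
  | hmk U V => exact fuseTensor_fuseTensor _ _ _

/-- Here `Δ ⊗ id` inserts a unit after the first leg, while in `fuse₃_idComul` `id ⊗ Δ` inserts one
before the last; on `p ⊗ 1 ⊗ q` the results agree. -/
theorem fuse₃_comulId (Z : E.LTens) :
    D.fuse₃ ((D.coring hgal hflat).comulId Z) = (insertOne P P).rTensor P (D.fuse Z) := by
  induction Z using BalTensor.mk_surj_induction with
  | hadd x y hx hy => simp only [map_add, hx, hy]
  | hmk X Y =>
    change fuseTensor (P ⊗[ℂ] P) P (D.fuse ((D.coring hgal hflat).comul X)) (D.leg Y) =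
      LinearMap.rTensor P _ (fuseTensor P P (D.leg X) (D.leg Y))
    rw [fuse_coring_comul, fuseTensor_insertOne]

theorem fuse₃_idComul (Z : E.LTens) :
    D.fuse₃ ((D.coring hgal hflat).idComul Z) = insertOne (P ⊗[ℂ] P) P (D.fuse Z) := by
  induction Z using BalTensor.mk_surj_induction with
  | hadd x y hx hy => simp only [map_add, hx, hy]
  | hmk X Y =>
    change D.fuse₃ (E.linsert X ((D.coring hgal hflat).comul Y)) =
      insertOne (P ⊗[ℂ] P) P (fuseTensor P P (D.leg X) (D.leg Y))
    rw [fuse₃_linsert, fuse_coring_comul, fuseTensor_rTensor_insertOne]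

/-- Applying `ε` to the first factor multiplies the first two legs, and `leg_idCounit` multiplies
the last two; either way `p ⊗ 1 ⊗ q` becomes `p ⊗ q`. -/
theorem leg_counitId (Z : E.LTens) : D.leg ((D.coring hgal hflat).counitId Z) =
    (LinearMap.mul' ℂ P).rTensor P (D.fuse Z) := by
  induction Z using BalTensor.mk_surj_induction with
  | hadd x y hx hy => simp only [map_add, hx, hy]
  | hmk X Y =>
    change D.leg (E.s (D.counit X) * Y) =
      LinearMap.rTensor P _ (fuseTensor P P (D.leg X) (D.leg Y))
    rw [leg_s_mul, mul'_rTensor_fuseTensor, coe_counit]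

theorem leg_idCounit (Z : E.LTens) : D.leg ((D.coring hgal hflat).idCounit Z) =
    (LinearMap.mul' ℂ P).lTensor P (TensorProduct.assoc ℂ P P P (D.fuse Z)) := by
  induction Z using BalTensor.mk_surj_induction with
  | hadd x y hx hy => simp only [map_add, hx, hy]
  | hmk X Y =>
    change D.leg (E.t (D.counit Y) * X) = LinearMap.lTensor P _
      (TensorProduct.assoc ℂ P P P (fuseTensor P P (D.leg X) (D.leg Y)))
    rw [leg_t_mul, mul'_lTensor_fuseTensor, coe_counit]

/-- The left bialgebroid structure on `L`. -/
noncomputable def leftBialgebroid : LeftBialgebroid E where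
  toLeftCoringData := D.coring hgal hflat
  coassoc X := D.fuse₃_injective hgal hflat <| by
    rw [fuse₃_comulId, fuse₃_idComul, fuse_coring_comul, rTensor_insertOne_insertOne]
  counit_comul X := D.leg_injective <| by
    rw [leg_counitId, fuse_coring_comul, mul'_rTensor_insertOne]
  comul_counit X := D.leg_injective <| by
    rw [leg_idCounit, fuse_coring_comul, mul'_lTensor_insertOne]
  comul_mem X b := D.fuse_injective hgal hflat <| by
    rw [fuse_lmulR, fuse_lmulR, fuse_coring_comul, D.leg_t, D.leg_s, D.leg_one,
      twoSided_insertOne_comm]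
  comul_one := D.fuse_injective hgal hflat <| by
    rw [fuse_coring_comul, fuse_lmk, D.leg_one]
    simp
  comul_mul X Y := D.fuse_injective hgal hflat <| by
    -- The product of `Δ(X)` with `Z` multiplies the outer legs of the fused `Z` by those of `X`.
    have h : ∀ (hX : (D.coring hgal hflat).comul X ∈ E.ltakeuchi) (Z : E.LTens),
        D.fuse (E.ltMul ⟨_, hX⟩ Z) = outer P (D.leg X) (D.fuse Z) := by
      intro hX Z
      induction Z using BalTensor.mk_surj_induction with
      | hadd x y hx hy => simp only [map_add, hx, hy]
      | hmk U V =>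
        change D.fuse (E.lmulR U V ((D.coring hgal hflat).comul X)) = outer P (D.leg X)
          (fuseTensor P P (D.leg U) (D.leg V))
        rw [fuse_lmulR, fuse_coring_comul, twoSided_insertOne]
    refine (D.fuse_coring_comul hgal hflat (X * Y)).trans (Eq.trans ?_ (h _ _).symm)
    rw [fuse_coring_comul, outer_insertOne, D.leg_mul]
  counit_one := Subtype.ext <| by
    change LinearMap.mul' ℂ P (D.leg 1) = 1
    rw [D.leg_one]
    simp
  counit_mul_s X Y := Subtype.ext <| by
    change LinearMap.mul' ℂ P (D.leg (X * Y)) =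
      LinearMap.mul' ℂ P (D.leg (X * E.s (D.counit Y)))
    rw [D.leg_mul, D.leg_mul, mul'_legMul, D.leg_s, mul'_legMul_tmul_one, coe_counit]
  counit_mul_t X Y := Subtype.ext <| by
    change LinearMap.mul' ℂ P (D.leg (X * Y)) =
      LinearMap.mul' ℂ P (D.leg (X * E.t (D.counit Y)))
    rw [D.leg_mul, D.leg_mul, mul'_legMul, D.leg_t, mul'_legMul_one_tmul, coe_counit]

variable (S : L ≃ₐ[ℂ] Lᵐᵒᵖ) (hS : ∀ X, D.leg (unop (S X)) = TensorProduct.comm ℂ P P (D.leg X))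

/-- The bialgebroid `L` with an antipode that flips the two legs. -/
noncomputable def antipodeData : AntipodeData E where
  left := D.leftBialgebroid hgal hflat
  antipode := S
  antipode_t b := D.leg_injective <| by
    rw [hS, D.leg_t, D.leg_s, TensorProduct.comm_tmul]

theorem leg_S (X : L) : D.leg ((D.antipodeData hgal hflat S hS).S X) =
    TensorProduct.comm ℂ P P (D.leg X) := hS X

theorem leg_Sinv (X : L) : D.leg ((D.antipodeData hgal hflat S hS).Sinv X) =
    TensorProduct.comm ℂ P P (D.leg X) := by
  conv_rhs => rw [← (D.antipodeData hgal hflat S hS).S_Sinv X, leg_S]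
  rw [← LinearEquiv.trans_apply]
  simp

/-- The rotation takes `p ⊗ 1 ⊗ q` to `q ⊗ p ⊗ 1`, which is the fused form of `S⁻¹(X) ⊗ 1`. -/
theorem mapSinv_comul (X : L) :
    (D.antipodeData hgal hflat S hS).mapSinv ((D.leftBialgebroid hgal hflat).comul X) =
      E.lmk ((D.antipodeData hgal hflat S hS).Sinv X) 1 := by
  have h : ∀ Z, D.fuse ((D.antipodeData hgal hflat S hS).mapSinv Z) =
      (TensorProduct.assoc ℂ P P P).symm
        (TensorProduct.comm ℂ (P ⊗[ℂ] P) P (D.fuse Z)) := by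
    intro Z
    induction Z using BalTensor.mk_surj_induction with
    | hadd x y hx hy => simp only [map_add, hx, hy]
    | hmk X Y =>
      change D.fuse (E.lmulR 1 X ((D.coring hgal hflat).comul
          ((D.antipodeData hgal hflat S hS).Sinv Y))) = (TensorProduct.assoc ℂ P P P).symm
        (TensorProduct.comm ℂ (P ⊗[ℂ] P) P (fuseTensor P P (D.leg X) (D.leg Y)))
      rw [fuse_lmulR, fuse_coring_comul, leg_Sinv, D.leg_one, twoSided_comm_right]
  refine D.fuse_injective hgal hflat ?_
  rw [h, fuse_lmk, leg_Sinv, D.leg_one, ← assoc_comm_insertOne]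
  exact congrArg _ (congrArg _ (D.fuse_coring_comul hgal hflat X))

/-- The rotation takes `p ⊗ 1 ⊗ q` to `1 ⊗ q ⊗ p`, which is the fused form of `1 ⊗ S(X)`. -/
theorem mapS_comul (X : L) :
    (D.antipodeData hgal hflat S hS).mapS ((D.leftBialgebroid hgal hflat).comul X) =
      E.lmk 1 ((D.antipodeData hgal hflat S hS).S X) := by
  have h : ∀ Z, D.fuse ((D.antipodeData hgal hflat S hS).mapS Z) =
      TensorProduct.comm ℂ P (P ⊗[ℂ] P) (TensorProduct.assoc ℂ P P P (D.fuse Z)) := by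
    intro Z
    induction Z using BalTensor.mk_surj_induction with
    | hadd x y hx hy => simp only [map_add, hx, hy]
    | hmk X Y =>
      change D.fuse (E.lmulR Y 1 ((D.coring hgal hflat).comul
          ((D.antipodeData hgal hflat S hS).S X))) = TensorProduct.comm ℂ P (P ⊗[ℂ] P)
        (TensorProduct.assoc ℂ P P P (fuseTensor P P (D.leg X) (D.leg Y)))
      rw [fuse_lmulR, fuse_coring_comul, leg_S, D.leg_one, twoSided_comm_left]
  refine D.fuse_injective hgal hflat ?_
  rw [h, fuse_lmk, leg_S, D.leg_one, ← comm_assoc_insertOne]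
  exact congrArg _ (congrArg _ (D.fuse_coring_comul hgal hflat X))

end CoinvariantRing

end ComoduleAlgebra

/-! ## The right bialgebroid induced by an antipode -/

namespace AntipodeData

variable {B L : Type*} [Ring B] [Algebra ℂ B] [Ring L] [Algebra ℂ L] {E : EnvRing B L}
  (D : AntipodeData E)

/-- Apply `S⁻¹` to the commutation of `s(a)` and `t(b)`, using `S⁻¹(s(a)) = t(a)`. -/
theorem S_s_comm (a b : B) : E.t a * D.Sinv (E.t b) = D.Sinv (E.t b) * E.t a := by
  rw [← D.Sinv_s a, ← Sinv_mul, ← Sinv_mul]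
  exact congrArg _ (E.comm a b).symm

/-- The base `s_R(b) = t_L(b)`, `t_R(b) = S⁻¹(t_L(b))` of the right bialgebroid. -/
def rbase : EnvRing Bᵐᵒᵖ L where
  src := (AlgEquiv.opOp ℂ L).symm.toAlgHom.comp (AlgHom.op E.tgt)
  tgt := AlgHom.op (D.antipode.symm.toAlgHom.comp E.tgt)
  comm a b := D.S_s_comm (unop a) (unop b)

theorem rbase_s (b : Bᵐᵒᵖ) : D.rbase.s b = E.t (unop b) := rfl

theorem rbase_t (b : Bᵐᵒᵖ) : D.rbase.t b = D.Sinv (E.t (unop b)) := rfl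

theorem Sinv_t_mul (b : B) (X : L) : D.Sinv (E.t b * X) = D.Sinv X * D.rbase.t (op b) :=
  D.Sinv_mul _ _

theorem Sinv_s_mul (b : B) (X : L) : D.Sinv (E.s b * X) = D.Sinv X * D.rbase.s (op b) := by
  rw [D.Sinv_mul, Sinv_s, rbase_s, unop_op]

theorem S_one : D.S 1 = 1 := by simp [S]

/-- The flip `X ⊗ Y ↦ S⁻¹(Y) ⊗ S⁻¹(X)`. -/
abbrev flip : E.LTens →ₗ[ℂ] D.rbase.RTens :=
  EnvRing.flipMap D.Sinv D.Sinv_t_mul D.Sinv_s_mul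

theorem flip_lmk (X Y : L) : D.flip (E.lmk X Y) = D.rbase.rmk (D.Sinv Y) (D.Sinv X) := rfl

/-- The antimultiplicative flip exchanges left with right multiplication and the first factor with
the second. This lemma and the following ones carry each axiom of the left bialgebroid to its mirror
image. -/
theorem rmulL_flip (U V : L) (Z : E.LTens) :
    D.rbase.rmulL U V (D.flip Z) = D.flip (E.lmulR (D.S V) (D.S U) Z) := by
  induction Z using BalTensor.mk_surj_induction with
  | hadd x y hx hy => simp only [map_add, hx, hy]
  | hmk X Y =>
    change D.rbase.rmk (U * D.Sinv Y) (V * D.Sinv X) =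
      D.rbase.rmk (D.Sinv (Y * D.S U)) (D.Sinv (X * D.S V))
    rw [Sinv_mul, Sinv_mul, Sinv_S, Sinv_S]

theorem ractL_flip (b : Bᵐᵒᵖ) (Z : E.LTens) :
    D.rbase.ractL b (D.flip Z) = D.flip (E.lactR (unop b) Z) := by
  induction Z using BalTensor.mk_surj_induction with
  | hadd x y hx hy => simp only [map_add, hx, hy]
  | hmk X Y =>
    change D.rbase.rmk (D.Sinv Y * D.rbase.t b) (D.Sinv X) =
      D.rbase.rmk (D.Sinv (E.t (unop b) * Y)) (D.Sinv X)
    rw [Sinv_t_mul, op_unop]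

theorem ractR_flip (b : Bᵐᵒᵖ) (Z : E.LTens) :
    D.rbase.ractR b (D.flip Z) = D.flip (E.lactL (unop b) Z) := by
  induction Z using BalTensor.mk_surj_induction with
  | hadd x y hx hy => simp only [map_add, hx, hy]
  | hmk X Y =>
    change D.rbase.rmk (D.Sinv Y) (D.Sinv X * D.rbase.s b) =
      D.rbase.rmk (D.Sinv Y) (D.Sinv (E.s (unop b) * X))
    rw [Sinv_s_mul, op_unop]

/-- The coproduct and the counit of the right bialgebroid. -/
def rightCoring : RightCoringData D.rbase where
  comul := D.flip ∘ₗ D.left.comul ∘ₗ D.S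
  counit := (opLinearEquiv ℂ).toLinearMap ∘ₗ D.left.counit ∘ₗ D.S
  comul_t a X := by
    simp only [LinearMap.comp_apply]
    rw [rbase_t, S_mul, S_Sinv, D.left.comul_t, ractL_flip]
  comul_s a X := by
    simp only [LinearMap.comp_apply]
    rw [rbase_s, S_mul, S_t, D.left.comul_s, ractR_flip]
  counit_t a X := by
    change op (D.left.counit (D.S (X * D.rbase.t a))) = a * op (D.left.counit (D.S X))
    rw [rbase_t, S_mul, S_Sinv, D.left.counit_t, op_mul, op_unop]
  counit_s a X := by
    change op (D.left.counit (D.S (X * D.rbase.s a))) = op (D.left.counit (D.S X)) * a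
    rw [rbase_s, S_mul, S_t, D.left.counit_s, op_mul, op_unop]

theorem rightCoring_comul (X : L) :
    D.rightCoring.comul X = D.flip (D.left.comul (D.S X)) := rfl

theorem rightCoring_counit (X : L) :
    D.rightCoring.counit X = op (D.left.counit (D.S X)) := rfl

/-- The flip `X ⊗ Y ⊗ Z ↦ S⁻¹(Z) ⊗ S⁻¹(Y) ⊗ S⁻¹(X)`. -/
def flip₃ : E.LTens₃ →ₗ[ℂ] D.rbase.RTens₃ :=
  BalTensor.lift (D.rbase.rinsertBilin.compl₁₂ D.Sinv D.flip).flip fun b Z Y => by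
    change D.rbase.rinsert (D.Sinv Y) (D.flip (E.lactR b Z)) =
      D.rbase.rinsert (D.Sinv (E.s b * Y)) (D.flip Z)
    rw [Sinv_s_mul, EnvRing.rinsert_bal, ractL_flip, unop_op]

theorem flip₃_linsert (X : L) (Z : E.LTens) : D.flip₃ (E.linsert X Z) =
    BalTensor.mk (fun b => D.rbase.ractR b) (fun b => LinearMap.mulRight ℂ (D.rbase.t b))
      (D.flip Z) (D.Sinv X) := by
  induction Z using BalTensor.mk_surj_induction with
  | hadd x y hx hy => simp only [map_add, hx, hy, LinearMap.add_apply]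
  | hmk U V => rfl

/-- Reversing the factors exchanges `Δ ⊗ id` with `id ⊗ Δ`, so left coassociativity yields right
coassociativity. -/
theorem comulId_flip (Z : E.LTens) :
    D.rightCoring.comulId (D.flip Z) = D.flip₃ (D.left.idComul Z) := by
  induction Z using BalTensor.mk_surj_induction with
  | hadd x y hx hy => simp only [map_add, hx, hy]
  | hmk X Y =>
    change BalTensor.mk _ _ (D.flip (D.left.comul (D.S (D.Sinv Y)))) (D.Sinv X) =
      D.flip₃ (E.linsert X (D.left.comul Y))
    rw [S_Sinv, flip₃_linsert]

theorem idComul_flip (Z : E.LTens) :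
    D.rightCoring.idComul (D.flip Z) = D.flip₃ (D.left.comulId Z) := by
  induction Z using BalTensor.mk_surj_induction with
  | hadd x y hx hy => simp only [map_add, hx, hy]
  | hmk X Y =>
    change D.rbase.rinsert (D.Sinv Y) (D.flip (D.left.comul (D.S (D.Sinv X)))) =
      D.rbase.rinsert (D.Sinv Y) (D.flip (D.left.comul X))
    rw [S_Sinv]

theorem counitId_flip (Z : E.LTens) :
    D.rightCoring.counitId (D.flip Z) = D.Sinv (D.left.idCounit Z) := by
  induction Z using BalTensor.mk_surj_induction with
  | hadd x y hx hy => simp only [map_add, hx, hy]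
  | hmk X Y =>
    change D.Sinv X * D.rbase.t (op (D.left.counit (D.S (D.Sinv Y)))) =
      D.Sinv (E.t (D.left.counit Y) * X)
    rw [S_Sinv, Sinv_t_mul]

theorem idCounit_flip (Z : E.LTens) :
    D.rightCoring.idCounit (D.flip Z) = D.Sinv (D.left.counitId Z) := by
  induction Z using BalTensor.mk_surj_induction with
  | hadd x y hx hy => simp only [map_add, hx, hy]
  | hmk X Y =>
    change D.Sinv Y * D.rbase.s (op (D.left.counit (D.S (D.Sinv X)))) =
      D.Sinv (E.s (D.left.counit X) * Y)
    rw [S_Sinv, Sinv_s_mul]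

theorem flip_mem_rtakeuchi {Z : E.LTens} (hZ : Z ∈ E.ltakeuchi) :
    D.flip Z ∈ D.rbase.rtakeuchi := fun a => by
  rw [rmulL_flip, rmulL_flip, S_one, rbase_s, rbase_t, S_t, S_Sinv]
  exact congrArg _ (hZ (unop a)).symm

theorem rtMul_flip {Z : E.LTens} (hZ : Z ∈ E.ltakeuchi) (hZ' : D.flip Z ∈ D.rbase.rtakeuchi)
    (W : E.LTens) : D.rbase.rtMul ⟨D.flip Z, hZ'⟩ (D.flip W) = D.flip (E.ltMul ⟨Z, hZ⟩ W) := by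
  induction W using BalTensor.mk_surj_induction with
  | hadd x y hx hy => simp only [map_add, hx, hy]
  | hmk U V =>
    change D.rbase.rmulL (D.Sinv V) (D.Sinv U) (D.flip Z) = D.flip (E.lmulR U V Z)
    rw [rmulL_flip, S_Sinv, S_Sinv]

/-- The right bialgebroid structure over `Bᵐᵒᵖ` induced by the antipode. -/
def right : RightBialgebroid D.rbase where
  toRightCoringData := D.rightCoring
  coassoc X := by
    rw [rightCoring_comul, comulId_flip, idComul_flip, ← D.left.coassoc]
  counit_comul X := by
    rw [rightCoring_comul, counitId_flip, D.left.comul_counit, Sinv_S]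
  comul_counit X := by
    rw [rightCoring_comul, idCounit_flip, D.left.counit_comul, Sinv_S]
  comul_mem X := D.flip_mem_rtakeuchi (D.left.comul_mem _)
  comul_one := by
    rw [rightCoring_comul, S_one, D.left.comul_one, flip_lmk]
    simp [Sinv]
  comul_mul X Y := by
    refine Eq.trans ?_ (D.rtMul_flip (D.left.comul_mem (D.S Y)) _ _).symm
    rw [rightCoring_comul, S_mul, D.left.comul_mul, LinearMap.comp_apply]
  counit_one := by
    rw [rightCoring_counit, S_one, D.left.counit_one, op_one]
  counit_s_mul X Y := by
    rw [rightCoring_counit, rightCoring_counit, rightCoring_counit, rbase_s, S_mul, S_mul, S_t,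
      D.left.counit_mul_s, unop_op]
  counit_t_mul X Y := by
    rw [rightCoring_counit, rightCoring_counit, rightCoring_counit, rbase_t, S_mul, S_mul, S_Sinv,
      D.left.counit_mul_t, unop_op]

end AntipodeData

/-! ### The flip antipode, for commutative `H` -/

namespace ComoduleAlgebra

section Flip

set_option maxSynthPendingDepth 3

variable {P H : Type*} [Ring P] [Algebra ℂ P] [CommRing H] [HopfAlgebra ℂ H]
  {δ : ComoduleAlgebra P H}

/-- Commutativity of `H` identifies `q₍₁₎ p₍₁₎` with `p₍₁₎ q₍₁₎`, so the flip is a comodule map and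
preserves `L`. -/
theorem codiag₂_comm (x : P ⊗[ℂ] P) : δ.codiag₂ (TensorProduct.comm ℂ P P x) =
    (TensorProduct.comm ℂ P P).toLinearMap.rTensor H (δ.codiag₂ x) := by
  induction x with
  | zero => simp
  | add x y hx hy => simp only [map_add, hx, hy]
  | tmul p q =>
    rw [TensorProduct.comm_tmul, codiag_tmul, codiag_tmul, AlgHom.toLinearMap_apply,
      AlgHom.toLinearMap_apply]
    induction δ.coact p with
    | zero => simp
    | add x x' hx hx' =>
      simp only [TensorProduct.add_tmul, TensorProduct.tmul_add, map_add, hx, hx']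
    | tmul w d =>
    induction δ.coact q with
    | zero => simp
    | add y y' hy hy' =>
      simp only [TensorProduct.add_tmul, TensorProduct.tmul_add, map_add, hy, hy']
    | tmul p e => simp [mul_comm]

theorem comm_legMul (x y : P ⊗[ℂ] P) : TensorProduct.comm ℂ P P (legMul P x y) =
    legMul P (TensorProduct.comm ℂ P P y) (TensorProduct.comm ℂ P P x) := by
  induction x with
  | zero => simp
  | add a b ha hb => simp only [map_add, LinearMap.add_apply, ha, hb]
  | tmul p q =>
  induction y with
  | zero => simp
  | add a b ha hb => simp only [map_add, LinearMap.add_apply, ha, hb]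
  | tmul r u => simp

namespace CoinvariantRing

variable {L : Type*} [Ring L] [Algebra ℂ L] {E : EnvRing δ.coinv L} (D : δ.CoinvariantRing E)

theorem comm_leg_mem (X : L) : TensorProduct.comm ℂ P P (D.leg X) ∈ Set.range D.leg := by
  rw [← D.range_leg, codiag₂_comm, D.codiag₂_leg]
  rfl

/-- The flip `p ⊗ q ↦ q ⊗ p` on `L`. -/
noncomputable def swap : L →ₗ[ℂ] L :=
  (LinearEquiv.ofInjective D.leg D.leg_injective).symm.toLinearMap ∘ₗ
    ((TensorProduct.comm ℂ P P).toLinearMap ∘ₗ D.leg).codRestrict (LinearMap.range D.leg)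
      D.comm_leg_mem

@[simp]
theorem leg_swap (X : L) : D.leg (D.swap X) = TensorProduct.comm ℂ P P (D.leg X) := by
  have h : LinearEquiv.ofInjective D.leg D.leg_injective (D.swap X) =
      ((TensorProduct.comm ℂ P P).toLinearMap ∘ₗ D.leg).codRestrict (LinearMap.range D.leg)
        D.comm_leg_mem X := LinearEquiv.apply_symm_apply _ _
  exact congrArg Subtype.val h

theorem swap_swap (X : L) : D.swap (D.swap X) = X := D.leg_injective <| by
  rw [leg_swap, leg_swap, ← LinearEquiv.trans_apply]
  simp

/-- The flip `p ⊗ q ↦ q ⊗ p` as an isomorphism from `L` to its opposite algebra. -/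
noncomputable def swapEquiv : L ≃ₐ[ℂ] Lᵐᵒᵖ :=
  AlgEquiv.ofLinearEquiv
    ((LinearEquiv.ofInvolutive D.swap D.swap_swap).trans (opLinearEquiv ℂ))
    (unop_injective <| D.leg_injective <| by
      change D.leg (D.swap 1) = D.leg 1
      rw [leg_swap, D.leg_one, TensorProduct.comm_tmul])
    fun X Y => unop_injective <| D.leg_injective <| by
      change D.leg (D.swap (X * Y)) = D.leg (D.swap Y * D.swap X)
      rw [leg_swap, D.leg_mul, D.leg_mul, leg_swap, leg_swap, comm_legMul]

theorem leg_swapEquiv (X : L) :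
    D.leg (unop (D.swapEquiv X)) = TensorProduct.comm ℂ P P (D.leg X) := D.leg_swap X

end CoinvariantRing

end Flip

section Reverse

set_option maxSynthPendingDepth 3

variable {P : Type*} [Ring P] [Algebra ℂ P]

/-- The reversal `x ⊗ y ⊗ z ↦ z ⊗ y ⊗ x`. -/
noncomputable def reverse (P : Type*) [Ring P] [Algebra ℂ P] :
    (P ⊗[ℂ] P) ⊗[ℂ] P →ₗ[ℂ] (P ⊗[ℂ] P) ⊗[ℂ] P :=
  (TensorProduct.comm ℂ P P).toLinearMap.rTensor P ∘ₗ
    (TensorProduct.comm ℂ P (P ⊗[ℂ] P)).toLinearMap ∘ₗ (TensorProduct.assoc ℂ P P P).toLinearMap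

@[simp]
theorem reverse_tmul (x y z : P) : reverse P ((x ⊗ₜ y) ⊗ₜ z) = (z ⊗ₜ y) ⊗ₜ x := by
  simp [reverse]

theorem reverse_insertOne (x : P ⊗[ℂ] P) :
    reverse P (insertOne P P x) = insertOne P P (TensorProduct.comm ℂ P P x) := by
  induction x with
  | zero => simp
  | add a b ha hb => simp only [map_add, ha, hb]
  | tmul p q => simp

end Reverse

/-! ### The `*`-structures on `B` and `L` -/

section Star

set_option maxSynthPendingDepth 3

variable {P H : Type*} [Ring P] [Algebra ℂ P] [StarRing P] [StarModule ℂ P] [CommRing H]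
  [HopfAlgebra ℂ H] [StarRing H] [StarModule ℂ H] {δ : ComoduleAlgebra P H}

theorem star_mem_coinv (hδ : δ.IsUnitary) {b : P} (hb : b ∈ δ.coinv) : star b ∈ δ.coinv := by
  change δ.coact b = b ⊗ₜ 1 at hb
  change δ.coact (star b) = star b ⊗ₜ 1
  rw [hδ, hb, TensorProduct.star_tmul, star_one]

/-- The `*`-structure on the coinvariants. -/
@[reducible]
def coinvStarRing (hδ : δ.IsUnitary) : StarRing δ.coinv where
  star b := ⟨star (b : P), star_mem_coinv hδ b.2⟩
  star_involutive _ := Subtype.ext (star_star _)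
  star_mul _ _ := Subtype.ext (star_mul _ _)
  star_add _ _ := Subtype.ext (star_add _ _)

/-- The star of `H` reverses `p₍₁₎ q₍₁₎`; commutativity of `H` restores the order. -/
theorem codiag₂_star (hδ : δ.IsUnitary) (x : P ⊗[ℂ] P) :
    δ.codiag₂ (star x) = star (δ.codiag₂ x) := by
  induction x with
  | zero => simp
  | add x y hx hy => simp only [map_add, star_add, hx, hy]
  | tmul p q =>
    rw [TensorProduct.star_tmul, codiag_tmul, codiag_tmul, AlgHom.toLinearMap_apply,
      AlgHom.toLinearMap_apply, hδ, hδ]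
    induction δ.coact p with
    | zero => simp
    | add x x' hx hx' => simp only [TensorProduct.add_tmul, map_add, star_add, hx, hx']
    | tmul w d =>
    induction δ.coact q with
    | zero => simp
    | add y y' hy hy' => simp only [TensorProduct.tmul_add, map_add, star_add, hy, hy']
    | tmul p e => simp [TensorProduct.star_tmul]

theorem legMul_star (x y : P ⊗[ℂ] P) : star (legMul P x y) = legMul P (star y) (star x) := by
  induction x with
  | zero => simp
  | add a b ha hb => simp only [map_add, star_add, LinearMap.add_apply, ha, hb]
  | tmul p q =>
  induction y with
  | zero => simp
  | add a b ha hb => simp only [map_add, star_add, LinearMap.add_apply, ha, hb]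
  | tmul r u => simp [TensorProduct.star_tmul]

namespace CoinvariantRing

variable {L : Type*} [Ring L] [Algebra ℂ L] {E : EnvRing δ.coinv L} (D : δ.CoinvariantRing E)

theorem star_leg_mem (hδ : δ.IsUnitary) (X : L) : star (D.leg X) ∈ Set.range D.leg := by
  rw [← D.range_leg, codiag₂_star hδ, D.codiag₂_leg, TensorProduct.star_tmul, star_one]

/-- The star `p ⊗ q ↦ p^* ⊗ q^*` on `L`. -/
noncomputable def starFun (hδ : δ.IsUnitary) (X : L) : L := (D.star_leg_mem hδ X).choose

theorem leg_starFun (hδ : δ.IsUnitary) (X : L) : D.leg (D.starFun hδ X) = star (D.leg X) :=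
  (D.star_leg_mem hδ X).choose_spec

/-- The `*`-structure `(p ⊗ q)^* = p^* ⊗ q^*` on `L`. -/
@[reducible]
noncomputable def starRing (hδ : δ.IsUnitary) : StarRing L where
  star := D.starFun hδ
  star_involutive X := D.leg_injective <| by
    rw [leg_starFun, leg_starFun, star_star]
  star_mul X Y := D.leg_injective <| by
    rw [leg_starFun, D.leg_mul, D.leg_mul, leg_starFun, leg_starFun, legMul_star]
  star_add X Y := D.leg_injective <| by
    simp only [map_add, leg_starFun, star_add]

theorem starModule (hδ : δ.IsUnitary) : letI := D.starRing hδ; StarModule ℂ L :=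
  letI := D.starRing hδ
  ⟨fun c X => D.leg_injective <| by
    change D.leg (D.starFun hδ (c • X)) = D.leg (star c • D.starFun hδ X)
    rw [leg_starFun, map_smul, map_smul, leg_starFun, star_smul]⟩

end CoinvariantRing

theorem star_insertOne (x : P ⊗[ℂ] P) : star (insertOne P P x) = insertOne P P (star x) := by
  induction x with
  | zero => simp
  | add a b ha hb => simp only [map_add, star_add, ha, hb]
  | tmul p q => simp [TensorProduct.star_tmul]

/-- Fusing `S(Y^*) ⊗ S(X^*)` gives `u^* ⊗ r^* q^* ⊗ p^*`, the star of the reversed fused tensor of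
`X = p ⊗ q` and `Y = r ⊗ u`. -/
theorem fuseTensor_comm_star (x y : P ⊗[ℂ] P) :
    fuseTensor P P (TensorProduct.comm ℂ P P (star y)) (TensorProduct.comm ℂ P P (star x)) =
      star (reverse P (fuseTensor P P x y)) := by
  induction x with
  | zero => simp
  | add a b ha hb => simp only [map_add, star_add, LinearMap.add_apply, ha, hb]
  | tmul p q =>
  induction y with
  | zero => simp
  | add a b ha hb => simp only [map_add, star_add, LinearMap.add_apply, ha, hb]
  | tmul r u => simp [TensorProduct.star_tmul]

theorem mul'_star (x : P ⊗[ℂ] P) : LinearMap.mul' ℂ P (star x) =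
    star (LinearMap.mul' ℂ P (TensorProduct.comm ℂ P P x)) := by
  induction x with
  | zero => simp
  | add a b ha hb => simp only [map_add, star_add, ha, hb]
  | tmul p q => simp [TensorProduct.star_tmul]

end Star

/-! ### The full `*`-Hopf algebroid -/

namespace CoinvariantRing

section

set_option maxSynthPendingDepth 3

variable {P : Type u} {H : Type v} [Ring P] [Algebra ℂ P] [CommRing H] [HopfAlgebra ℂ H]
  {δ : ComoduleAlgebra P H} {L : Type u} [Ring L] [Algebra ℂ L] {E : EnvRing δ.coinv L}
  (D : δ.CoinvariantRing E) (hgal : δ.IsGalois)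
  (hflat : IsFaithfullyFlatLeft.{max u v} δ.coinv P)

/-- The full Hopf algebroid on `L`, with antipode `p ⊗ q ↦ q ⊗ p`. -/
noncomputable def fullHopfAlgebroid : FullHopfAlgebroid E where
  toAntipodeData := D.antipodeData hgal hflat D.swapEquiv D.leg_swapEquiv
  antipode_inv_comul := D.mapSinv_comul hgal hflat D.swapEquiv D.leg_swapEquiv
  antipode_comul := D.mapS_comul hgal hflat D.swapEquiv D.leg_swapEquiv
  rbase := (D.antipodeData hgal hflat D.swapEquiv D.leg_swapEquiv).rbase
  rbase_s _ := rfl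
  rbase_t _ := rfl
  right := (D.antipodeData hgal hflat D.swapEquiv D.leg_swapEquiv).right
  right_counit _ := rfl
  right_comul _ := rfl

variable [StarRing P] [StarModule ℂ P] [StarRing δ.coinv] [StarModule ℂ δ.coinv] [StarRing L]
  [StarModule ℂ L]

theorem fullHopfAlgebroid_isStar (hB : ∀ b : δ.coinv, ((star b : δ.coinv) : P) = star (b : P))
    (hL : ∀ X, D.leg (star X) = star (D.leg X)) : (D.fullHopfAlgebroid hgal hflat).IsStar := by
  let A := D.antipodeData hgal hflat D.swapEquiv D.leg_swapEquiv
  have hSinv : ∀ X, D.leg (A.Sinv X) = TensorProduct.comm ℂ P P (D.leg X) :=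
    D.leg_Sinv hgal hflat D.swapEquiv D.leg_swapEquiv
  have hS : ∀ X, D.leg (A.S X) = TensorProduct.comm ℂ P P (D.leg X) := D.leg_swap
  have star_s : ∀ b, star (E.s b) = A.rbase.t (op (star b)) := fun b => D.leg_injective <| by
    rw [hL, A.rbase_t, unop_op, hSinv, D.leg_s, D.leg_t, TensorProduct.star_tmul, star_one, hB,
      TensorProduct.comm_tmul]
  have star_t : ∀ b, star (E.t b) = A.rbase.s (op (star b)) := fun b => D.leg_injective <| by
    rw [hL, A.rbase_s, unop_op, D.leg_t, D.leg_t, TensorProduct.star_tmul, star_one, hB]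
  refine ⟨star_s, star_t, fun X => unop_injective (Subtype.ext ?_), fun X => ?_⟩
  · change LinearMap.mul' ℂ P (D.leg (star X)) = ((star (D.counit (A.S X)) : δ.coinv) : P)
    rw [hB, coe_counit, hL, hS, mul'_star]
  -- Every starred tensor is `flip W` for some `W` whose fused form is known; on generators `W =
  -- S(Y^*) ⊗ S(X^*)`. It then suffices to show that `Δ(S(X^*)) = W` when `Z = Δ(X)`, and there both
  -- sides fuse to `q^* ⊗ 1 ⊗ p^*`.
  · have key : ∀ Z : E.LTens, ∃ W : E.LTens,
        EnvRing.starMap (E := E) (F := A.rbase) star_s star_t Z = A.flip W ∧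
          D.fuse W = star (reverse P (D.fuse Z)) := by
      intro Z
      induction Z using BalTensor.mk_surj_induction with
      | hadd x y hx hy =>
        obtain ⟨V, hV, hV'⟩ := hx
        obtain ⟨W, hW, hW'⟩ := hy
        exact ⟨V + W, by rw [map_add, map_add, hV, hW],
          by rw [map_add, map_add, map_add, star_add, hV', hW']⟩
      | hmk X Y =>
        refine ⟨E.lmk (A.S (star Y)) (A.S (star X)), ?_, ?_⟩
        · rw [A.flip_lmk, A.Sinv_S, A.Sinv_S]
          rfl
        · change _ = star (reverse P (fuseTensor P P (D.leg X) (D.leg Y)))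
          rw [fuse_lmk, hS, hS, hL, hL, fuseTensor_comm_star]
    obtain ⟨W, hW, hW'⟩ := key (D.comul hgal hflat X)
    refine Eq.trans ?_ hW.symm
    change A.flip (D.comul hgal hflat (A.S (star X))) = A.flip W
    congr 1
    refine D.fuse_injective hgal hflat ?_
    rw [hW', fuse_comul, fuse_comul, hS, hL, reverse_insertOne, star_insertOne]
    congr 1
    induction D.leg X with
    | zero => simp
    | add a b ha hb => simp only [map_add, star_add, ha, hb]
    | tmul p q => simp [TensorProduct.star_tmul]

end

end CoinvariantRing

end ComoduleAlgebra

/-! ### Comparison with the Ehresmann-Schauenburg algebra and its coproduct formula -/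

namespace ComoduleAlgebra

section Legs

set_option maxSynthPendingDepth 3

variable {P H : Type*} [Ring P] [Algebra ℂ P] [Ring H] [HopfAlgebra ℂ H] (δ : ComoduleAlgebra P H)

/-- The inclusion of `L(P, H)` in `P ⊗ P`. -/
noncomputable def leg : δ.ES →ₗ[ℂ] P ⊗[ℂ] P :=
  (opLinearEquiv ℂ).symm.toLinearMap.lTensor P ∘ₗ δ.ES.val.toLinearMap

/-- The identification of `P ⊗ Pᵐᵒᵖ` and `P ⊗ P`. -/
noncomputable def unopEquiv (P : Type*) [Ring P] [Algebra ℂ P] : P ⊗[ℂ] Pᵐᵒᵖ ≃ₗ[ℂ] P ⊗[ℂ] P :=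
  (opLinearEquiv ℂ).symm.lTensor P

@[simp]
theorem unopEquiv_tmul (p : P) (q : Pᵐᵒᵖ) : unopEquiv P (p ⊗ₜ q) = p ⊗ₜ unop q := rfl

theorem leg_apply (X : δ.ES) : δ.leg X = unopEquiv P X := rfl

theorem leg_injective : Function.Injective δ.leg :=
  (unopEquiv P).injective.comp Subtype.val_injective

theorem codiag₂_unopEquiv (x : P ⊗[ℂ] Pᵐᵒᵖ) :
    δ.codiag₂ (unopEquiv P x) = (unopEquiv P).toLinearMap.rTensor H (δ.diag x) := by
  induction x with
  | zero => simp
  | add x y hx hy => simp only [map_add, hx, hy]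
  | tmul p q =>
    obtain ⟨q, rfl⟩ := op_surjective q
    rw [diag_tmul, unopEquiv_tmul, unop_op, codiag_tmul, AlgHom.toLinearMap_apply]
    induction δ.coact p with
    | zero => simp
    | add x x' hx hx' => simp only [TensorProduct.add_tmul, map_add, hx, hx', LinearMap.add_apply]
    | tmul w d =>
    induction δ.coact q with
    | zero => simp
    | add y y' hy hy' => simp only [TensorProduct.tmul_add, map_add, hy, hy']
    | tmul p e => simp

theorem codiag₂_eq_iff (x : P ⊗[ℂ] P) : δ.codiag₂ x = x ⊗ₜ 1 ↔ x ∈ Set.range δ.leg := by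
  have hinj : Function.Injective ((unopEquiv P).toLinearMap.rTensor H) :=
    ((unopEquiv P).rTensor H).injective
  obtain ⟨y, rfl⟩ := (unopEquiv P).surjective x
  have h : unopEquiv P y ⊗ₜ[ℂ] (1 : H) = (unopEquiv P).toLinearMap.rTensor H (y ⊗ₜ 1) := rfl
  rw [codiag₂_unopEquiv, h, hinj.eq_iff]
  constructor
  · exact fun hy => ⟨⟨y, hy⟩, rfl⟩
  · rintro ⟨X, hX⟩
    rw [leg_apply, (unopEquiv P).injective.eq_iff] at hX
    rw [← hX]
    exact X.2

theorem leg_mul (X Y : δ.ES) : δ.leg (X * Y) = legMul P (δ.leg X) (δ.leg Y) := by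
  rw [leg_apply, leg_apply, leg_apply, Subalgebra.coe_mul]
  generalize (X : P ⊗[ℂ] Pᵐᵒᵖ) = x
  generalize (Y : P ⊗[ℂ] Pᵐᵒᵖ) = y
  induction x with
  | zero => simp
  | add x y hx hy => simp only [map_add, hx, hy, add_mul, LinearMap.add_apply]
  | tmul p q =>
  induction y with
  | zero => simp
  | add x y hx hy => simp only [map_add, hx, hy, mul_add]
  | tmul r u => simp

theorem leg_s (b : δ.coinv) : δ.leg (δ.ESbase.s b) = (b : P) ⊗ₜ 1 := rfl

theorem leg_t (b : δ.coinv) : δ.leg (δ.ESbase.t b) = 1 ⊗ₜ (b : P) := rfl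

theorem leg_one : δ.leg 1 = 1 ⊗ₜ 1 := rfl


/-- The algebra `L(P, H)` as a presentation of `(P ⊗ P)^{co H}`. -/
noncomputable def coinvariantRing : δ.CoinvariantRing δ.ESbase where
  leg := δ.leg
  leg_injective := δ.leg_injective
  range_leg := δ.codiag₂_eq_iff
  leg_mul := δ.leg_mul
  leg_one := δ.leg_one
  leg_s := δ.leg_s
  leg_t := δ.leg_t

theorem unopEquiv_flipMap (x : P ⊗[ℂ] Pᵐᵒᵖ) :
    unopEquiv P (flipMap x) = TensorProduct.comm ℂ P P (unopEquiv P x) := by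
  induction x with
  | zero => simp
  | add x y hx hy => simp only [map_add, hx, hy]
  | tmul p q => simp [flipMap]

/-- The map `((p ⊗ q) ⊗ h) ⊗ u ↦ p ⊗ ((q ⊗ h) ⊗ u)`. -/
noncomputable def regroup (P H : Type*) [Ring P] [Algebra ℂ P] [Ring H] [Algebra ℂ H] :
    ((P ⊗[ℂ] P) ⊗[ℂ] H) ⊗[ℂ] P ≃ₗ[ℂ] P ⊗[ℂ] ((P ⊗[ℂ] H) ⊗[ℂ] Pᵐᵒᵖ) :=
  ((TensorProduct.assoc ℂ P P H).rTensor P).trans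
    ((TensorProduct.assoc ℂ P (P ⊗[ℂ] H) P).trans
      (((opLinearEquiv ℂ).lTensor (P ⊗[ℂ] H)).lTensor P))

@[simp]
theorem regroup_tmul (p q u : P) (h : H) :
    regroup P H (((p ⊗ₜ q) ⊗ₜ h) ⊗ₜ u) = p ⊗ₜ ((q ⊗ₜ h) ⊗ₜ op u) := rfl

/-- The canonical map on the middle factor of `P ⊗ (P ⊗_B P) ⊗ P`. -/
noncomputable def canMid : P ⊗[ℂ] (δ.PBP ⊗[ℂ] Pᵐᵒᵖ) →ₗ[ℂ] P ⊗[ℂ] ((P ⊗[ℂ] H) ⊗[ℂ] Pᵐᵒᵖ) :=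
  (δ.can.rTensor Pᵐᵒᵖ).lTensor P

@[simp]
theorem canMid_tmul (p : P) (z : δ.PBP) (u : Pᵐᵒᵖ) :
    δ.canMid (p ⊗ₜ (z ⊗ₜ u)) = p ⊗ₜ (δ.can z ⊗ₜ u) := rfl

variable {δ} in
-- Only injectivity of `χ` is used; tensoring over the field `ℂ` preserves it.
theorem canMid_injective (hgal : δ.IsGalois) : Function.Injective δ.canMid :=
  Module.Flat.lTensor_preserves_injective_linearMap _
    (Module.Flat.rTensor_preserves_injective_linearMap _ hgal.1)

theorem codiag₂_injective : Function.Injective δ.codiag₂ :=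
  Function.LeftInverse.injective (g := fun z => TensorProduct.rid ℂ (P ⊗[ℂ] P)
    ((Coalgebra.counit (R := ℂ) (A := H)).lTensor (P ⊗[ℂ] P) z)) (δ.codiag_counit δ.counit)

theorem can_mk (q r : P) : δ.can (BalTensor.mk _ _ q r) = (q ⊗ₜ 1) * δ.coact r := rfl

theorem canMid_middle (x y : P ⊗[ℂ] Pᵐᵒᵖ) : δ.canMid (δ.middle (x ⊗ₜ y)) =
    regroup P H ((((lastAct P P).orbit (unopEquiv P x)).rTensor H ∘ₗ
      δ.coact.toLinearMap).rTensor P (unopEquiv P y)) := by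
  induction y with
  | zero => simp
  | add y y' hy hy' => simp only [TensorProduct.tmul_add, map_add, hy, hy']
  | tmul r u =>
    obtain ⟨u, rfl⟩ := op_surjective u
    rw [unopEquiv_tmul, LinearMap.rTensor_tmul, LinearMap.comp_apply, AlgHom.toLinearMap_apply,
      unop_op]
    rw [← (lastAct P P).orbitₗ_apply]
    induction x with
    | zero =>
      simp only [TensorProduct.zero_tmul, map_zero, LinearMap.rTensor_zero, LinearMap.zero_apply]
    | add x x' hx hx' =>
      simp only [TensorProduct.add_tmul, map_add, LinearMap.rTensor_add, LinearMap.add_apply, hx,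
        hx']
    | tmul p q =>
      obtain ⟨q, rfl⟩ := op_surjective q
      rw [middle_tmul, canMid_tmul, can_mk, unopEquiv_tmul, unop_op, IsRightAction.orbitₗ_apply]
      induction δ.coact r with
      | zero => simp
      | add z z' hz hz' =>
        simp only [mul_add, TensorProduct.add_tmul, TensorProduct.tmul_add, map_add, hz, hz']
      | tmul r h => simp

/-- By `χ(τ(h)) = 1 ⊗ h`, the formula becomes `p₍₀₎ ⊗ 1 ⊗ p₍₁₎ ⊗ q`, which is the diagonal coaction
applied to `p ⊗ 1`, with `q` carried along. -/
theorem canMid_comulFormula (hgal : δ.IsGalois) (x : P ⊗[ℂ] Pᵐᵒᵖ) :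
    δ.canMid (δ.comulFormula hgal x) =
      regroup P H (δ.codiag₂.rTensor P (insertOne P P (unopEquiv P x))) := by
  induction x with
  | zero => simp
  | add x y hx hy => simp only [map_add, hx, hy]
  | tmul p u =>
    obtain ⟨u, rfl⟩ := op_surjective u
    rw [unopEquiv_tmul, insertOne_tmul, LinearMap.rTensor_tmul, codiag₂_tmul_one]
    change δ.canMid (TensorProduct.assoc ℂ P δ.PBP Pᵐᵒᵖ
      ((δ.translation hgal).lTensor P (δ.coact p) ⊗ₜ op u)) = _
    induction δ.coact p with
    | zero => simp
    | add x x' hx hx' => simp only [TensorProduct.add_tmul, map_add, hx, hx']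
    | tmul w d => simp [can_translation]

/-- For `X` in `L`, `X r₍₀₎ ⊗ r₍₁₎` is the diagonal coaction of `X r` by `orbit_leg`. Thus `χ` on
the middle factor converts `expand` into `fuse`, up to an injective map. -/
theorem canMid_expand (Z : δ.ESbase.LTens) : δ.canMid (δ.expand Z) =
    regroup P H (δ.codiag₂.rTensor P (δ.coinvariantRing.fuse Z)) := by
  induction Z using BalTensor.mk_surj_induction with
  | hadd x y hx hy => simp only [map_add, hx, hy]
  | hmk X Y =>
    refine (δ.canMid_middle _ _).trans (congrArg _ ?_)
    change _ = δ.codiag₂.rTensor P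
      (((lastAct P P).orbit (δ.coinvariantRing.leg X)).rTensor P (δ.coinvariantRing.leg Y))
    rw [← LinearMap.rTensor_comp_apply]
    exact LinearMap.congr_fun (congrArg (LinearMap.rTensor P)
      (LinearMap.ext fun p => (δ.coinvariantRing.orbit_leg X p).symm)) _

end Legs

section Ehresmann

set_option maxSynthPendingDepth 3

variable {P : Type u} {H : Type v} [Ring P] [Algebra ℂ P] [Ring H] [HopfAlgebra ℂ H]
  {δ : ComoduleAlgebra P H} (hgal : δ.IsGalois)
  (hflat : IsFaithfullyFlatLeft.{max u v} δ.coinv P)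

include hgal hflat in
theorem expand_injective : Function.Injective δ.expand := by
  -- The composite with `canMid` is injective because `fuse`, `codiag₂ ⊗ id` and `regroup` are.
  refine Function.Injective.of_comp (f := δ.canMid) fun Z W h => ?_
  rw [Function.comp_apply, Function.comp_apply, canMid_expand, canMid_expand] at h
  exact δ.coinvariantRing.fuse_injective hgal hflat
    (Module.Flat.rTensor_preserves_injective_linearMap _ δ.codiag₂_injective
      ((regroup P H).injective h))

theorem isESBialgebroid :
    δ.IsESBialgebroid hgal (δ.coinvariantRing.leftBialgebroid hgal hflat) where
  comul_eq X := canMid_injective hgal <| by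
    rw [canMid_comulFormula, canMid_expand]
    exact congrArg (fun z => regroup P H (δ.codiag₂.rTensor P z))
      (δ.coinvariantRing.fuse_comul hgal hflat X)
  counit_eq X := rfl

end Ehresmann

theorem unopEquiv_tensorStar {P : Type*} [Ring P] [Algebra ℂ P] [StarRing P] [StarModule ℂ P]
    (x : P ⊗[ℂ] Pᵐᵒᵖ) : unopEquiv P (tensorStar P x) = star (unopEquiv P x) := by
  induction x with
  | zero => simp
  | add x y hx hy => simp only [map_add, star_add, hx, hy]
  | tmul p q =>
    obtain ⟨q, rfl⟩ := op_surjective q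
    rw [tensorStar_tmul, unopEquiv_tmul, unopEquiv_tmul, TensorProduct.star_tmul, unop_op, unop_op]

end ComoduleAlgebra

/-- Let `P` be a `*`-algebra and `H` a commutative Hopf `*`-algebra over `ℂ`, and let `δ` be a unitary
coaction making `P` a faithfully flat `H`-Galois extension of `B = P^{co H}`.  Then the
Ehresmann-Schauenburg bialgebroid `L(P, H)`, with antipode `p ⊗ q ↦ q ⊗ p`, is a full `*`-Hopf
algebroid for `b ↦ b^*` on `B` and `(p ⊗ q)^* = p^* ⊗ q^*` on `L(P, H)`.  The injectivity of
`δ.expand` says that the formula for the coproduct determines it. -/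
theorem proposition3p10 {P : Type u} {H : Type v} [Ring P] [Algebra ℂ P] [StarRing P]
    [StarModule ℂ P] [CommRing H] [HopfAlgebra ℂ H] [StarRing H] [StarModule ℂ H]
    (hH : IsHopfStarAlgebra H) (δ : ComoduleAlgebra P H) (hunit : δ.IsUnitary)
    (hgal : δ.IsGalois) (hflat : IsFaithfullyFlatLeft.{max u v} δ.coinv P) :
    Function.Injective δ.expand ∧
    ∃ (_ : StarRing δ.coinv) (_ : StarModule ℂ δ.coinv) (_ : StarRing δ.ES)
      (_ : StarModule ℂ δ.ES) (𝓗 : FullHopfAlgebroid δ.ESbase),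
      δ.IsESBialgebroid hgal 𝓗.left ∧
      (∀ X : δ.ES, (𝓗.S X : P ⊗[ℂ] Pᵐᵒᵖ) = ComoduleAlgebra.flipMap (X : P ⊗[ℂ] Pᵐᵒᵖ)) ∧
      𝓗.IsStar ∧
      (∀ b : δ.coinv, ((star b : δ.coinv) : P) = star (b : P)) ∧
      (∀ X : δ.ES, ((star X : δ.ES) : P ⊗[ℂ] Pᵐᵒᵖ) = tensorStar P (X : P ⊗[ℂ] Pᵐᵒᵖ)) := by
  let D := δ.coinvariantRing
  let _ := ComoduleAlgebra.coinvStarRing hunit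
  have : StarModule ℂ δ.coinv := ⟨fun c b => Subtype.ext (star_smul c (b : P))⟩
  let _ := D.starRing hunit
  have := D.starModule hunit
  have hstar : ∀ X : δ.ES, D.leg (star X) = star (D.leg X) := D.leg_starFun hunit
  refine ⟨ComoduleAlgebra.expand_injective hgal hflat, inferInstance, inferInstance, inferInstance,
    inferInstance, D.fullHopfAlgebroid hgal hflat, ComoduleAlgebra.isESBialgebroid hgal hflat,
    fun X => (ComoduleAlgebra.unopEquiv P).injective ?_,
    D.fullHopfAlgebroid_isStar hgal hflat (fun _ => rfl) hstar, fun _ => rfl,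
    fun X => (ComoduleAlgebra.unopEquiv P).injective ?_⟩
  · rw [ComoduleAlgebra.unopEquiv_flipMap]
    exact D.leg_swap X
  · rw [ComoduleAlgebra.unopEquiv_tensorStar]
    exact hstar X
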